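/- Let $2\le p\le\infty$, let $q=p/(p-1)$ be the conjugate exponent ($q=1$ if $p=\infty$), and let $\nu<1$ be real. Let $L_{\nu,p}(\mathbb{R}_+)$ be the space of (classes of) measurable functions $f:(0,\infty)\to\mathbb{C}$ with finite norm $$\|f\|_{\nu,p}=\Big(\int_0^\infty x^{\nu p-1}|f(x)|^p\,dx\Big)^{1/p}\quad(p<\infty),\qquad \|f\|_{\nu,\infty}=\operatorname*{ess\,sup}_{x>0}|x^\nu f(x)| .$$ Let $J_\mu$ be the Bessel function of the first kind and $K_\mu$ the Macdonald (modified Bessel) function. For $f\in L_{\nu,p}(\mathbb{R}_+)$ the integral $$(Ff)(\tau)=\frac{1}{\sinh(\pi\tau/2)}\int_0^\infty K_{i\tau}(2\sqrt{2x})\,\mathrm{Im}\big[J_{i\tau}(2\sqrt{2x})\big]f(x)\,dx$$ converges absolutely for every real $\tau\neq0$, and $F$ is a bounded linear operator from $L_{\nu,p}(\mathbb{R}_+)$ into $L_p(\mathbb{R})$, with $$\|Ff\|_{L_p(\mathbb{R})}\le 2^{-\nu}\,\pi^{1/p-1}\,q^{2(\nu-1)}\,\big[\Gamma(q(1-\nu))\big]^{2/q}\,B(1-\nu,1-\nu)\,\|f\|_{\nu,p},$$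 where $\Gamma$ and $B$ are Euler's gamma and beta functions and $1/p=0$ if $p=\infty$. -/

import Mathlib

open MeasureTheory Set
open scoped ENNReal

noncomputable section

/-- The Bessel function of the first kind of complex order `μ` (principal branch), by its power
series `(z/2)^μ ∑ (-1)^k (z/2)^(2k) / (k! Γ(μ+k+1))`. At a pole of `Γ` the term is `0`, as it
should be, because `Complex.Gamma` takes the value `0` there. -/
def besselJ (μ z : ℂ) : ℂ :=
  (z / 2) ^ μ *
    ∑' k : ℕ, (-1) ^ k / ((k.factorial : ℂ) * Complex.Gamma (μ + k + 1)) * (z / 2) ^ (2 * k)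

/-- The Macdonald function (modified Bessel function of the second kind) of complex order `μ`,
for `Re z > 0`: `K_μ(z) = ∫_0^∞ exp (-z cosh u) cosh (μ u) du`. -/
def besselK (μ z : ℂ) : ℂ :=
  ∫ u in Ioi (0 : ℝ), Complex.exp (-z * (Real.cosh u : ℂ)) * Complex.cosh (μ * (u : ℂ))

/-- The kernel `K_{iτ}(2√(2x)) Im[J_{iτ}(2√(2x))] / sinh(πτ/2)`, for `x > 0` and `τ ≠ 0`. -/
def indexKernel (τ x : ℝ) : ℂ :=
  besselK (Complex.I * τ) ((2 * √(2 * x) : ℝ) : ℂ) *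
      ((besselJ (Complex.I * τ) ((2 * √(2 * x) : ℝ) : ℂ)).im : ℂ) /
    ((Real.sinh (Real.pi * τ / 2) : ℝ) : ℂ)

/-- The index transform `(F f)(τ) = ∫_0^∞ Ψ_τ(x) f(x) dx`, where `Ψ` is the kernel above. (The
transform is considered for `τ ≠ 0`; the value at `τ = 0` is `0` by convention.) -/
def indexTransform (f : ℝ → ℂ) (τ : ℝ) : ℂ :=
  ∫ x in Ioi (0 : ℝ), indexKernel τ x * f x

/-- The norm of `L_{ν,p}(ℝ₊)`: `(∫_0^∞ x^(νp-1) |f(x)|^p dx)^(1/p)` for finite `p`, and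
`ess sup_{x > 0} |x^ν f(x)|` for `p = ∞`. -/
def weightedNorm (ν : ℝ) (p : ℝ≥0∞) (f : ℝ → ℂ) : ℝ≥0∞ :=
  if p = ∞ then
    essSup (fun x : ℝ => ENNReal.ofReal (x ^ ν) * ‖f x‖ₑ) (volume.restrict (Ioi (0 : ℝ)))
  else
    (∫⁻ x in Ioi (0 : ℝ), ENNReal.ofReal (x ^ (ν * p.toReal - 1)) * ‖f x‖ₑ ^ p.toReal)
      ^ (1 / p.toReal)

/-- Membership in `L_{ν,p}(ℝ₊)`; only the values of `f` on `(0, ∞)` matter. -/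
def MemWeightedLp (ν : ℝ) (p : ℝ≥0∞) (f : ℝ → ℂ) : Prop :=
  AEStronglyMeasurable f (volume.restrict (Ioi (0 : ℝ))) ∧ weightedNorm ν p f < ∞

/-- The explicit constant
`2^(-ν) π^(1/p-1) q^(2(ν-1)) Γ(q(1-ν))^(2/q) B(1-ν, 1-ν)` (with `1/p = 0` if `p = ∞`). -/
def indexBound (ν : ℝ) (p q : ℝ≥0∞) : ℝ :=
  (2 : ℝ) ^ (-ν) * Real.pi ^ (p⁻¹.toReal - 1) * q.toReal ^ (2 * (ν - 1)) *
    Real.Gamma (q.toReal * (1 - ν)) ^ (2 / q.toReal) * ProbabilityTheory.beta (1 - ν) (1 - ν)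

end

/-! The kernel is a Fourier integral in `τ`. For `x > 0` and `τ ≠ 0` it equals `-(1/π) ∫ e^{iτu}
k(x,u) du` with `k(x,u) = Re K₀(4 e^{iπ/4} √(x cosh u))`. Hence `F f` is, up to the factor `-1/π`
and a dilation by `2π`, the Fourier transform of `g(u) = ∫ k(x,u) f(x) dx`. Hausdorff–Young with
constant `1` then gives `‖F f‖_p ≤ π⁻¹ (2π)^{1/p} ‖g‖_q`.

The Fourier representation (`indexKernel_eq_integral`) comes from two formulas for `K_{iτ}` on the
ray of angle `θ < π/2`. The connection formula `besselK_eq_expSeries` writes `K_{iτ}` through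
`I_{±iτ}`, so that `Re K_{iτ}(y e^{iθ})` tends to `-(π/2) Im J_{iτ}(y) / sinh(πτ/2)` as `θ ↑ π/2`
(`tendsto_re_besselK`). The product formula `besselK_mul_besselK` writes `K_{iτ}(y) K_{iτ}(y
e^{iθ})` as half the integral of `e^{iτu}` against a value of `K₀`. As `K_{iτ}(y)` is real, taking
real parts and letting `θ ↑ π/2` gives the claim.

To bound `‖g‖_q`, put `a = 1 - ν`. Since `|k(x,u)| ≤ K₀(2√(2x cosh u))`, Hölder in `x` gives `|g(u)|
≤ ‖f‖_{ν,p} M(u)^{1/q}` with `M(u) = ∫ (x^a K₀(2√(2x cosh u)))^q dx/x`. Scaling gives `M(u) =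
cosh(u)^{-aq} M(0)`, so every positive power of `|g|` is integrable and Fubini is available. The
sharp form of the constant comes from `lintegral_majorantPow_le`: write `K₀` as an integral over
`v`, apply Hölder in `v` with weight `cosh^{-2a} v`, and pass to `ξ = √x e^{u/2}`, `η = √x
e^{-u/2}`. The inequality `2√(ξ²+η²) ≥ √2(ξ+η)` makes the double integral a product of two Gamma
integrals, and the remaining `∫ cosh^{-2a}` is a beta value. -/

open scoped FourierTransform SchwartzMap

/-! ### The Fourier transform on the line and the Hausdorff–Young inequality. -/

/-- The self-adjointness of the Fourier transform against a Schwartz function. -/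
theorem integral_fourier_mul_eq_flip {f g : ℝ → ℂ} (hf : Integrable f) (hg : Integrable g) :
    ∫ x, 𝓕 f x * g x = ∫ x, f x * 𝓕 g x := by
  simpa using! (VectorFourier.integral_fourierIntegral_smul_eq_flip (L := innerₗ ℝ)
      Real.continuous_fourierChar continuous_inner hf hg)

theorem continuous_fourier_of_integrable {f : ℝ → ℂ} (hf : Integrable f) : Continuous (𝓕 f) :=
  VectorFourier.fourierIntegral_continuous Real.continuous_fourierChar
    (by exact continuous_inner) hf

/-- Both sides are locally integrable, so it is enough to test them on smooth compactly supported
functions. There the `L²` transform is the distributional one, defined by moving `𝓕` onto the test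
function, and the `L¹` transform satisfies the same flip identity. -/
theorem coeFn_fourier_toLp_two {f : ℝ → ℂ} (h1 : Integrable f) (h2 : MemLp f 2) :
    (𝓕 (h2.toLp f) : Lp ℂ 2 (volume : Measure ℝ)) =ᵐ[volume] 𝓕 f := by
  have hc := continuous_fourier_of_integrable h1
  refine ae_eq_of_integral_contDiff_smul_eq ?_ hc.locallyIntegrable ?_
  · exact (Lp.memLp _).locallyIntegrable (by norm_num)
  · intro g hg hgc
    have hg₁ : HasCompactSupport (Complex.ofRealCLM ∘ g) := hgc.comp_left rfl
    have hg₂ : ContDiff ℝ (⊤ : ℕ∞) (Complex.ofRealCLM ∘ g) := by fun_prop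
    set φ : 𝓢(ℝ, ℂ) := hg₁.toSchwartzMap hg₂ with hφ
    have hφx : ∀ x, φ x = (g x : ℂ) := fun x => rfl
    have key := congrArg (fun T : 𝓢'(ℝ, ℂ) => T φ)
      (Lp.fourier_toTemperedDistribution_eq (h2.toLp f))
    simp only [TemperedDistribution.fourier_apply, Lp.toTemperedDistribution_apply] at key
    have e1 : ∫ x, g x • (𝓕 (h2.toLp f) : Lp ℂ 2 (volume : Measure ℝ)) x
        = ∫ x, φ x • (𝓕 (h2.toLp f) : Lp ℂ 2 (volume : Measure ℝ)) x := by
      simp [hφx]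
    rw [e1, ← key]
    have e2 : ∫ x, (𝓕 φ : 𝓢(ℝ, ℂ)) x • (h2.toLp f) x = ∫ x, f x * 𝓕 (φ : ℝ → ℂ) x := by
      refine integral_congr_ae ?_
      filter_upwards [h2.coeFn_toLp] with x hx
      rw [hx, SchwartzMap.fourier_coe, smul_eq_mul, mul_comm]
    rw [e2, ← integral_fourier_mul_eq_flip h1 φ.integrable]
    simp [hφx, mul_comm]

/-- Plancherel's theorem on `L¹ ∩ L²`. -/
theorem eLpNorm_fourier_two {f : ℝ → ℂ} (h1 : Integrable f) (h2 : MemLp f 2) :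
    eLpNorm (𝓕 f) 2 volume = eLpNorm f 2 volume := by
  rw [← eLpNorm_congr_ae (coeFn_fourier_toLp_two h1 h2), ← eLpNorm_congr_ae h2.coeFn_toLp]
  have := Lp.norm_fourier_eq (h2.toLp f)
  rw [Lp.norm_def, Lp.norm_def] at this
  exact (ENNReal.toReal_eq_toReal_iff' (Lp.memLp _).2.ne (Lp.memLp _).2.ne).1 this

/-- `w ‖w‖^(α-1)` is the analytic family used for interpolation: it is `w` at `α = 1`, keeps the
phase of `w` for real `α`, and its modulus depends only on `Re α`. -/
theorem norm_mul_norm_cpow (w α : ℂ) (hα : 0 < α.re) :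
    ‖w * (‖w‖ : ℂ) ^ (α - 1)‖ = ‖w‖ ^ α.re := by
  rcases eq_or_ne w 0 with rfl | hw
  · simp [Real.zero_rpow hα.ne']
  · have hw' : 0 < ‖w‖ := norm_pos_iff.2 hw
    rw [norm_mul, Complex.norm_cpow_eq_rpow_re_of_pos hw', Complex.sub_re, Complex.one_re,
      Real.rpow_sub_one hw'.ne']
    field_simp

theorem aestronglyMeasurable_mul_norm_cpow {X : Type*} [MeasurableSpace X] {m : Measure X}
    {c : X → ℂ} (hc : AEStronglyMeasurable c m) (α : ℂ) :
    AEStronglyMeasurable (fun x => c x * (‖c x‖ : ℂ) ^ (α - 1)) m := by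
  have h : AEMeasurable c m := hc.aemeasurable
  exact AEMeasurable.aestronglyMeasurable (by fun_prop)

theorem integrable_mul_norm_cpow {X : Type*} [MeasurableSpace X] {m : Measure X}
    {c : X → ℂ} (hc : AEStronglyMeasurable c m) {α : ℂ} (hα : 0 < α.re)
    (hi : Integrable (fun x => ‖c x‖ ^ α.re) m) :
    Integrable (fun x => c x * (‖c x‖ : ℂ) ^ (α - 1)) m := by
  refine hi.mono' (aestronglyMeasurable_mul_norm_cpow hc α) (.of_forall fun x => ?_)
  rw [norm_mul_norm_cpow _ _ hα]

theorem rpow_le_rpow_add_rpow {r a b s : ℝ} (hr : 0 < r) (has : a ≤ s) (hsb : s ≤ b) :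
    r ^ s ≤ r ^ a + r ^ b := by
  rcases le_total r 1 with h | h
  · exact (Real.rpow_le_rpow_of_exponent_ge hr h has).trans
      (le_add_of_nonneg_right (Real.rpow_nonneg hr.le _))
  · exact (Real.rpow_le_rpow_of_exponent_le h hsb).trans
      (le_add_of_nonneg_left (Real.rpow_nonneg hr.le _))

theorem abs_log_le_rpow_add_rpow {r ε : ℝ} (hr : 0 < r) (hε : 0 < ε) :
    |Real.log r| ≤ (r ^ ε + r ^ (-ε)) / ε := by
  have h1 := Real.log_le_rpow_div hr.le hε
  have h2 := Real.log_le_rpow_div (inv_nonneg.2 hr.le) hε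
  rw [Real.log_inv, Real.inv_rpow hr.le, ← Real.rpow_neg hr.le] at h2
  have h3 : 0 ≤ r ^ ε / ε := by positivity
  have h4 : 0 ≤ r ^ (-ε) / ε := by positivity
  rw [add_div, abs_le]
  constructor <;> linarith

/-- `α ↦ ∫ c |c|^(α-1)` is holomorphic on the right half plane if all powers of `c` are
integrable. -/
theorem differentiableAt_integral_mul_norm_cpow {X : Type*} [MeasurableSpace X] {m : Measure X}
    {c : X → ℂ} (hc : AEStronglyMeasurable c m)
    (hi : ∀ s : ℝ, 0 < s → Integrable (fun x => ‖c x‖ ^ s) m) {α : ℂ} (hα : 0 < α.re) :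
    DifferentiableAt ℂ (fun α : ℂ => ∫ x, c x * (‖c x‖ : ℂ) ^ (α - 1) ∂m) α := by
  set b := α.re
  -- On the ball of radius `ε` the exponent has real part in `[3ε, 5ε]`, and the logarithm costs
  -- another `±ε`. The dominating powers `2ε`, `4ε`, `6ε` are therefore all positive.
  set ε := b / 4 with hε
  have hε0 : 0 < ε := by positivity
  have hmeas : AEMeasurable c m := hc.aemeasurable
  refine (hasDerivAt_integral_of_dominated_loc_of_deriv_le
    (F := fun α x => c x * (‖c x‖ : ℂ) ^ (α - 1))
    (F' := fun α x => c x * ((‖c x‖ : ℂ) ^ (α - 1) * Complex.log ‖c x‖))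
    (bound := fun x => (‖c x‖ ^ (2 * ε) + 2 * ‖c x‖ ^ (4 * ε) + ‖c x‖ ^ (6 * ε)) / ε)
    (Metric.ball_mem_nhds α hε0) (.of_forall fun α => aestronglyMeasurable_mul_norm_cpow hc α)
    (integrable_mul_norm_cpow hc hα (hi _ hα))
    (AEMeasurable.aestronglyMeasurable (by fun_prop)) (.of_forall ?_) ?_
    (.of_forall ?_)).2.differentiableAt
  · intro x β hβ
    have hβ' : |β.re - b| < ε := by
      have := (Complex.abs_re_le_norm (β - α)).trans_lt (by simpa [dist_eq_norm] using hβ)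
      simpa [b] using this
    rw [abs_lt] at hβ'
    rcases eq_or_ne (c x) 0 with h0 | h0
    · simp only [h0, zero_mul, norm_zero]
      positivity
    · have hr : 0 < ‖c x‖ := norm_pos_iff.2 h0
      rw [← mul_assoc, norm_mul, norm_mul_norm_cpow _ _ (by linarith), ← Complex.ofReal_log hr.le,
        Complex.norm_real, Real.norm_eq_abs]
      have h1 := rpow_le_rpow_add_rpow hr (a := 3 * ε) (b := 5 * ε) (s := β.re)
        (by linarith) (by linarith)
      have h2 := abs_log_le_rpow_add_rpow hr hε0
      refine (mul_le_mul h1 h2 (abs_nonneg _) (by positivity)).trans (le_of_eq ?_)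
      have e1 : ‖c x‖ ^ (2 * ε) = ‖c x‖ ^ (3 * ε) * ‖c x‖ ^ (-ε) := by
        rw [← Real.rpow_add hr]; ring_nf
      have e2 : ‖c x‖ ^ (4 * ε) = ‖c x‖ ^ (3 * ε) * ‖c x‖ ^ ε := by
        rw [← Real.rpow_add hr]; ring_nf
      have e2' : ‖c x‖ ^ (4 * ε) = ‖c x‖ ^ (5 * ε) * ‖c x‖ ^ (-ε) := by
        rw [← Real.rpow_add hr]; ring_nf
      have e3 : ‖c x‖ ^ (6 * ε) = ‖c x‖ ^ (5 * ε) * ‖c x‖ ^ ε := by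
        rw [← Real.rpow_add hr]; ring_nf
      rw [e1, e3, two_mul]
      nth_rw 1 [e2]
      rw [e2']
      ring
  · exact (((hi _ (by positivity)).add ((hi _ (by positivity)).const_mul 2)).add
      (hi _ (by positivity))).div_const ε
  · intro x β _
    rcases eq_or_ne (c x) 0 with h0 | h0
    · simpa [h0] using hasDerivAt_const β (0 : ℂ)
    · have hr : (‖c x‖ : ℂ) ≠ 0 := by simpa using h0
      have := ((hasDerivAt_id β).sub_const 1).const_cpow (c := (‖c x‖ : ℂ)) (Or.inl hr)
      simpa using this.const_mul (c x)

theorem enorm_integral_mul_le {X : Type*} [MeasurableSpace X] {m : Measure X} (p q : ℝ≥0∞)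
    [p.HolderTriple q 1] {f g : X → ℂ} (hf : AEStronglyMeasurable f m)
    (hg : AEStronglyMeasurable g m) :
    ‖∫ x, f x * g x ∂m‖ₑ ≤ eLpNorm f p m * eLpNorm g q m := by
  refine (enorm_integral_le_lintegral_enorm _).trans ?_
  rw [← eLpNorm_one_eq_lintegral_enorm]
  have h : eLpNorm (f • g) 1 m ≤ eLpNorm f p m * eLpNorm g q m :=
    eLpNorm_smul_le_mul_eLpNorm hg hf
  exact h

/-- The Hausdorff–Young inequality, in its bilinear form. -/
theorem norm_integral_fourier_mul_le {p q : ℝ} (hpq : p.HolderConjugate q) (hp : 2 ≤ p)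
    {f g : ℝ → ℂ} (hf : AEStronglyMeasurable f) (hg : AEStronglyMeasurable g)
    (hfi : ∀ s : ℝ, 0 < s → Integrable (fun x => ‖f x‖ ^ s))
    (hgi : ∀ s : ℝ, 0 < s → Integrable (fun x => ‖g x‖ ^ s)) :
    ‖∫ t, 𝓕 f t * g t‖ ≤ ((∫ x, ‖f x‖ ^ q) * ∫ x, ‖g x‖ ^ q) ^ (1 / q) := by
  have hq0 : 0 < q := hpq.symm.pos
  have hp0 : 0 < p := hpq.pos
  -- The bilinear form is the integral of `c` over the plane. Since `‖c‖ = ‖f‖ ‖g‖`, replacing `c`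
  -- by `c ‖c‖^(α-1)` deforms `f` and `g` separately and leaves the exponential alone.
  set c : ℝ × ℝ → ℂ := fun z => Complex.exp (((-2 * Real.pi * z.1 * z.2 : ℝ) : ℂ) * Complex.I) * (f z.1 * g z.2) with hcdef
  have hcm : AEStronglyMeasurable c (volume.prod volume) := by
    refine AEStronglyMeasurable.mul ?_ (hf.comp_fst.mul hg.comp_snd)
    exact Continuous.aestronglyMeasurable (by fun_prop)
  have hcn : ∀ z, ‖c z‖ = ‖f z.1‖ * ‖g z.2‖ := fun z => by
    rw [hcdef]
    simp only [norm_mul, Complex.norm_exp_ofReal_mul_I, one_mul]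
  have hcr : ∀ s : ℝ, (fun z => ‖c z‖ ^ s) = fun z : ℝ × ℝ => ‖f z.1‖ ^ s * ‖g z.2‖ ^ s := by
    intro s; ext z; rw [hcn, Real.mul_rpow (norm_nonneg _) (norm_nonneg _)]
  have hci : ∀ s : ℝ, 0 < s → Integrable (fun x => ‖c x‖ ^ s) (volume.prod volume) := by
    intro s hs
    rw [hcr]
    exact (hfi s hs).mul_prod (hgi s hs)
  have hcint : ∀ s : ℝ, ∫ z, ‖c z‖ ^ s ∂(volume.prod volume)
      = (∫ x, ‖f x‖ ^ s) * ∫ x, ‖g x‖ ^ s := by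
    intro s
    rw [hcr]
    exact integral_prod_mul (fun x => ‖f x‖ ^ s) (fun x => ‖g x‖ ^ s)
  set Ψ : ℂ → ℂ := fun α => ∫ z, c z * (‖c z‖ : ℂ) ^ (α - 1) ∂(volume.prod volume) with hΨ
  have hΨn : ∀ α : ℂ, 0 < α.re → ‖Ψ α‖ ≤ ∫ z, ‖c z‖ ^ α.re ∂(volume.prod volume) := by
    intro α hα
    refine (norm_integral_le_integral_norm _).trans (le_of_eq (integral_congr_ae ?_))
    exact .of_forall fun z => norm_mul_norm_cpow _ _ hα
  have hΨf : ∀ α : ℂ, 0 < α.re → Ψ α = ∫ t, 𝓕 (fun u => f u * (‖f u‖ : ℂ) ^ (α - 1)) t *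
      (g t * (‖g t‖ : ℂ) ^ (α - 1)) := by
    intro α hα
    rw [hΨ]
    simp only
    rw [integral_prod_symm _ (integrable_mul_norm_cpow hcm hα (hci _ hα))]
    refine integral_congr_ae (.of_forall fun t => ?_)
    simp only
    rw [Real.fourier_real_eq_integral_exp_smul, ← integral_mul_const]
    refine integral_congr_ae (.of_forall fun u => ?_)
    simp only [hcn, Complex.ofReal_mul, smul_eq_mul]
    rw [Complex.mul_cpow_ofReal_nonneg (norm_nonneg _) (norm_nonneg _)]
    simp only [hcdef, Complex.ofReal_mul]
    ring
  set A := ∫ x, ‖f x‖ ^ q with hA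
  set B := ∫ x, ‖g x‖ ^ q with hB
  have hA0 : 0 ≤ A := integral_nonneg fun x => by positivity
  have hB0 : 0 ≤ B := integral_nonneg fun x => by positivity
  have hmem : ∀ {h : ℝ → ℂ}, AEStronglyMeasurable h →
      (∀ s : ℝ, 0 < s → Integrable (fun x => ‖h x‖ ^ s)) → ∀ α : ℂ, α.re = q / 2 →
      MemLp (fun u => h u * (‖h u‖ : ℂ) ^ (α - 1)) 2 volume ∧
      eLpNorm (fun u => h u * (‖h u‖ : ℂ) ^ (α - 1)) 2 volume
        = ENNReal.ofReal ((∫ x, ‖h x‖ ^ q) ^ (1 / 2 : ℝ)) := by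
    intro h hh hi α hα
    have hn : ∀ x, ‖h x * (‖h x‖ : ℂ) ^ (α - 1)‖ ^ (2 : ℝ) = ‖h x‖ ^ q := by
      intro x
      rw [norm_mul_norm_cpow _ _ (by rw [hα]; positivity), ← Real.rpow_mul (norm_nonneg _), hα]
      ring_nf
    have hm : MemLp (fun u => h u * (‖h u‖ : ℂ) ^ (α - 1)) 2 volume := by
      rw [← integrable_norm_rpow_iff (aestronglyMeasurable_mul_norm_cpow hh α) two_ne_zero
        ENNReal.ofNat_ne_top]
      simpa only [ENNReal.toReal_ofNat, hn] using hi q hq0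
    refine ⟨hm, ?_⟩
    rw [hm.eLpNorm_eq_integral_rpow_norm two_ne_zero ENNReal.ofNat_ne_top]
    simp only [ENNReal.toReal_ofNat, hn, one_div]
  have hb1 : ∀ α : ℂ, α.re = q / 2 → ‖Ψ α‖ ≤ (A * B) ^ (1 / 2 : ℝ) := by
    intro α hα
    have hα0 : 0 < α.re := by rw [hα]; positivity
    obtain ⟨mf, nf⟩ := hmem hf hfi α hα
    obtain ⟨mg, ng⟩ := hmem hg hgi α hα
    have f1 := integrable_mul_norm_cpow hf hα0 (hfi _ hα0)
    have hF := eLpNorm_fourier_two f1 mf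
    set F := fun u => f u * (‖f u‖ : ℂ) ^ (α - 1)
    set G := fun u => g u * (‖g u‖ : ℂ) ^ (α - 1)
    rw [hΨf α hα0]
    have h3 := enorm_integral_mul_le 2 2
      (continuous_fourier_of_integrable f1).aestronglyMeasurable mg.1
    rw [hF, nf, ng, ← ENNReal.ofReal_mul (by positivity), ← Real.mul_rpow hA0 hB0] at h3
    rw [← ofReal_norm] at h3
    exact (ENNReal.ofReal_le_ofReal_iff (by positivity)).1 h3
  have hre : ∀ z : ℂ, ((q : ℂ) * (1 - z / 2)).re = q * (1 - z.re / 2) := by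
    intro z
    simp
  have hpq' := hpq.inv_add_inv_eq_one
  -- The map `α = q(1 - z/2)` sends `Re z = 0` to `Re α = q`, where the triangle inequality gives `A
  -- B`, and `Re z = 1` to `Re α = q/2`, where Plancherel gives `(A B)^(1/2)`. The point `z = 2/p`,
  -- in the strip because `p ≥ 2`, goes to `α = 1`, and the interpolated exponent is `1 - 2/p + 1/p
  -- = 1/q`.
  have hmain := Complex.HadamardThreeLines.norm_le_interp_of_mem_verticalClosedStrip₀₁'
    (fun z : ℂ => Ψ ((q : ℂ) * (1 - z / 2))) (z := ((2 / p : ℝ) : ℂ))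
    (a := A * B) (b := (A * B) ^ (1 / 2 : ℝ)) ?_ ?_ ?_ ?_ ?_
  · have e1 : (q : ℂ) * (1 - ((2 / p : ℝ) : ℂ) / 2) = 1 := by
      have : q * (1 - 2 / p / 2) = 1 := by
        have : 1 - 2 / p / 2 = q⁻¹ := by
          rw [div_eq_mul_inv 2 p]; linarith
        rw [this, mul_inv_cancel₀ hq0.ne']
      exact_mod_cast this
    simp only [e1, Complex.ofReal_re] at hmain
    rw [hΨf 1 (by simp)] at hmain
    simp only [sub_self, Complex.cpow_zero, mul_one] at hmain
    refine hmain.trans (le_of_eq ?_)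
    have hAB : 0 ≤ A * B := by positivity
    rw [← Real.rpow_mul hAB, ← Real.rpow_add' hAB]
    · congr 1
      rw [div_eq_mul_inv 2 p, one_div q]; linarith
    · have : 1 - 2 / p + 1 / 2 * (2 / p) = q⁻¹ := by
        rw [div_eq_mul_inv 2 p]; linarith
      rw [this]; positivity
  · simp only [Complex.HadamardThreeLines.verticalClosedStrip, mem_preimage, Complex.ofReal_re]
    exact ⟨by positivity, by rw [div_le_one hp0]; exact hp⟩
  · refine DifferentiableOn.diffContOnCl (fun z hz => ?_)
    have hz' : z.re ∈ Icc (0 : ℝ) 1 := by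
      have : closure (Complex.HadamardThreeLines.verticalStrip 0 1) ⊆ Complex.re ⁻¹' Icc 0 1 :=
        closure_minimal (preimage_mono Ioo_subset_Icc_self)
          (isClosed_Icc.preimage Complex.continuous_re)
      exact this hz
    refine DifferentiableAt.differentiableWithinAt ?_
    refine (differentiableAt_integral_mul_norm_cpow hcm hci ?_).comp z (by fun_prop)
    rw [hre]
    have := hz'.2
    exact mul_pos hq0 (by linarith)
  · refine ⟨∫ z, (‖c z‖ ^ (q / 2) + ‖c z‖ ^ q) ∂(volume.prod volume), ?_⟩
    rintro _ ⟨z, hz, rfl⟩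
    have hz' : z.re ∈ Icc (0 : ℝ) 1 := hz
    have h0 : 0 < ((q : ℂ) * (1 - z / 2)).re := by
      rw [hre]; exact mul_pos hq0 (by linarith [hz'.2])
    refine (hΨn _ h0).trans (integral_mono (hci _ h0)
      ((hci _ (by positivity)).add (hci _ hq0)) fun x => ?_)
    rcases eq_or_ne (c x) 0 with hx | hx
    · simp only [hx, norm_zero, Real.zero_rpow hq0.ne', Real.zero_rpow h0.ne',
        Real.zero_rpow (half_pos hq0).ne', add_zero, le_refl]
    · refine rpow_le_rpow_add_rpow (norm_pos_iff.2 hx) ?_ ?_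
      · rw [hre]; nlinarith [hz'.2]
      · rw [hre]; nlinarith [hz'.1]
  · intro z hz
    have hz' : z.re = 0 := hz
    have h0 : ((q : ℂ) * (1 - z / 2)).re = q := by rw [hre, hz']; ring
    refine (hΨn _ (by rw [h0]; exact hq0)).trans (le_of_eq ?_)
    rw [h0, hcint]
  · intro z hz
    have hz' : z.re = 1 := hz
    exact hb1 _ (by rw [hre, hz']; ring)

theorem enorm_fourier_le {f : ℝ → ℂ} (t : ℝ) : ‖𝓕 f t‖ₑ ≤ ∫⁻ x, ‖f x‖ₑ := by
  rw [Real.fourier_real_eq_integral_exp_smul]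
  refine (enorm_integral_le_lintegral_enorm _).trans (le_of_eq (lintegral_congr fun x => ?_))
  rw [enorm_smul, ← ofReal_norm, Complex.norm_exp_ofReal_mul_I, ENNReal.ofReal_one, one_mul]

/-- Duality: test `h = 𝓕 f` against `conj h · ‖h‖^(p-2)` cut off to `[-R, R]`. As `(p-1) q = p`,
both `∫ h g` and `∫ ‖g‖^q` equal the left side `A`, so the bilinear inequality reads `A ≤ (F
A)^(1/q)`. The cutoff keeps `A` finite, which allows division by `A^(1/q)`. -/
theorem setIntegral_norm_fourier_rpow_le {p q : ℝ} (hpq : p.HolderConjugate q) (hp : 2 ≤ p)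
    {f : ℝ → ℂ} (hf : AEStronglyMeasurable f)
    (hfi : ∀ s : ℝ, 0 < s → Integrable (fun x => ‖f x‖ ^ s)) (R : ℝ) :
    ∫ t in Icc (-R) R, ‖𝓕 f t‖ ^ p ≤ (∫ x, ‖f x‖ ^ q) ^ (p / q) := by
  have hq0 : 0 < q := hpq.symm.pos
  have hp0 : 0 < p := hpq.pos
  have hf1 : Integrable f := by
    rw [← integrable_norm_iff hf]
    simpa using hfi 1 one_pos
  set h := 𝓕 f with hh
  have hc : Continuous h := continuous_fourier_of_integrable hf1
  set g₀ : ℝ → ℂ := fun t => (starRingEnd ℂ) (h t) *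
    (‖(starRingEnd ℂ) (h t)‖ : ℂ) ^ (((p - 1 : ℝ) : ℂ) - 1) with hg₀
  have hg₀n : ∀ t, ‖g₀ t‖ = ‖h t‖ ^ (p - 1) := fun t => by
    rw [hg₀]
    simp only
    rw [norm_mul_norm_cpow _ _ (by rw [Complex.ofReal_re]; linarith), Complex.ofReal_re,
      RCLike.norm_conj]
  have hhg : ∀ t, h t * g₀ t = ((‖h t‖ ^ p : ℝ) : ℂ) := fun t => by
    rcases eq_or_ne (h t) 0 with h0 | h0
    · simp [h0, Real.zero_rpow hp0.ne']
    · have hr : 0 < ‖h t‖ := norm_pos_iff.2 h0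
      rw [hg₀]
      simp only [RCLike.norm_conj]
      rw [← mul_assoc, Complex.mul_conj, Complex.normSq_eq_norm_sq, ← Complex.ofReal_one,
        ← Complex.ofReal_sub, ← Complex.ofReal_cpow hr.le, ← Complex.ofReal_mul,
        ← Real.rpow_natCast, ← Real.rpow_add hr]
      congr 2
      push_cast
      ring
  set g : ℝ → ℂ := (Icc (-R) R).indicator g₀ with hg
  have hgm : AEStronglyMeasurable g := by
    refine AEStronglyMeasurable.indicator ?_ measurableSet_Icc
    exact aestronglyMeasurable_mul_norm_cpow
      (Continuous.aestronglyMeasurable (by fun_prop)) _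
  have hgs : ∀ s : ℝ, 0 < s → (fun x => ‖g x‖ ^ s)
      = (Icc (-R) R).indicator (fun x => ‖h x‖ ^ ((p - 1) * s)) := by
    intro s hs
    ext x
    by_cases hx : x ∈ Icc (-R) R
    · rw [hg, indicator_of_mem hx, indicator_of_mem hx, hg₀n, Real.rpow_mul (norm_nonneg _)]
    · rw [hg, indicator_of_notMem hx, indicator_of_notMem hx, norm_zero, Real.zero_rpow hs.ne']
  have hgi : ∀ s : ℝ, 0 < s → Integrable (fun x => ‖g x‖ ^ s) := by
    intro s hs
    rw [hgs s hs, integrable_indicator_iff measurableSet_Icc]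
    refine Continuous.integrableOn_Icc ?_
    exact hc.norm.rpow_const fun x => Or.inr (mul_nonneg (by linarith) hs.le)
  have key := norm_integral_fourier_mul_le hpq hp hf hgm hfi hgi
  rw [hgs q hq0, integral_indicator measurableSet_Icc] at key
  have e1 : (p - 1) * q = p := hpq.sub_one_mul_conj
  have e2 : ∫ t, h t * g t = ((∫ t in Icc (-R) R, ‖h t‖ ^ p : ℝ) : ℂ) := by
    rw [← integral_complex_ofReal, ← integral_indicator measurableSet_Icc]
    refine integral_congr_ae (.of_forall fun t => ?_)
    by_cases hx : t ∈ Icc (-R) R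
    · simp only [hg, indicator_of_mem hx, hhg]
    · simp only [hg, indicator_of_notMem hx, mul_zero]
  rw [← hh, e1, e2, Complex.norm_real, Real.norm_eq_abs] at key
  set A := ∫ t in Icc (-R) R, ‖h t‖ ^ p
  set F := ∫ x, ‖f x‖ ^ q
  have hA : 0 ≤ A := integral_nonneg fun x => by positivity
  have hF : 0 ≤ F := integral_nonneg fun x => by positivity
  rw [abs_of_nonneg hA, Real.mul_rpow hF hA] at key
  have hinv := hpq.inv_add_inv_eq_one
  rcases hA.eq_or_lt with h0 | h0
  · rw [← h0]; positivity
  · have h1 : A ^ (1 / p) ≤ F ^ (1 / q) := by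
      have h2 : A = A ^ (1 / p) * A ^ (1 / q) := by
        rw [← Real.rpow_add h0, one_div, one_div, hinv, Real.rpow_one]
      have h3 : 0 < A ^ (1 / q) := by positivity
      rw [h2] at key
      refine le_of_mul_le_mul_right ?_ h3
      rwa [← h2] at key ⊢
    calc A = (A ^ (1 / p)) ^ p := by rw [← Real.rpow_mul hA, one_div_mul_cancel hp0.ne', Real.rpow_one]
      _ ≤ (F ^ (1 / q)) ^ p := Real.rpow_le_rpow (by positivity) h1 hp0.le
      _ = F ^ (p / q) := by rw [← Real.rpow_mul hF]; ring_nf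

/-- The Hausdorff–Young inequality for functions all of whose powers are integrable. -/
theorem eLpNorm_fourier_le {p q : ℝ≥0∞} (hpq : p⁻¹ + q⁻¹ = 1) (hp : 2 ≤ p)
    {f : ℝ → ℂ} (hf : AEStronglyMeasurable f)
    (hfi : ∀ s : ℝ, 0 < s → Integrable (fun x => ‖f x‖ ^ s)) :
    eLpNorm (𝓕 f) p volume ≤ eLpNorm f q volume := by
  have hf1 : Integrable f := by
    rw [← integrable_norm_iff hf]
    simpa using hfi 1 one_pos
  rcases eq_or_ne p ∞ with rfl | hptop
  · have hq : q = 1 := by simpa using hpq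
    rw [hq, eLpNorm_one_eq_lintegral_enorm, eLpNorm_exponent_top]
    exact essSup_le_of_ae_le _ (.of_forall fun t => enorm_fourier_le t)
  · have hp0 : p ≠ 0 := fun h => by simp [h] at hp
    have hq0 : q ≠ 0 := by
      rintro rfl
      simp at hpq
    have hp2 : 2 ≤ p.toReal := by
      have := ENNReal.toReal_mono hptop hp
      simpa using this
    have hqtop : q ≠ ∞ := by
      rintro rfl
      have : p = 1 := by simpa using hpq
      rw [this] at hp2
      norm_num at hp2
    have hconj : p.toReal.HolderConjugate q.toReal := by
      refine Real.holderConjugate_iff.2 ⟨by linarith, ?_⟩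
      rw [← ENNReal.toReal_inv, ← ENNReal.toReal_inv, ← ENNReal.toReal_add, hpq,
        ENNReal.toReal_one]
      · exact ENNReal.inv_ne_top.2 hp0
      · exact ENNReal.inv_ne_top.2 hq0
    have hpr : 0 < p.toReal := hconj.pos
    have hqr : 0 < q.toReal := hconj.symm.pos
    have hmem : MemLp f q volume := by
      rw [← integrable_norm_rpow_iff hf hq0 hqtop]
      exact hfi _ hqr
    have hc : Continuous (𝓕 f) := continuous_fourier_of_integrable hf1
    set F := ∫ x, ‖f x‖ ^ q.toReal with hF
    have hF0 : 0 ≤ F := integral_nonneg fun x => by positivity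
    rw [hmem.eLpNorm_eq_integral_rpow_norm hq0 hqtop, eLpNorm_eq_lintegral_rpow_enorm_toReal hp0 hptop]
    have h1 : ∀ R : ℝ, ∫⁻ t in Icc (-R) R, ‖𝓕 f t‖ₑ ^ p.toReal
        ≤ ENNReal.ofReal (F ^ (p.toReal / q.toReal)) := by
      intro R
      refine le_trans (le_of_eq ?_) (ENNReal.ofReal_le_ofReal
        (setIntegral_norm_fourier_rpow_le hconj hp2 hf hfi R))
      rw [ofReal_integral_eq_lintegral_ofReal]
      · refine lintegral_congr fun t => ?_
        rw [← ofReal_norm, ENNReal.ofReal_rpow_of_nonneg (norm_nonneg _) hpr.le]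
      · exact Continuous.integrableOn_Icc (hc.norm.rpow_const fun x => Or.inr hpr.le)
      · exact .of_forall fun t => by positivity
    have h2 : ∫⁻ t, ‖𝓕 f t‖ₑ ^ p.toReal ≤ ENNReal.ofReal (F ^ (p.toReal / q.toReal)) := by
      have hcov : AECover (volume : Measure ℝ) Filter.atTop fun n : ℕ => Icc (-(n : ℝ)) n :=
        aecover_Icc (Filter.tendsto_neg_atTop_atBot.comp tendsto_natCast_atTop_atTop)
          tendsto_natCast_atTop_atTop
      refine le_of_tendsto (hcov.lintegral_tendsto_of_countably_generated ?_)
        (.of_forall fun n => h1 n)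
      exact (hc.enorm.measurable.pow_const _).aemeasurable
    refine (ENNReal.rpow_le_rpow h2 (by positivity)).trans (le_of_eq ?_)
    rw [ENNReal.ofReal_rpow_of_nonneg (by positivity) (by positivity), ← Real.rpow_mul hF0]
    congr 2
    field_simp

/-! ### Integrals against `exp (-ζ cosh v)` and the modified Bessel equation. -/

theorem half_exp_le_cosh (v : ℝ) : Real.exp v / 2 ≤ Real.cosh v := by
  rw [Real.cosh_eq]; linarith [Real.exp_pos (-v)]

theorem integrable_cosh_rpow_neg {a : ℝ} (ha : 0 < a) :
    Integrable (fun v : ℝ => Real.cosh v ^ (-a)) := by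
  have hc : Continuous fun v : ℝ => Real.cosh v ^ (-a) :=
    Real.continuous_cosh.rpow_const fun v => Or.inl (Real.cosh_pos v).ne'
  have hb : ∀ v w : ℝ, Real.exp w / 2 ≤ Real.cosh v →
      ‖Real.cosh v ^ (-a)‖ ≤ 2 ^ a * Real.exp (-a * w) := by
    intro v w h
    rw [Real.norm_of_nonneg (Real.rpow_nonneg (Real.cosh_pos v).le _)]
    refine (Real.rpow_le_rpow_of_nonpos (by positivity) h (by linarith)).trans (le_of_eq ?_)
    rw [Real.div_rpow (Real.exp_pos w).le zero_le_two, ← Real.exp_mul, Real.rpow_neg zero_le_two,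
      div_inv_eq_mul, mul_comm, mul_comm w]
  rw [← integrableOn_univ, ← Iic_union_Ioi (a := (0 : ℝ))]
  refine IntegrableOn.union ?_ ?_
  · refine Integrable.mono' ((integrableOn_exp_mul_Iic ha 0).const_mul (2 ^ a))
      hc.aestronglyMeasurable (.of_forall fun v => ?_)
    have := hb v (-v) (by rw [← Real.cosh_neg]; exact half_exp_le_cosh _)
    simpa using this
  · exact Integrable.mono' ((exp_neg_integrableOn_Ioi 0 ha).const_mul (2 ^ a))
      hc.aestronglyMeasurable (.of_forall fun v => hb v v (half_exp_le_cosh _))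

/-- The inequality `e^{cX} ≥ (cX)^(n+1)/(n+1)!` at `X = cosh v` bounds the integrand by a multiple
of `1 / cosh v`. -/
theorem integrable_exp_neg_mul_cosh_mul_cosh_pow {c : ℝ} (hc : 0 < c) (n : ℕ) :
    Integrable (fun v : ℝ => Real.exp (-c * Real.cosh v) * Real.cosh v ^ n) := by
  refine ((integrable_cosh_rpow_neg one_pos).const_mul
    ((n + 1).factorial / c ^ (n + 1))).mono' ?_ (.of_forall fun v => ?_)
  · exact Continuous.aestronglyMeasurable (by fun_prop)
  · have hx : 0 < Real.cosh v := Real.cosh_pos v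
    rw [Real.norm_of_nonneg (by positivity)]
    set x := Real.cosh v
    have h := Real.pow_div_factorial_le_exp (c * x) (by positivity) (n + 1)
    rw [Real.rpow_neg_one, neg_mul, Real.exp_neg]
    have hf : (0 : ℝ) < (n + 1).factorial := by positivity
    rw [div_le_iff₀ hf] at h
    rw [inv_mul_le_iff₀ (Real.exp_pos _)]
    have h2 : x ^ n = (c * x) ^ (n + 1) / (c ^ (n + 1) * x) := by
      field_simp
      ring
    rw [h2, div_le_iff₀ (by positivity)]
    refine h.trans (le_of_eq ?_)
    field_simp

theorem norm_cexp_neg_mul_cosh (ζ : ℂ) (v : ℝ) :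
    ‖Complex.exp (-ζ * (Real.cosh v : ℂ))‖ = Real.exp (-ζ.re * Real.cosh v) := by
  rw [Complex.norm_exp]
  congr 1
  rw [Complex.re_mul_ofReal, Complex.neg_re]

theorem integrable_cexp_neg_mul_cosh_mul {ζ : ℂ} (hζ : 0 < ζ.re) {g : ℝ → ℂ} {C : ℝ} (n : ℕ)
    (hg : AEStronglyMeasurable g) (hgb : ∀ v, ‖g v‖ ≤ C * Real.cosh v ^ n) :
    Integrable (fun v : ℝ => Complex.exp (-ζ * (Real.cosh v : ℂ)) * g v) := by
  refine ((integrable_exp_neg_mul_cosh_mul_cosh_pow hζ n).const_mul C).mono' ?_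
    (.of_forall fun v => ?_)
  · exact (Continuous.aestronglyMeasurable (by fun_prop)).mul hg
  · rw [norm_mul, norm_cexp_neg_mul_cosh, mul_left_comm]
    exact mul_le_mul_of_nonneg_left (hgb v) (Real.exp_pos _).le

/-- Differentiation in `ζ` brings down a factor `-cosh v`, so growth bounded by a power of `cosh v`
is stable and the lemma can be applied twice to reach the second derivative of `K_{iτ}`. -/
theorem hasDerivAt_integral_cexp_neg_mul_cosh {ζ : ℂ} (hζ : 0 < ζ.re) {g : ℝ → ℂ} {C : ℝ} (n : ℕ)
    (hg : AEStronglyMeasurable g) (hgb : ∀ v, ‖g v‖ ≤ C * Real.cosh v ^ n) (s : Set ℝ) :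
    HasDerivAt (fun ζ : ℂ => ∫ v in s, Complex.exp (-ζ * (Real.cosh v : ℂ)) * g v)
      (-∫ v in s, Complex.exp (-ζ * (Real.cosh v : ℂ)) * (Real.cosh v * g v)) ζ := by
  have hm : ∀ ζ : ℂ, AEStronglyMeasurable
      (fun v : ℝ => Complex.exp (-ζ * (Real.cosh v : ℂ)) * g v) (volume.restrict s) := fun ζ =>
    ((Continuous.aestronglyMeasurable (by fun_prop)).mul hg).restrict
  have hgm : AEStronglyMeasurable (fun v : ℝ => (Real.cosh v : ℂ) * g v) :=
    (Continuous.aestronglyMeasurable (by fun_prop)).mul hg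
  have hgb' : ∀ v : ℝ, ‖(Real.cosh v : ℂ) * g v‖ ≤ C * Real.cosh v ^ (n + 1) := fun v => by
    rw [norm_mul, Complex.norm_real, Real.norm_of_nonneg (Real.cosh_pos v).le, pow_succ',
      mul_left_comm]
    exact mul_le_mul_of_nonneg_left (hgb v) (Real.cosh_pos v).le
  rw [← integral_neg]
  refine (hasDerivAt_integral_of_dominated_loc_of_deriv_le
    (F := fun (ζ : ℂ) (v : ℝ) => Complex.exp (-ζ * (Real.cosh v : ℂ)) * g v)
    (F' := fun (ζ : ℂ) (v : ℝ) => -(Complex.exp (-ζ * (Real.cosh v : ℂ)) * (Real.cosh v * g v)))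
    (bound := fun v => C * (Real.exp (-(ζ.re / 2) * Real.cosh v) * Real.cosh v ^ (n + 1)))
    (Metric.ball_mem_nhds ζ (half_pos hζ)) (.of_forall hm)
    (integrable_cexp_neg_mul_cosh_mul hζ n hg hgb).restrict
    (integrable_cexp_neg_mul_cosh_mul hζ (n + 1) hgm hgb').restrict.neg.1
    (.of_forall ?_)
    ((integrable_exp_neg_mul_cosh_mul_cosh_pow (half_pos hζ) _).const_mul C).restrict
    (.of_forall ?_)).2
  · intro v z hz
    have hz' : ζ.re / 2 < z.re := by
      have := (Complex.abs_re_le_norm (z - ζ)).trans_lt (by simpa [dist_eq_norm] using hz)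
      rw [abs_lt, Complex.sub_re] at this
      linarith [this.1]
    rw [norm_neg, norm_mul, norm_cexp_neg_mul_cosh, mul_left_comm]
    refine mul_le_mul (Real.exp_le_exp.2 ?_) (hgb' v) (norm_nonneg _) (Real.exp_pos _).le
    exact mul_le_mul_of_nonneg_right (by linarith) (Real.cosh_pos v).le
  · intro v z _
    have h1 : HasDerivAt (fun z : ℂ => -z * (Real.cosh v : ℂ)) (-1 * (Real.cosh v : ℂ)) z :=
      ((hasDerivAt_id z).neg).mul_const _
    convert! (h1.cexp.mul_const (g v)) using 1
    ring

theorem besselK_eq_integral_cos (τ : ℝ) (ζ : ℂ) : besselK (Complex.I * τ) ζ =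
    ∫ v in Ioi (0 : ℝ), Complex.exp (-ζ * (Real.cosh v : ℂ)) * (Real.cos (τ * v) : ℂ) := by
  refine setIntegral_congr_fun measurableSet_Ioi fun v _ => ?_
  rw [mul_assoc, mul_comm Complex.I, Complex.cosh_mul_I, ← Complex.ofReal_mul, Complex.ofReal_cos]

theorem abs_sinh_le_cosh (v : ℝ) : |Real.sinh v| ≤ Real.cosh v := by
  rw [abs_le]
  constructor
  · linarith [Real.sinh_eq v, Real.cosh_eq v, Real.exp_pos v]
  · linarith [Real.sinh_eq v, Real.cosh_eq v, Real.exp_pos (-v)]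

/-- Integration by parts against `exp (-ζ cosh v)` on the half line. -/
theorem integral_cexp_neg_mul_cosh_mul_deriv {ζ : ℂ} (hζ : 0 < ζ.re) {h h' : ℝ → ℂ} {C : ℝ} (n : ℕ)
    (hd : ∀ v, HasDerivAt h (h' v) v) (hc : Continuous h') (h0 : h 0 = 0)
    (hb : ∀ v, ‖h v‖ ≤ C * Real.cosh v ^ n) (hb' : ∀ v, ‖h' v‖ ≤ C * Real.cosh v ^ n) :
    ∫ v in Ioi (0 : ℝ), Complex.exp (-ζ * (Real.cosh v : ℂ)) * h' v =
      ζ * ∫ v in Ioi (0 : ℝ), Complex.exp (-ζ * (Real.cosh v : ℂ)) * (Real.sinh v * h v) := by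
  have hhc : Continuous h := continuous_iff_continuousAt.2 fun v => (hd v).continuousAt
  have i1 := integrable_cexp_neg_mul_cosh_mul hζ n hhc.aestronglyMeasurable hb
  have i2 := integrable_cexp_neg_mul_cosh_mul hζ n hc.aestronglyMeasurable hb'
  have i3 := integrable_cexp_neg_mul_cosh_mul hζ (g := fun v => Real.sinh v * h v) (n + 1)
    (Continuous.aestronglyMeasurable (by fun_prop)) (fun v => by
      rw [norm_mul, Complex.norm_real, pow_succ', mul_left_comm]
      exact mul_le_mul (abs_sinh_le_cosh v) (hb v) (norm_nonneg _) (Real.cosh_pos v).le)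
  have hder : ∀ v : ℝ, HasDerivAt (fun v : ℝ => Complex.exp (-ζ * (Real.cosh v : ℂ)) * h v)
      (Complex.exp (-ζ * (Real.cosh v : ℂ)) * h' v
        - ζ * (Complex.exp (-ζ * (Real.cosh v : ℂ)) * (Real.sinh v * h v))) v := by
    intro v
    have h1 : HasDerivAt (fun v : ℝ => -ζ * (Real.cosh v : ℂ)) (-ζ * (Real.sinh v : ℂ)) v :=
      (Real.hasDerivAt_cosh v).ofReal_comp.const_mul _
    convert! h1.cexp.mul (hd v) using 1
    ring
  have i4 := i2.sub (i3.const_mul ζ)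
  have := integral_Ioi_of_hasDerivAt_of_tendsto' (a := 0) (fun v _ => hder v) i4.integrableOn
    (tendsto_zero_of_hasDerivAt_of_integrableOn_Ioi (a := 0) (fun v _ => hder v) i4.integrableOn
      i1.integrableOn)
  simp only [h0, mul_zero, sub_zero] at this
  rw [integral_sub i2.integrableOn (i3.const_mul ζ).integrableOn, integral_const_mul] at this
  exact sub_eq_zero.1 this

theorem norm_ofReal_cos_le_one (x : ℝ) : ‖(Real.cos x : ℂ)‖ ≤ 1 := by
  rw [Complex.norm_real]; exact Real.abs_cos_le_one x

theorem norm_ofReal_sin_le_one (x : ℝ) : ‖(Real.sin x : ℂ)‖ ≤ 1 := by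
  rw [Complex.norm_real]; exact Real.abs_sin_le_one x

theorem norm_ofReal_cosh (x : ℝ) : ‖(Real.cosh x : ℂ)‖ = Real.cosh x := by
  rw [Complex.norm_real, Real.norm_of_nonneg (Real.cosh_pos x).le]

theorem norm_ofReal_sinh_le (x : ℝ) : ‖(Real.sinh x : ℂ)‖ ≤ Real.cosh x := by
  rw [Complex.norm_real]; exact abs_sinh_le_cosh x

/-- Integration by parts with `h(v) = sin(τv)`. -/
theorem mul_integral_cexp_mul_cos {ζ : ℂ} (hζ : 0 < ζ.re) (τ : ℝ) :
    τ * ∫ v in Ioi (0 : ℝ), Complex.exp (-ζ * (Real.cosh v : ℂ)) * (Real.cos (τ * v) : ℂ) =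
      ζ * ∫ v in Ioi (0 : ℝ), Complex.exp (-ζ * (Real.cosh v : ℂ)) *
        (Real.sinh v * (Real.sin (τ * v) : ℂ)) := by
  have hd : ∀ v : ℝ, HasDerivAt (fun v : ℝ => (Real.sin (τ * v) : ℂ))
      ((Real.cos (τ * v) * τ : ℝ) : ℂ) v := fun v =>
    (((hasDerivAt_id v).const_mul τ).sin.congr_deriv (by simp)).ofReal_comp
  rw [← integral_cexp_neg_mul_cosh_mul_deriv hζ (C := 1 + |τ|) 0 hd (by fun_prop) (by simp),
    ← integral_const_mul]
  · refine integral_congr_ae (.of_forall fun v => ?_)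
    push_cast; ring
  · intro v
    simp only [pow_zero, mul_one]
    linarith [norm_ofReal_sin_le_one (τ * v), abs_nonneg τ]
  · intro v
    simp only [pow_zero, mul_one]
    rw [Complex.ofReal_mul, norm_mul, Complex.norm_real τ, Real.norm_eq_abs]
    nlinarith [norm_ofReal_cos_le_one (τ * v), abs_nonneg τ]

/-- Integration by parts with `h(v) = sinh v cos(τv)` and `sinh² = cosh² - 1`. Eliminating the `sinh
· sin` integral between this identity and the previous one yields the modified Bessel equation. -/
theorem integral_cexp_mul_cosh_cos_sub {ζ : ℂ} (hζ : 0 < ζ.re) (τ : ℝ) :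
    (∫ v in Ioi (0 : ℝ), Complex.exp (-ζ * (Real.cosh v : ℂ)) *
        (Real.cosh v * (Real.cos (τ * v) : ℂ)))
      - τ * ∫ v in Ioi (0 : ℝ), Complex.exp (-ζ * (Real.cosh v : ℂ)) *
        (Real.sinh v * (Real.sin (τ * v) : ℂ)) =
      ζ * ((∫ v in Ioi (0 : ℝ), Complex.exp (-ζ * (Real.cosh v : ℂ)) *
        (Real.cosh v * (Real.cosh v * (Real.cos (τ * v) : ℂ)))) -
        ∫ v in Ioi (0 : ℝ), Complex.exp (-ζ * (Real.cosh v : ℂ)) * (Real.cos (τ * v) : ℂ)) := by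
  have hd : ∀ v : ℝ, HasDerivAt (fun v : ℝ => ((Real.sinh v * Real.cos (τ * v) : ℝ) : ℂ))
      ((Real.cosh v * Real.cos (τ * v) + Real.sinh v * (-Real.sin (τ * v) * τ) : ℝ) : ℂ) v :=
    fun v => ((Real.hasDerivAt_sinh v).mul
      (((hasDerivAt_id v).const_mul τ).cos.congr_deriv (by simp))).ofReal_comp
  have key := integral_cexp_neg_mul_cosh_mul_deriv hζ (C := 1 + |τ|) 1 hd (by fun_prop) (by simp)
    ?_ ?_
  · have i0 : Integrable (fun v : ℝ => Complex.exp (-ζ * (Real.cosh v : ℂ)) *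
        (Real.cos (τ * v) : ℂ)) := by
      refine integrable_cexp_neg_mul_cosh_mul hζ (C := 1) 0
        (Continuous.aestronglyMeasurable (by fun_prop)) fun v => ?_
      simpa using norm_ofReal_cos_le_one (τ * v)
    have i1 : Integrable (fun v : ℝ => Complex.exp (-ζ * (Real.cosh v : ℂ)) *
        (Real.cosh v * (Real.cos (τ * v) : ℂ))) := by
      refine integrable_cexp_neg_mul_cosh_mul hζ (C := 1) 1
        (Continuous.aestronglyMeasurable (by fun_prop)) fun v => ?_
      rw [norm_mul, norm_ofReal_cosh, pow_one, one_mul]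
      exact mul_le_of_le_one_right (Real.cosh_pos v).le (norm_ofReal_cos_le_one _)
    have i2 : Integrable (fun v : ℝ => Complex.exp (-ζ * (Real.cosh v : ℂ)) *
        (Real.cosh v * (Real.cosh v * (Real.cos (τ * v) : ℂ)))) := by
      refine integrable_cexp_neg_mul_cosh_mul hζ (C := 1) 2
        (Continuous.aestronglyMeasurable (by fun_prop)) fun v => ?_
      rw [norm_mul, norm_mul, norm_ofReal_cosh, one_mul, pow_two, ← mul_assoc]
      exact mul_le_of_le_one_right (by positivity) (norm_ofReal_cos_le_one _)
    have i3 : Integrable (fun v : ℝ => Complex.exp (-ζ * (Real.cosh v : ℂ)) *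
        (Real.sinh v * (Real.sin (τ * v) : ℂ))) := by
      refine integrable_cexp_neg_mul_cosh_mul hζ (C := 1) 1
        (Continuous.aestronglyMeasurable (by fun_prop)) fun v => ?_
      rw [norm_mul, pow_one, one_mul]
      exact (mul_le_of_le_one_right (norm_nonneg _) (norm_ofReal_sin_le_one _)).trans
        (norm_ofReal_sinh_le v)
    rw [← integral_const_mul, ← integral_sub i1.restrict (i3.restrict.const_mul _),
      ← integral_sub i2.restrict i0.restrict]
    convert! key using 1
    · refine integral_congr_ae (.of_forall fun v => ?_)
      push_cast; ring
    · congr 1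
      refine integral_congr_ae (.of_forall fun v => ?_)
      have : ((Real.cosh v : ℂ)) ^ 2 = (Real.sinh v : ℂ) ^ 2 + 1 := by
        exact_mod_cast Real.cosh_sq v
      simp only [Complex.ofReal_mul]
      linear_combination (Complex.exp (-ζ * (Real.cosh v : ℂ)) * (Real.cos (τ * v) : ℂ)) * this
  · intro v
    rw [Complex.ofReal_mul, norm_mul, pow_one]
    have h1 := norm_ofReal_sinh_le v
    have h2 := norm_ofReal_cos_le_one (τ * v)
    have h3 := abs_nonneg τ
    have h4 := Real.cosh_pos v
    calc _ ≤ Real.cosh v * 1 := mul_le_mul h1 h2 (norm_nonneg _) h4.le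
      _ ≤ _ := by nlinarith
  · intro v
    rw [Complex.norm_real, pow_one]
    refine (norm_add_le _ _).trans ?_
    rw [norm_mul, norm_mul, norm_mul, norm_neg, Real.norm_eq_abs, Real.norm_eq_abs,
      Real.norm_eq_abs, Real.norm_eq_abs, Real.norm_eq_abs, abs_of_pos (Real.cosh_pos v), add_mul,
      one_mul]
    have h4 := Real.cosh_pos v
    refine add_le_add (mul_le_of_le_one_right h4.le (Real.abs_cos_le_one _)) ?_
    rw [mul_comm |τ|, mul_comm _ |τ|, mul_left_comm, mul_comm (Real.cosh v)]
    refine mul_le_mul_of_nonneg_left ?_ (abs_nonneg τ)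
    exact (mul_le_of_le_one_right (abs_nonneg _) (Real.abs_sin_le_one _)).trans
      (abs_sinh_le_cosh v)

/-- The derivative of `ζ ↦ K_{iτ}(ζ)`. -/
noncomputable def besselKDeriv (τ : ℝ) (ζ : ℂ) : ℂ :=
  -∫ v in Ioi (0 : ℝ), Complex.exp (-ζ * (Real.cosh v : ℂ)) *
    (Real.cosh v * (Real.cos (τ * v) : ℂ))

theorem hasDerivAt_besselK {ζ : ℂ} (hζ : 0 < ζ.re) (τ : ℝ) :
    HasDerivAt (besselK (Complex.I * τ)) (besselKDeriv τ ζ) ζ := by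
  have h := hasDerivAt_integral_cexp_neg_mul_cosh hζ (g := fun v => (Real.cos (τ * v) : ℂ))
    (C := 1) 0 (Continuous.aestronglyMeasurable (by fun_prop))
    (fun v => by simpa using norm_ofReal_cos_le_one (τ * v)) (Ioi 0)
  rwa [← (funext fun ζ => besselK_eq_integral_cos τ ζ :
    besselK (Complex.I * τ) = fun ζ => _)] at h

/-- The modified Bessel equation. -/
theorem hasDerivAt_mul_besselKDeriv {ζ : ℂ} (hζ : 0 < ζ.re) (τ : ℝ) :
    HasDerivAt (fun ζ => ζ * besselKDeriv τ ζ)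
      ((ζ ^ 2 - τ ^ 2) / ζ * besselK (Complex.I * τ) ζ) ζ := by
  have h := (hasDerivAt_integral_cexp_neg_mul_cosh hζ
    (g := fun v => (Real.cosh v : ℂ) * (Real.cos (τ * v) : ℂ))
    (C := 1) 1 (Continuous.aestronglyMeasurable (by fun_prop))
    (fun v => by
      rw [norm_mul, norm_ofReal_cosh, pow_one, one_mul]
      exact mul_le_of_le_one_right (Real.cosh_pos v).le (norm_ofReal_cos_le_one _)) (Ioi 0)).neg
  have h2 := (hasDerivAt_id ζ).mul h
  have e1 := mul_integral_cexp_mul_cos hζ τ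
  have e2 := integral_cexp_mul_cosh_cos_sub hζ τ
  have hζ0 : ζ ≠ 0 := by rintro rfl; simp at hζ
  refine h2.congr_deriv ?_
  simp only [id, neg_neg]
  rw [besselK_eq_integral_cos, div_mul_eq_mul_div, eq_div_iff hζ0]
  simp only [Pi.neg_apply]
  linear_combination (-ζ) * e2 + (τ : ℂ) * e1

/-! ### The connection formula between `K_{iτ}` and the series `I_{±iτ}`. -/

/-- Comparison of an incomplete Macdonald integral with the Gamma integral. -/
theorem norm_integral_sub_Gamma_le {ε : ℝ} (hε : |ε| ≤ 1) (l s : ℝ) :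
    ‖(∫ v in Ioi (0 : ℝ), Complex.exp (-(2 * Real.exp s : ℝ) * (Real.cosh v : ℂ)) *
        (((Real.exp s * (Real.exp v + ε * Real.exp (-v)) : ℝ) : ℂ) * Complex.exp (Complex.I * l * v)))
      - Complex.exp (-(Complex.I * l * s)) * Complex.Gamma (1 + Complex.I * l)‖ ≤
      3 * Real.exp s := by
  set r := Real.exp s with hr
  have hr0 : 0 < r := Real.exp_pos s
  -- `G` has integral `r^{-il} Γ(1+il)` over `(0,∞)`, and `t = e^v` identifies its part over `(1,∞)`
  -- with an integral over `v > 0`. The part over `(0,1)` costs at most `r`; the factor `exp(-r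
  -- e^{-v})` and the `ε`-term together cost at most `2r`.
  set G : ℝ → ℂ := fun t => (r : ℂ) * ((t : ℂ) ^ (Complex.I * l) * Complex.exp (-(r * t))) with hG
  have hGn : ∀ t, 0 < t → ‖G t‖ = r * Real.exp (-(r * t)) := by
    intro t ht
    rw [hG]
    simp only [norm_mul, Complex.norm_real, Real.norm_of_nonneg hr0.le]
    rw [Complex.norm_cpow_eq_rpow_re_of_pos ht, Complex.norm_exp]
    simp
  have hGc : ContinuousOn G (Ioi 0) := by
    refine continuousOn_const.mul (ContinuousOn.mul (fun t ht => ?_)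
      (Continuous.continuousOn (by fun_prop)))
    exact (Complex.continuousAt_ofReal_cpow_const t _ (Or.inr (ne_of_gt ht))).continuousWithinAt
  have hGi : IntegrableOn G (Ioi 0) := by
    have h1 := (exp_neg_integrableOn_Ioi 0 hr0).const_mul r
    refine Integrable.mono' h1 (hGc.aestronglyMeasurable measurableSet_Ioi) ?_
    filter_upwards [ae_restrict_mem measurableSet_Ioi] with t ht
    rw [hGn t ht, neg_mul]
  have hΓ : Complex.exp (-(Complex.I * l * s)) * Complex.Gamma (1 + Complex.I * l)
      = ∫ t in Ioi (0 : ℝ), G t := by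
    have h := Complex.integral_cpow_mul_exp_neg_mul_Ioi (a := 1 + Complex.I * l) (r := r)
      (by simp) hr0
    rw [hG]
    simp only
    rw [integral_const_mul]
    rw [add_sub_cancel_left] at h
    rw [h, ← mul_assoc]
    congr 1
    have hrc : (1 / r : ℂ) = (Real.exp (-s) : ℂ) := by
      rw [Real.exp_neg, ← hr, Complex.ofReal_inv, one_div]
    have hrc' : (r : ℂ) = Complex.exp s := by rw [hr, Complex.ofReal_exp]
    rw [hrc, Complex.cpow_def_of_ne_zero (by exact_mod_cast (Real.exp_pos _).ne'),
      ← Complex.ofReal_log (Real.exp_pos _).le, Real.log_exp, hrc', ← Complex.exp_add]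
    congr 1
    push_cast
    ring
  have hsplit : ∫ t in Ioi (0 : ℝ), G t = (∫ t in Ioc (0 : ℝ) 1, G t) + ∫ t in Ioi (1 : ℝ), G t := by
    rw [← setIntegral_union (Ioc_disjoint_Ioi le_rfl) measurableSet_Ioi
      (hGi.mono_set Ioc_subset_Ioi_self) (hGi.mono_set (Ioi_subset_Ioi zero_le_one)),
      Ioc_union_Ioi_eq_Ioi zero_le_one]
  have hsub : ∫ t in Ioi (1 : ℝ), G t = ∫ v in Ioi (0 : ℝ), Real.exp v • G (Real.exp v) := by
    rw [integral_comp_exp_Ioi, Real.exp_zero]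
  have hsubi : IntegrableOn (fun v => Real.exp v • G (Real.exp v)) (Ioi 0) := by
    rw [integrableOn_comp_exp_Ioi, Real.exp_zero]
    exact hGi.mono_set (Ioi_subset_Ioi zero_le_one)
  have hb1 : ‖∫ t in Ioc (0 : ℝ) 1, G t‖ ≤ r := by
    have := norm_setIntegral_le_of_norm_le_const (μ := volume) (s := Ioc (0 : ℝ) 1) (f := G) (C := r)
      (by simp) (fun t ht => by
        rw [hGn t ht.1]
        refine mul_le_of_le_one_right hr0.le (Real.exp_le_one_iff.2 ?_)
        have := mul_pos hr0 ht.1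
        linarith)
    simpa using this
  have hmi : IntegrableOn (fun v : ℝ => Complex.exp (-(2 * r : ℝ) * (Real.cosh v : ℂ)) *
        (((r * (Real.exp v + ε * Real.exp (-v)) : ℝ) : ℂ) * Complex.exp (Complex.I * l * v)))
        (Ioi 0) := by
    refine (integrable_cexp_neg_mul_cosh_mul (C := 2 * r) (by simpa using hr0) 1
      (Continuous.aestronglyMeasurable (by fun_prop)) fun v => ?_).integrableOn
    rw [norm_mul, Complex.norm_real, Complex.norm_exp, norm_mul, Real.norm_of_nonneg hr0.le]
    have h1 : ‖Real.exp v + ε * Real.exp (-v)‖ ≤ 2 * Real.cosh v := by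
      refine (norm_add_le _ _).trans ?_
      rw [norm_mul, Real.norm_of_nonneg (Real.exp_pos _).le, Real.norm_of_nonneg (Real.exp_pos _).le,
        Real.norm_eq_abs, Real.cosh_eq]
      nlinarith [Real.exp_pos (-v)]
    have h2 : (Complex.I * l * v).re = 0 := by simp
    rw [h2, Real.exp_zero, mul_one, pow_one, mul_comm 2 r, mul_assoc]
    exact mul_le_mul_of_nonneg_left h1 hr0.le
  rw [hΓ, hsplit, hsub, add_comm, ← sub_sub, ← integral_sub hmi hsubi]
  refine (norm_sub_le _ _).trans ?_
  have hb2 : ‖∫ v in Ioi (0 : ℝ), (Complex.exp (-(2 * r : ℝ) * (Real.cosh v : ℂ)) *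
        (((r * (Real.exp v + ε * Real.exp (-v)) : ℝ) : ℂ) * Complex.exp (Complex.I * l * v))
        - Real.exp v • G (Real.exp v))‖ ≤ 2 * r := by
    have h1 : ∫ v in Ioi (0 : ℝ), 2 * r * Real.exp (-v) = 2 * r := by
      rw [integral_const_mul, integral_exp_neg_Ioi_zero, mul_one]
    refine le_trans ?_ h1.le
    have h2 : IntegrableOn (fun v : ℝ => 2 * r * Real.exp (-v)) (Ioi 0) := by
      have := (exp_neg_integrableOn_Ioi 0 one_pos).const_mul (2 * r)
      simpa [IntegrableOn] using this
    refine norm_integral_le_of_norm_le h2 ?_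
    filter_upwards [ae_restrict_mem measurableSet_Ioi] with v hv
    have e1 : G (Real.exp v) = r * (Complex.exp (Complex.I * l * v) *
        (Real.exp (-(r * Real.exp v)) : ℂ)) := by
      rw [hG]
      simp only
      rw [Complex.cpow_def_of_ne_zero (by exact_mod_cast (Real.exp_pos _).ne'),
        ← Complex.ofReal_log (Real.exp_pos _).le, Real.log_exp]
      push_cast
      ring_nf
    have e2 : Complex.exp (-(2 * r : ℝ) * (Real.cosh v : ℂ)) *
        (((r * (Real.exp v + ε * Real.exp (-v)) : ℝ) : ℂ) * Complex.exp (Complex.I * l * v))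
        - Real.exp v • G (Real.exp v) =
        ((r * Real.exp (-(r * Real.exp v)) * (Real.exp v * (Real.exp (-(r * Real.exp (-v))) - 1)
          + ε * Real.exp (-v) * Real.exp (-(r * Real.exp (-v)))) : ℝ) : ℂ)
          * Complex.exp (Complex.I * l * v) := by
      have e3 : Complex.exp (-(2 * r : ℝ) * (Real.cosh v : ℂ)) =
          ((Real.exp (-(r * Real.exp v)) * Real.exp (-(r * Real.exp (-v))) : ℝ) : ℂ) := by
        rw [← Real.exp_add, Complex.ofReal_exp, Real.cosh_eq]
        push_cast
        ring_nf
      rw [e1, e3, Complex.real_smul]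
      push_cast
      ring
    have h0 : (Complex.I * l * v).re = 0 := by simp
    rw [e2, norm_mul, Complex.norm_exp, h0, Real.exp_zero, mul_one, Complex.norm_real, norm_mul,
      Real.norm_of_nonneg (by positivity)]
    set x := r * Real.exp (-v) with hx
    have hx0 : 0 < x := by positivity
    have h3 : |Real.exp (-x) - 1| ≤ x := by
      rw [abs_le]
      constructor
      · linarith [Real.add_one_le_exp (-x)]
      · linarith [Real.exp_le_one_iff.2 (by linarith : -x ≤ 0)]
    have h4 : Real.exp (-x) ≤ 1 := Real.exp_le_one_iff.2 (by linarith)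
    have h5 : Real.exp v * Real.exp (-v) = 1 := by rw [← Real.exp_add]; simp
    have h6 : Real.exp (-(r * Real.exp v)) * r ≤ Real.exp (-v) := by
      have : r * Real.exp v ≤ Real.exp (r * Real.exp v) := by
        linarith [Real.add_one_le_exp (r * Real.exp v)]
      rw [Real.exp_neg, Real.exp_neg, inv_mul_le_iff₀ (Real.exp_pos _), le_mul_inv_iff₀ (Real.exp_pos _)]
      exact this
    have h7 : ‖Real.exp v * (Real.exp (-x) - 1) + ε * Real.exp (-v) * Real.exp (-x)‖
        ≤ r + Real.exp (-v) := by
      refine (norm_add_le _ _).trans (add_le_add ?_ ?_)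
      · rw [norm_mul, Real.norm_of_nonneg (Real.exp_pos _).le, Real.norm_eq_abs]
        calc _ ≤ Real.exp v * x := mul_le_mul_of_nonneg_left h3 (Real.exp_pos _).le
          _ = r := by rw [hx, mul_left_comm, h5, mul_one]
      · rw [norm_mul, norm_mul, Real.norm_of_nonneg (Real.exp_pos _).le,
          Real.norm_of_nonneg (Real.exp_pos _).le, Real.norm_eq_abs]
        have h8 := Real.exp_pos (-v)
        have h9 : |ε| * Real.exp (-v) ≤ Real.exp (-v) := mul_le_of_le_one_left h8.le hε
        exact (mul_le_of_le_one_right (by positivity) h4).trans h9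
    have h10 : Real.exp (-(r * Real.exp v)) ≤ 1 := Real.exp_le_one_iff.2 (by
      have := Real.exp_pos v
      nlinarith [mul_pos hr0 this])
    calc _ ≤ r * Real.exp (-(r * Real.exp v)) * (r + Real.exp (-v)) :=
          mul_le_mul_of_nonneg_left h7 (by positivity)
      _ = r * (Real.exp (-(r * Real.exp v)) * r) + r * (Real.exp (-(r * Real.exp v)) * Real.exp (-v)) := by
          ring
      _ ≤ r * Real.exp (-v) + r * (1 * Real.exp (-v)) := by
          gcongr
      _ = _ := by ring
  linarith

/-- A generalized power series `∑ c_k e^((μ+2k)t)`. -/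
noncomputable def expSeries (μ : ℂ) (c : ℕ → ℂ) (t : ℂ) : ℂ := ∑' k : ℕ, c k * Complex.exp ((μ + 2 * k) * t)

theorem norm_cexp_add_two_mul_le (μ t : ℂ) {M : ℝ} (ht : ‖t‖ ≤ M) (k : ℕ) :
    ‖Complex.exp ((μ + 2 * k) * t)‖ ≤ Real.exp (‖μ‖ * M) * Real.exp (2 * M) ^ k := by
  rw [← Real.exp_nat_mul, ← Real.exp_add]
  refine (Complex.norm_exp_le_exp_norm _).trans (Real.exp_le_exp.2 ?_)
  rw [norm_mul]
  have h1 : ‖μ + 2 * (k : ℂ)‖ ≤ ‖μ‖ + 2 * k := by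
    refine (norm_add_le _ _).trans ?_
    simp
  calc _ ≤ (‖μ‖ + 2 * k) * M := mul_le_mul h1 ht (norm_nonneg _) (by positivity)
    _ = _ := by ring

theorem summable_norm_mul_add_two_mul {c : ℕ → ℂ} (hc : ∀ R : ℝ, Summable fun k => ‖c k‖ * R ^ k)
    (μ : ℂ) (R : ℝ) : Summable fun k => ‖c k * (μ + 2 * k)‖ * R ^ k := by
  refine Summable.of_norm_bounded (g := fun k => (‖μ‖ + 2) * (‖c k‖ * (2 * |R|) ^ k))
    ((hc _).mul_left _) fun k => ?_
  have h1 : ‖μ + 2 * (k : ℂ)‖ ≤ ‖μ‖ + 2 * k := by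
    refine (norm_add_le _ _).trans ?_
    simp
  have h2 : (k : ℝ) ≤ 2 ^ k := by exact_mod_cast (Nat.lt_two_pow_self).le
  have h3 : (1 : ℝ) ≤ 2 ^ k := one_le_pow₀ one_le_two
  rw [norm_mul, norm_norm, norm_mul, norm_pow, Real.norm_eq_abs, mul_pow]
  have h4 : ‖μ + 2 * (k : ℂ)‖ ≤ (‖μ‖ + 2) * 2 ^ k := by nlinarith [norm_nonneg μ]
  calc _ ≤ ‖c k‖ * ((‖μ‖ + 2) * 2 ^ k) * |R| ^ k := by gcongr
    _ = _ := by ring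

/-- In the logarithmic variable the series is entire, so no branch of a power has to be chosen.
Termwise differentiation multiplies the coefficients by `μ + 2k`, which preserves their summability
against every `R^k`. -/
theorem hasDerivAt_expSeries {c : ℕ → ℂ} (hc : ∀ R : ℝ, Summable fun k => ‖c k‖ * R ^ k)
    (μ t : ℂ) : HasDerivAt (expSeries μ c) (expSeries μ (fun k => c k * (μ + 2 * k)) t) t := by
  set M := ‖t‖ + 1
  have hb : ∀ (c : ℕ → ℂ) (k : ℕ), ∀ z ∈ Metric.ball (0 : ℂ) M,
      ‖c k * Complex.exp ((μ + 2 * k) * z)‖ ≤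
        Real.exp (‖μ‖ * M) * (‖c k‖ * Real.exp (2 * M) ^ k) := by
    intro c k z hz
    rw [norm_mul, mul_left_comm]
    exact mul_le_mul_of_nonneg_left (norm_cexp_add_two_mul_le μ z (mem_ball_zero_iff.1 hz).le k)
      (norm_nonneg _)
  have ht : t ∈ Metric.ball (0 : ℂ) M := by simp [M]
  refine hasDerivAt_tsum_of_isPreconnected
    (g := fun k z => c k * Complex.exp ((μ + 2 * k) * z))
    (g' := fun k z => c k * (μ + 2 * k) * Complex.exp ((μ + 2 * k) * z))
    (((summable_norm_mul_add_two_mul hc μ (Real.exp (2 * M)))).mul_left (Real.exp (‖μ‖ * M)))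
    Metric.isOpen_ball (convex_ball (0 : ℂ) M).isPreconnected ?_ ?_ ht ?_ ht
  · intro k z _
    have h := (((hasDerivAt_id z).const_mul (μ + 2 * (k : ℂ))).cexp).const_mul (c k)
    refine h.congr_deriv ?_
    simp only [id]
    ring
  · intro k z hz
    exact hb (fun k => c k * (μ + 2 * k)) k z hz
  · exact Summable.of_norm_bounded ((hc (Real.exp (2 * M))).mul_left (Real.exp (‖μ‖ * M)))
      fun k => hb c k t ht

/-- Every term with `k ≥ 1` is `O(e^{2s})`, whereas for imaginary `μ` the term `k = 0` oscillates
without decaying and has to be subtracted. -/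
theorem tendsto_expSeries_sub {c : ℕ → ℂ} (hc : ∀ R : ℝ, Summable fun k => ‖c k‖ * R ^ k)
    {μ : ℂ} (hμ : μ.re = 0) :
    Filter.Tendsto (fun s : ℝ => expSeries μ c s - c 0 * Complex.exp (μ * s)) Filter.atBot
      (nhds 0) := by
  have hs1 : Summable fun k => ‖c (k + 1)‖ := by
    have := hc 1
    simp only [one_pow, mul_one] at this
    exact (summable_nat_add_iff 1).2 this
  have hlim : Filter.Tendsto (fun s : ℝ => Real.exp (2 * s) * ∑' k, ‖c (k + 1)‖) Filter.atBot
      (nhds 0) := by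
    have := (Real.tendsto_exp_atBot.comp
      (Filter.tendsto_id.const_mul_atBot (zero_lt_two (α := ℝ)))).mul_const (∑' k, ‖c (k + 1)‖)
    simpa [Function.comp_def] using this
  refine squeeze_zero_norm' ?_ hlim
  filter_upwards [Filter.eventually_le_atBot (0 : ℝ)] with s hs
  have hn : ∀ k : ℕ, ‖c k * Complex.exp ((μ + 2 * k) * s)‖ = ‖c k‖ * Real.exp (2 * s) ^ k := by
    intro k
    rw [norm_mul, Complex.norm_exp, ← Real.exp_nat_mul]
    congr 2
    simp [hμ]
    ring
  have hsum : Summable fun k : ℕ => c k * Complex.exp ((μ + 2 * k) * s) := by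
    refine Summable.of_norm ?_
    simp only [hn]
    exact hc _
  have e1 : expSeries μ c s - c 0 * Complex.exp (μ * s)
      = ∑' k : ℕ, c (k + 1) * Complex.exp ((μ + 2 * (k + 1 : ℕ)) * s) := by
    rw [expSeries, hsum.tsum_eq_zero_add]
    simp
  rw [e1, ← tsum_mul_left]
  refine tsum_of_norm_bounded (hs1.mul_left _).hasSum fun k => ?_
  rw [hn, pow_succ', mul_left_comm]
  refine mul_le_mul_of_nonneg_left ?_ (Real.exp_pos _).le
  refine mul_le_of_le_one_right (norm_nonneg _) (pow_le_one₀ (Real.exp_pos _).le ?_)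
  exact Real.exp_le_one_iff.2 (by linarith)

/-- The coefficients of the modified Bessel function `I_μ(2 e^t)`. -/
noncomputable def besselCoeff (μ : ℂ) (k : ℕ) : ℂ := 1 / ((k.factorial : ℂ) * Complex.Gamma (μ + k + 1))

/-- The functional equation of `Γ`; `Re μ = 0` keeps `μ + k + 1` away from `0`. This recurrence is
the differential equation read on coefficients. -/
theorem besselCoeff_succ {μ : ℂ} (hμ : μ.re = 0) (k : ℕ) :
    besselCoeff μ (k + 1) * ((k + 1) * (μ + k + 1)) = besselCoeff μ k := by
  have h0 : μ + k + 1 ≠ 0 := by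
    intro h
    have := congrArg Complex.re h
    simp [hμ] at this
    linarith [(Nat.cast_nonneg k : (0 : ℝ) ≤ k)]
  have hG : Complex.Gamma (μ + k + 1) ≠ 0 := Complex.Gamma_ne_zero_of_re_pos (by
    simp [hμ]; positivity)
  rw [besselCoeff, besselCoeff, Nat.factorial_succ]
  have e : μ + ((k + 1 : ℕ) : ℂ) + 1 = (μ + k + 1) + 1 := by push_cast; ring
  rw [e, Complex.Gamma_add_one _ h0]
  have hk : (k.factorial : ℂ) ≠ 0 := by exact_mod_cast k.factorial_ne_zero
  have hk1 : (k : ℂ) + 1 ≠ 0 := by exact_mod_cast k.succ_ne_zero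
  push_cast
  field_simp

theorem norm_besselCoeff_le {μ : ℂ} (hμ : μ.re = 0) (k : ℕ) :
    ‖besselCoeff μ k‖ ≤ ‖besselCoeff μ 0‖ / k.factorial := by
  induction k with
  | zero => simp
  | succ k ih =>
    have h := congrArg norm (besselCoeff_succ hμ k)
    rw [norm_mul, norm_mul] at h
    have h1 : (k : ℝ) + 1 ≤ ‖μ + k + 1‖ := by
      have := Complex.re_le_norm (μ + k + 1)
      simpa [hμ] using this
    have h1' : (1 : ℝ) ≤ ‖μ + k + 1‖ := le_trans (by linarith [(Nat.cast_nonneg k : (0 : ℝ) ≤ k)]) h1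
    have h2 : ‖(k : ℂ) + 1‖ = k + 1 := by
      rw [← Nat.cast_succ, Complex.norm_natCast, Nat.cast_succ]
    rw [h2] at h
    have h3 : ‖besselCoeff μ (k + 1)‖ * (k + 1) ≤ ‖besselCoeff μ k‖ := by
      rw [← h]
      refine mul_le_mul_of_nonneg_left ?_ (norm_nonneg _)
      exact le_mul_of_one_le_right (by positivity) h1'
    rw [Nat.factorial_succ, Nat.cast_mul, le_div_iff₀ (by positivity)]
    rw [le_div_iff₀ (by positivity)] at ih
    push_cast
    calc _ = (‖besselCoeff μ (k + 1)‖ * (k + 1)) * k.factorial := by ring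
      _ ≤ ‖besselCoeff μ k‖ * k.factorial := by gcongr
      _ ≤ _ := ih

theorem summable_besselCoeff {μ : ℂ} (hμ : μ.re = 0) (R : ℝ) :
    Summable fun k => ‖besselCoeff μ k‖ * R ^ k := by
  refine Summable.of_norm_bounded (g := fun k => ‖besselCoeff μ 0‖ * (|R| ^ k / k.factorial))
    ((Real.summable_pow_div_factorial _).mul_left _) fun k => ?_
  rw [norm_mul, norm_norm, norm_pow, Real.norm_eq_abs]
  calc _ ≤ ‖besselCoeff μ 0‖ / k.factorial * |R| ^ k :=
        mul_le_mul_of_nonneg_right (norm_besselCoeff_le hμ k) (by positivity)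
    _ = _ := by ring

/-- The differential equation of `t ↦ I_μ(2 e^t)`. -/
theorem expSeries_besselCoeff_ode {μ : ℂ} (hμ : μ.re = 0) (t : ℂ) :
    expSeries μ (fun k => besselCoeff μ k * (μ + 2 * k) * (μ + 2 * k)) t
      = (4 * Complex.exp (2 * t) + μ ^ 2) * expSeries μ (besselCoeff μ) t := by
  have hs : ∀ {c : ℕ → ℂ}, (∀ R : ℝ, Summable fun k => ‖c k‖ * R ^ k) →
      Summable fun k : ℕ => c k * Complex.exp ((μ + 2 * k) * t) := by
    intro c hc
    refine Summable.of_norm_bounded ((hc (Real.exp (2 * ‖t‖))).mul_left (Real.exp (‖μ‖ * ‖t‖)))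
      fun k => ?_
    rw [norm_mul, mul_left_comm]
    exact mul_le_mul_of_nonneg_left (norm_cexp_add_two_mul_le μ t le_rfl k) (norm_nonneg _)
  have h0 := hs (summable_besselCoeff hμ)
  have h2 := hs (summable_norm_mul_add_two_mul
    (summable_norm_mul_add_two_mul (summable_besselCoeff hμ) μ) μ)
  have h3 : Summable fun k : ℕ => (besselCoeff μ k * (μ + 2 * k) * (μ + 2 * k)
      - μ ^ 2 * besselCoeff μ k) * Complex.exp ((μ + 2 * k) * t) := by
    refine (h2.sub (h0.mul_left (μ ^ 2))).congr fun k => ?_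
    ring
  have e1 : expSeries μ (fun k => besselCoeff μ k * (μ + 2 * k) * (μ + 2 * k)) t
      - μ ^ 2 * expSeries μ (besselCoeff μ) t = ∑' k : ℕ, (besselCoeff μ k * (μ + 2 * k) * (μ + 2 * k)
      - μ ^ 2 * besselCoeff μ k) * Complex.exp ((μ + 2 * k) * t) := by
    rw [expSeries, expSeries, ← tsum_mul_left, ← h2.tsum_sub (h0.mul_left (μ ^ 2))]
    exact tsum_congr fun k => by ring
  -- Since `(μ+2k)² - μ² = 4k(μ+k)`, the term `k = 0` vanishes, and after an index shift the
  -- recurrence turns the rest into `4e^{2t}` times the original series.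
  have e2 : ∑' k : ℕ, (besselCoeff μ k * (μ + 2 * k) * (μ + 2 * k)
      - μ ^ 2 * besselCoeff μ k) * Complex.exp ((μ + 2 * k) * t)
      = 4 * Complex.exp (2 * t) * expSeries μ (besselCoeff μ) t := by
    rw [h3.tsum_eq_zero_add, expSeries, ← tsum_mul_left]
    have e3 : (besselCoeff μ 0 * (μ + 2 * (0 : ℕ)) * (μ + 2 * (0 : ℕ))
      - μ ^ 2 * besselCoeff μ 0) * Complex.exp ((μ + 2 * (0 : ℕ)) * t) = 0 := by
      push_cast; ring
    rw [e3, zero_add]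
    refine tsum_congr fun k => ?_
    rw [← besselCoeff_succ hμ k]
    have e4 : Complex.exp ((μ + 2 * ((k + 1 : ℕ) : ℂ)) * t)
        = Complex.exp (2 * t) * Complex.exp ((μ + 2 * k) * t) := by
      rw [← Complex.exp_add]
      congr 1
      push_cast; ring
    rw [e4]
    push_cast
    ring
  rw [e2] at e1
  linear_combination e1

/-- Uniqueness at `-∞` for `g'' = (4 e^(2s) - τ²) g`. -/
theorem eq_zero_of_bessel_ode {τ : ℝ} (hτ : τ ≠ 0) {g g' : ℝ → ℂ}
    (h1 : ∀ s, HasDerivAt g (g' s) s)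
    (h2 : ∀ s, HasDerivAt g' (((4 * Real.exp (2 * s) - τ ^ 2 : ℝ) : ℂ) * g s) s)
    (hg : Filter.Tendsto g Filter.atBot (nhds 0)) (hg' : Filter.Tendsto g' Filter.atBot (nhds 0))
    (s : ℝ) : g s = 0 := by
  -- An energy argument. The `τ²` terms cancel in `E' = 8 e^{2s} ⟨g', g⟩`, which is at most `(4/|τ|)
  -- e^{2s} E`, and the exponential in `W` is the integrating factor. So `W` is antitone and tends
  -- to `0` at `-∞`, which forces `W ≤ 0`.
  set E : ℝ → ℝ := fun s => ‖g' s‖ ^ 2 + τ ^ 2 * ‖g s‖ ^ 2 with hE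
  set W : ℝ → ℝ := fun s => E s * Real.exp (-(2 / |τ| * Real.exp (2 * s))) with hW
  have hτ' : 0 < |τ| := abs_pos.2 hτ
  have hd : ∀ s, HasDerivAt E (2 * inner ℝ (g' s) (((4 * Real.exp (2 * s) - τ ^ 2 : ℝ) : ℂ) * g s)
      + τ ^ 2 * (2 * inner ℝ (g s) (g' s))) s := fun s =>
    (h2 s).norm_sq.add ((h1 s).norm_sq.const_mul _)
  have hexp : ∀ s, HasDerivAt (fun s => Real.exp (-(2 / |τ| * Real.exp (2 * s))))
      (Real.exp (-(2 / |τ| * Real.exp (2 * s))) * (-(4 / |τ| * Real.exp (2 * s)))) s := by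
    intro s
    have := (((((hasDerivAt_id s).const_mul 2).exp).const_mul (2 / |τ|)).neg).exp
    refine this.congr_deriv ?_
    simp only [id, Pi.neg_apply]
    ring
  have hWd : ∀ s, HasDerivAt W _ s := fun s => (hd s).mul (hexp s)
  have hanti : Antitone W := by
    refine antitone_of_deriv_nonpos (fun s => (hWd s).differentiableAt) fun s => ?_
    rw [(hWd s).deriv]
    have e1 : 2 * inner ℝ (g' s) (((4 * Real.exp (2 * s) - τ ^ 2 : ℝ) : ℂ) * g s)
      + τ ^ 2 * (2 * inner ℝ (g s) (g' s)) = 8 * Real.exp (2 * s) * inner ℝ (g' s) (g s) := by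
      rw [← Complex.real_smul, real_inner_smul_right, real_inner_comm (g' s) (g s)]
      ring
    have e2 : inner ℝ (g' s) (g s) ≤ ‖g' s‖ * ‖g s‖ := real_inner_le_norm _ _
    have e3 : 2 * (|τ| * (‖g' s‖ * ‖g s‖)) ≤ E s := by
      have := two_mul_le_add_sq (‖g' s‖) (|τ| * ‖g s‖)
      rw [hE]
      simp only
      rw [mul_pow, sq_abs] at this
      linarith
    have e4 : 8 * Real.exp (2 * s) * inner ℝ (g' s) (g s) ≤ 4 / |τ| * Real.exp (2 * s) * E s := by
      have e5 : 2 * inner ℝ (g' s) (g s) ≤ E s / |τ| := by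
        rw [le_div_iff₀ hτ']
        nlinarith
      calc _ = 4 * Real.exp (2 * s) * (2 * inner ℝ (g' s) (g s)) := by ring
        _ ≤ 4 * Real.exp (2 * s) * (E s / |τ|) := by gcongr
        _ = _ := by ring
    rw [e1]
    have e6 := Real.exp_pos (-(2 / |τ| * Real.exp (2 * s)))
    nlinarith
  have hlim : Filter.Tendsto W Filter.atBot (nhds 0) := by
    have hE0 : Filter.Tendsto E Filter.atBot (nhds 0) := by
      have := (hg'.norm.pow 2).add ((hg.norm.pow 2).const_mul (τ ^ 2))
      simpa using this
    refine squeeze_zero (fun s => by positivity) (fun s => ?_) hE0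
    refine mul_le_of_le_one_right (by positivity) (Real.exp_le_one_iff.2 ?_)
    have : 0 ≤ 2 / |τ| * Real.exp (2 * s) := by positivity
    linarith
  have hW0 : W s ≤ 0 := ge_of_tendsto hlim
    ((Filter.eventually_le_atBot s).mono fun x hx => hanti hx)
  have hE0 : E s ≤ 0 := by
    have e6 := Real.exp_pos (-(2 / |τ| * Real.exp (2 * s)))
    by_contra hcon
    push Not at hcon
    have := mul_pos hcon e6
    exact absurd hW0 (not_le.2 this)
  have h3 : ‖g s‖ ^ 2 ≤ 0 := by
    have h4 : 0 < τ ^ 2 := by positivity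
    have h5 : 0 ≤ ‖g' s‖ ^ 2 := by positivity
    rw [hE] at hE0
    simp only at hE0
    by_contra hcon
    push Not at hcon
    nlinarith [mul_pos h4 hcon]
  have h4 : ‖g s‖ = 0 := by
    have := sq_nonneg ‖g s‖
    exact pow_eq_zero_iff two_ne_zero |>.1 (le_antisymm h3 this)
  simpa using h4

/-- The integration by parts against `sin(τv)` brings in the factor `sinh v`, hence integrals of the
type compared with `Γ(1 ± iτ)` (with `ε = -1`). Without it the comparison would be with the Gamma
integral at `±iτ`, which does not converge absolutely. -/
theorem besselK_two_mul_exp_eq {τ : ℝ} (hτ : τ ≠ 0) (s : ℝ) :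
    besselK (Complex.I * τ) ((2 * Real.exp s : ℝ) : ℂ) =
      1 / (2 * Complex.I * τ) * ((∫ v in Ioi (0 : ℝ),
        Complex.exp (-(2 * Real.exp s : ℝ) * (Real.cosh v : ℂ)) *
        (((Real.exp s * (Real.exp v + (-1) * Real.exp (-v)) : ℝ) : ℂ)
          * Complex.exp (Complex.I * τ * v)))
      - ∫ v in Ioi (0 : ℝ), Complex.exp (-(2 * Real.exp s : ℝ) * (Real.cosh v : ℂ)) *
        (((Real.exp s * (Real.exp v + (-1) * Real.exp (-v)) : ℝ) : ℂ)
          * Complex.exp (Complex.I * (-τ : ℝ) * v))) := by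
  have hζ : 0 < (((2 * Real.exp s : ℝ) : ℂ)).re := by
    rw [Complex.ofReal_re]; positivity
  have hτc : (τ : ℂ) ≠ 0 := by exact_mod_cast hτ
  have hint : ∀ l : ℝ, Integrable fun v : ℝ =>
      Complex.exp (-(2 * Real.exp s : ℝ) * (Real.cosh v : ℂ)) *
        (((Real.exp s * (Real.exp v + (-1) * Real.exp (-v)) : ℝ) : ℂ)
          * Complex.exp (Complex.I * l * v)) := by
    intro l
    refine integrable_cexp_neg_mul_cosh_mul (C := 2 * Real.exp s) hζ 1
      (Continuous.aestronglyMeasurable (by fun_prop)) fun v => ?_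
    have h2 : (Complex.I * l * v).re = 0 := by simp
    rw [norm_mul, Complex.norm_exp, h2, Real.exp_zero, mul_one, Complex.norm_real, norm_mul,
      Real.norm_of_nonneg (Real.exp_pos s).le, pow_one, mul_comm 2, mul_assoc]
    refine mul_le_mul_of_nonneg_left ?_ (Real.exp_pos s).le
    have := abs_sinh_le_cosh v
    rw [Real.sinh_eq, abs_div, abs_two, div_le_iff₀ two_pos] at this
    rw [Real.norm_eq_abs, neg_one_mul, ← sub_eq_add_neg]
    linarith
  have h := mul_integral_cexp_mul_cos hζ τ
  rw [← besselK_eq_integral_cos] at h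
  rw [← integral_sub (hint τ).integrableOn (hint (-τ)).integrableOn, one_div_mul_eq_div,
    eq_div_iff (by simp [hτ]), mul_comm, mul_assoc, mul_assoc, h, ← integral_const_mul,
    ← integral_const_mul, ← integral_const_mul]
  refine integral_congr_ae (.of_forall fun v => ?_)
  have e1 : (Real.sin (τ * v) : ℂ) * (2 * Complex.I) =
      Complex.exp (Complex.I * τ * v) - Complex.exp (Complex.I * (-τ : ℝ) * v) := by
    rw [Complex.ofReal_sin, Complex.sin]
    push_cast
    have e2 : -((τ : ℂ) * v) * Complex.I = Complex.I * -τ * v := by ring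
    have e3 : ((τ : ℂ) * v) * Complex.I = Complex.I * τ * v := by ring
    rw [e2, e3]
    linear_combination (Complex.exp (Complex.I * -τ * v) - Complex.exp (Complex.I * τ * v)) *
      Complex.I_sq
  simp only
  rw [← mul_sub, ← mul_sub, ← e1, Real.sinh_eq]
  push_cast
  ring

/-- Here the derivative already supplies `cosh v`, so no integration by parts is needed and the
Gamma comparison applies with `ε = 1`. -/
theorem mul_besselKDeriv_two_mul_exp_eq (τ : ℝ) (s : ℝ) :
    ((2 * Real.exp s : ℝ) : ℂ) * besselKDeriv τ ((2 * Real.exp s : ℝ) : ℂ) =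
      -(1 / 2) * ((∫ v in Ioi (0 : ℝ),
        Complex.exp (-(2 * Real.exp s : ℝ) * (Real.cosh v : ℂ)) *
        (((Real.exp s * (Real.exp v + 1 * Real.exp (-v)) : ℝ) : ℂ)
          * Complex.exp (Complex.I * τ * v)))
      + ∫ v in Ioi (0 : ℝ), Complex.exp (-(2 * Real.exp s : ℝ) * (Real.cosh v : ℂ)) *
        (((Real.exp s * (Real.exp v + 1 * Real.exp (-v)) : ℝ) : ℂ)
          * Complex.exp (Complex.I * (-τ : ℝ) * v))) := by
  have hζ : 0 < (((2 * Real.exp s : ℝ) : ℂ)).re := by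
    rw [Complex.ofReal_re]; positivity
  have hint : ∀ l : ℝ, Integrable fun v : ℝ =>
      Complex.exp (-(2 * Real.exp s : ℝ) * (Real.cosh v : ℂ)) *
        (((Real.exp s * (Real.exp v + 1 * Real.exp (-v)) : ℝ) : ℂ)
          * Complex.exp (Complex.I * l * v)) := by
    intro l
    refine integrable_cexp_neg_mul_cosh_mul (C := 2 * Real.exp s) hζ 1
      (Continuous.aestronglyMeasurable (by fun_prop)) fun v => ?_
    have h2 : (Complex.I * l * v).re = 0 := by simp
    rw [norm_mul, Complex.norm_exp, h2, Real.exp_zero, mul_one, Complex.norm_real, norm_mul,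
      Real.norm_of_nonneg (Real.exp_pos s).le, pow_one, mul_comm 2, mul_assoc]
    refine mul_le_mul_of_nonneg_left ?_ (Real.exp_pos s).le
    rw [Real.norm_of_nonneg (by positivity), Real.cosh_eq]
    linarith
  rw [← integral_add (hint τ).integrableOn (hint (-τ)).integrableOn, besselKDeriv, mul_neg, neg_mul,
    ← integral_const_mul, ← integral_const_mul]
  congr 1
  refine integral_congr_ae (.of_forall fun v => ?_)
  have e1 : (Real.cos (τ * v) : ℂ) * 2 =
      Complex.exp (Complex.I * τ * v) + Complex.exp (Complex.I * (-τ : ℝ) * v) := by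
    rw [Complex.ofReal_cos, Complex.cos]
    push_cast
    have e2 : -((τ : ℂ) * v) * Complex.I = Complex.I * -τ * v := by ring
    have e3 : ((τ : ℂ) * v) * Complex.I = Complex.I * τ * v := by ring
    rw [e2, e3]
    ring
  simp only
  rw [← mul_add, ← mul_add, ← e1, Real.cosh_eq]
  push_cast
  ring

theorem tendsto_integral_sub_Gamma {ε : ℝ} (hε : |ε| ≤ 1) (l : ℝ) : Filter.Tendsto (fun s : ℝ =>
    (∫ v in Ioi (0 : ℝ), Complex.exp (-(2 * Real.exp s : ℝ) * (Real.cosh v : ℂ)) *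
        (((Real.exp s * (Real.exp v + ε * Real.exp (-v)) : ℝ) : ℂ) * Complex.exp (Complex.I * l * v)))
      - Complex.exp (-(Complex.I * l * s)) * Complex.Gamma (1 + Complex.I * l))
    Filter.atBot (nhds 0) := by
  refine squeeze_zero_norm (norm_integral_sub_Gamma_le hε l) ?_
  simpa using Real.tendsto_exp_atBot.const_mul 3

theorem besselCoeff_zero (μ : ℂ) : besselCoeff μ 0 = 1 / Complex.Gamma (1 + μ) := by
  simp [besselCoeff, add_comm]

/-- The connection formula on the positive half line. -/
theorem besselK_two_mul_exp_eq_expSeries {τ : ℝ} (hτ : τ ≠ 0) (s : ℝ) :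
    besselK (Complex.I * τ) ((2 * Real.exp s : ℝ) : ℂ) =
      Complex.Gamma (1 + Complex.I * τ) * Complex.Gamma (1 - Complex.I * τ) / (2 * Complex.I * τ) *
        (expSeries (-(Complex.I * τ)) (besselCoeff (-(Complex.I * τ))) s
          - expSeries (Complex.I * τ) (besselCoeff (Complex.I * τ)) s) := by
  set μ : ℂ := Complex.I * τ with hμ
  have hμr : μ.re = 0 := by simp [hμ]
  have hμr' : (-μ).re = 0 := by simp [hμ]
  have hτc : (τ : ℂ) ≠ 0 := by exact_mod_cast hτ
  have hμ0 : μ ≠ 0 := mul_ne_zero Complex.I_ne_zero hτc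
  have h2μ : 2 * Complex.I * (τ : ℂ) = 2 * μ := by rw [hμ]; ring
  rw [h2μ]
  have hG1 : Complex.Gamma (1 + μ) ≠ 0 := Complex.Gamma_ne_zero_of_re_pos (by simp [hμr])
  have hG2 : Complex.Gamma (1 - μ) ≠ 0 := Complex.Gamma_ne_zero_of_re_pos (by simp [hμr])
  set κ : ℂ := Complex.Gamma (1 + μ) * Complex.Gamma (1 - μ) / (2 * μ) with hκ
  have sm := summable_besselCoeff hμr'
  have sp := summable_besselCoeff hμr
  set bm1 := fun k : ℕ => (besselCoeff (-μ)) k * (-μ + 2 * k) with hbm1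
  set bp1 := fun k : ℕ => (besselCoeff μ) k * (μ + 2 * k) with hbp1
  have sm1 := summable_norm_mul_add_two_mul sm (-μ)
  have sp1 := summable_norm_mul_add_two_mul sp μ
  have hbm0 : (besselCoeff (-μ)) 0 = 1 / Complex.Gamma (1 - μ) := by rw [besselCoeff_zero, sub_eq_add_neg]
  have hbp0 : (besselCoeff μ) 0 = 1 / Complex.Gamma (1 + μ) := by rw [besselCoeff_zero]
  have hre : ∀ s : ℝ, 0 < (((2 * Real.exp s : ℝ) : ℂ)).re := fun s => by
    rw [Complex.ofReal_re]; positivity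
  have hζd : ∀ s : ℝ, HasDerivAt (fun s : ℝ => ((2 * Real.exp s : ℝ) : ℂ))
      ((2 * Real.exp s : ℝ) : ℂ) s := fun s =>
    ((Real.hasDerivAt_exp s).const_mul 2).ofReal_comp
  -- `g` solves the homogeneous equation. At `-∞` both parts have the leading term `(Γ(1+μ) e^{-μs}
  -- - Γ(1-μ) e^{μs}) / (2μ)`, and their derivatives agree to leading order as well, so `g` and `g'`
  -- tend to `0` and uniqueness applies.
  set g : ℝ → ℂ := fun s => besselK μ ((2 * Real.exp s : ℝ) : ℂ)
    - κ * (expSeries (-μ) (besselCoeff (-μ)) s - expSeries μ (besselCoeff μ) s) with hg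
  set g' : ℝ → ℂ := fun s => ((2 * Real.exp s : ℝ) : ℂ) * besselKDeriv τ ((2 * Real.exp s : ℝ) : ℂ)
    - κ * (expSeries (-μ) bm1 s - expSeries μ bp1 s) with hg'
  have key : g s = 0 := by
    refine eq_zero_of_bessel_ode hτ (g' := g') (fun s => ?_) (fun s => ?_) ?_ ?_ s
    · have h1 : HasDerivAt (fun s : ℝ => besselK μ ((2 * Real.exp s : ℝ) : ℂ)) _ s :=
        HasDerivAt.comp (h₂ := besselK μ) s (hasDerivAt_besselK (hre s) τ) (hζd s)
      have h2 := (hasDerivAt_expSeries sm (-μ) s).comp_ofReal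
      have h3 := (hasDerivAt_expSeries sp μ s).comp_ofReal
      refine (h1.sub ((h2.sub h3).const_mul κ)).congr_deriv ?_
      rw [hg']
      simp only
      ring
    · have h1 : HasDerivAt (fun s : ℝ => ((2 * Real.exp s : ℝ) : ℂ) *
          besselKDeriv τ ((2 * Real.exp s : ℝ) : ℂ)) _ s :=
        HasDerivAt.comp (h₂ := fun ζ => ζ * besselKDeriv τ ζ) s
          (hasDerivAt_mul_besselKDeriv (hre s) τ) (hζd s)
      have h2 := (hasDerivAt_expSeries sm1 (-μ) s).comp_ofReal
      have h3 := (hasDerivAt_expSeries sp1 μ s).comp_ofReal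
      refine (h1.sub ((h2.sub h3).const_mul κ)).congr_deriv ?_
      rw [expSeries_besselCoeff_ode hμr', expSeries_besselCoeff_ode hμr, hg]
      simp only
      have hζ0 : ((2 * Real.exp s : ℝ) : ℂ) ≠ 0 := by
        exact_mod_cast (by positivity : (2 * Real.exp s : ℝ) ≠ 0)
      have e1 : ((2 * Real.exp s : ℝ) : ℂ) ^ 2 = 4 * Complex.exp (2 * s) := by
        push_cast
        rw [mul_pow, ← Complex.exp_nat_mul]
        push_cast
        ring
      have e2 : μ ^ 2 = -(τ : ℂ) ^ 2 := by rw [hμ, mul_pow, Complex.I_sq]; ring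
      rw [mul_comm _ ((2 * Real.exp s : ℝ) : ℂ), ← mul_assoc, mul_div_cancel₀ _ hζ0, e1, neg_sq, e2]
      push_cast
      ring
    · have t1 := ((tendsto_integral_sub_Gamma (ε := -1) (by simp) τ).sub
        (tendsto_integral_sub_Gamma (ε := -1) (by simp) (-τ))).const_mul (1 / (2 * μ))
      have t2 := ((tendsto_expSeries_sub sm hμr').sub (tendsto_expSeries_sub sp hμr)).const_mul κ
      have t3 := t1.sub t2
      simp only [sub_zero, mul_zero] at t3
      refine t3.congr fun s => ?_
      rw [hg]
      simp only
      rw [hμ, besselK_two_mul_exp_eq hτ s, ← hμ, h2μ, hbm0, hbp0]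
      have e1 : Complex.I * ((-τ : ℝ) : ℂ) = -μ := by rw [hμ]; push_cast; ring
      have e2 : (1 : ℂ) + -μ = 1 - μ := by ring
      rw [e1, hκ, e2, neg_mul μ, neg_neg]
      field_simp
      ring
    · have t1 := ((tendsto_integral_sub_Gamma (ε := 1) (by simp) τ).add
        (tendsto_integral_sub_Gamma (ε := 1) (by simp) (-τ))).const_mul (-(1 / 2) : ℂ)
      have t2 := ((tendsto_expSeries_sub sm1 hμr').sub (tendsto_expSeries_sub sp1 hμr)).const_mul κ
      have t3 := t1.sub t2
      simp only [sub_zero, mul_zero, add_zero] at t3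
      refine t3.congr fun s => ?_
      rw [hg']
      simp only
      rw [mul_besselKDeriv_two_mul_exp_eq τ s]
      simp only [hbm1, hbp1, hbm0, hbp0]
      have e1 : Complex.I * ((-τ : ℝ) : ℂ) = -μ := by rw [hμ]; push_cast; ring
      have e2 : (1 : ℂ) + -μ = 1 - μ := by ring
      rw [e1, ← hμ, hκ, e2, neg_mul μ, neg_neg]
      push_cast
      field_simp
      ring_nf
  exact sub_eq_zero.1 key

theorem Gamma_one_add_mul_Gamma_one_sub {τ : ℝ} (hτ : τ ≠ 0) :
    Complex.Gamma (1 + Complex.I * τ) * Complex.Gamma (1 - Complex.I * τ) / (2 * Complex.I * τ) =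
      Real.pi / (2 * Complex.I * Real.sinh (Real.pi * τ)) := by
  have hτc : (τ : ℂ) ≠ 0 := by exact_mod_cast hτ
  have hμ0 : Complex.I * (τ : ℂ) ≠ 0 := mul_ne_zero Complex.I_ne_zero hτc
  rw [add_comm 1, Complex.Gamma_add_one _ hμ0, mul_assoc, Complex.Gamma_mul_Gamma_one_sub]
  have e1 : (Real.pi : ℂ) * (Complex.I * τ) = ((Real.pi * τ : ℝ) : ℂ) * Complex.I := by
    push_cast; ring
  have hs : (Real.sinh (Real.pi * τ) : ℂ) ≠ 0 := by
    exact_mod_cast (Real.sinh_eq_zero.not.2 (mul_ne_zero Real.pi_ne_zero hτ))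
  rw [e1, Complex.sin_mul_I, ← Complex.ofReal_sinh]
  have hI := Complex.I_ne_zero
  field_simp

/-- The connection formula in the right half plane. -/
theorem besselK_eq_expSeries {τ : ℝ} (hτ : τ ≠ 0) {t : ℂ} (ht : |t.im| < Real.pi / 2) :
    besselK (Complex.I * τ) (2 * Complex.exp t) =
      Real.pi / (2 * Complex.I * Real.sinh (Real.pi * τ)) *
        (expSeries (-(Complex.I * τ)) (besselCoeff (-(Complex.I * τ))) t
          - expSeries (Complex.I * τ) (besselCoeff (Complex.I * τ)) t) := by
  set U : Set ℂ := {t : ℂ | |t.im| < Real.pi / 2} with hU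
  have hUeq : U = Complex.im ⁻¹' Ioo (-(Real.pi / 2)) (Real.pi / 2) := by
    ext t; simp [hU, abs_lt]
  have hUo : IsOpen U := by
    rw [hUeq]; exact isOpen_Ioo.preimage Complex.continuous_im
  have hUc : IsPreconnected U := by
    rw [hUeq]
    exact ((convex_Ioo _ _).linear_preimage Complex.imLm).isPreconnected
  have hμr : (Complex.I * (τ : ℂ)).re = 0 := by simp
  have hμr' : (-(Complex.I * (τ : ℂ))).re = 0 := by simp
  have hre : ∀ t ∈ U, 0 < (2 * Complex.exp t).re := by
    intro t ht
    rw [hUeq] at ht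
    have h1 := Real.cos_pos_of_mem_Ioo ht
    have h2 : (2 * Complex.exp t).re = 2 * (Real.exp t.re * Real.cos t.im) := by
      rw [← Complex.exp_re]; simp
    rw [h2]
    have := Real.exp_pos t.re
    positivity
  have hf : AnalyticOnNhd ℂ (fun t => besselK (Complex.I * τ) (2 * Complex.exp t)) U := by
    refine DifferentiableOn.analyticOnNhd (fun t ht => ?_) hUo
    refine DifferentiableAt.differentiableWithinAt ?_
    exact DifferentiableAt.comp (g := besselK (Complex.I * τ)) t
      (hasDerivAt_besselK (hre t ht) τ).differentiableAt (by fun_prop)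
  have hg : AnalyticOnNhd ℂ (fun t => Real.pi / (2 * Complex.I * Real.sinh (Real.pi * τ)) *
        (expSeries (-(Complex.I * τ)) (besselCoeff (-(Complex.I * τ))) t
          - expSeries (Complex.I * τ) (besselCoeff (Complex.I * τ)) t)) U := by
    refine DifferentiableOn.analyticOnNhd (fun t ht => ?_) hUo
    refine DifferentiableAt.differentiableWithinAt ?_
    exact ((hasDerivAt_expSeries (summable_besselCoeff hμr') _ t).sub
      (hasDerivAt_expSeries (summable_besselCoeff hμr) _ t)).differentiableAt.const_mul _
  -- Identity theorem: `2e^t` maps the strip `|Im t| < π/2` into the right half plane, and the two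
  -- sides agree on the real axis, which accumulates at `0`.
  refine hf.eqOn_of_preconnected_of_frequently_eq hg hUc (z₀ := 0)
    (by simp [hU, Real.pi_pos]) ?_ ht
  have hlim : Filter.Tendsto (fun s : ℝ => (s : ℂ)) (nhdsWithin 0 {0}ᶜ) (nhdsWithin 0 {0}ᶜ) := by
    refine tendsto_nhdsWithin_iff.2 ⟨?_, ?_⟩
    · exact (Complex.continuous_ofReal.tendsto' 0 0 (by simp)).mono_left nhdsWithin_le_nhds
    · filter_upwards [self_mem_nhdsWithin] with s hs
      simpa using hs
  refine hlim.frequently (Filter.Eventually.frequently (.of_forall fun s => ?_))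
  have := besselK_two_mul_exp_eq_expSeries hτ s
  rw [Gamma_one_add_mul_Gamma_one_sub hτ] at this
  rw [← this]
  push_cast
  rfl

/-! ### The boundary value of `K_{iτ}` on the imaginary axis. -/

/-- At this point `2e^t = iy`, and the factors `e^{iπk} = (-1)^k` turn the series of `I_μ` into that
of `J_μ`. -/
theorem expSeries_besselCoeff_eq_besselJ {y : ℝ} (hy : 0 < y) (μ : ℂ) :
    expSeries μ (besselCoeff μ) (Real.log (y / 2) + Real.pi / 2 * Complex.I) =
      Complex.exp (Real.pi / 2 * Complex.I * μ) * besselJ μ y := by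
  have hy2 : (0 : ℝ) < y / 2 := by positivity
  have hz : (y : ℂ) / 2 = ((y / 2 : ℝ) : ℂ) := by push_cast; ring
  have hz0 : ((y / 2 : ℝ) : ℂ) ≠ 0 := by exact_mod_cast hy2.ne'
  have hexp : Complex.exp (Real.log (y / 2) : ℝ) = ((y / 2 : ℝ) : ℂ) := by
    rw [← Complex.ofReal_exp, Real.exp_log hy2]
  rw [besselJ, hz, Complex.cpow_def_of_ne_zero hz0, ← Complex.ofReal_log hy2.le, ← mul_assoc,
    ← Complex.exp_add, expSeries, ← tsum_mul_left]
  refine tsum_congr fun k => ?_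
  have e1 : (μ + 2 * k) * ((Real.log (y / 2) : ℂ) + Real.pi / 2 * Complex.I) =
      (Real.pi / 2 * Complex.I * μ + Real.log (y / 2) * μ) +
        ((k : ℂ) * (Real.pi * Complex.I) + ((2 * k : ℕ) : ℂ) * (Real.log (y / 2) : ℝ)) := by
    push_cast; ring
  rw [e1, Complex.exp_add, Complex.exp_add ((k : ℂ) * _), Complex.exp_nat_mul, Complex.exp_nat_mul,
    Complex.exp_pi_mul_I, hexp, besselCoeff]
  ring

theorem besselJ_conj {y : ℝ} (hy : 0 < y) (μ : ℂ) :
    besselJ ((starRingEnd ℂ) μ) y = (starRingEnd ℂ) (besselJ μ y) := by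
  have hy2 : (0 : ℝ) < y / 2 := by positivity
  have hz : (y : ℂ) / 2 = ((y / 2 : ℝ) : ℂ) := by push_cast; ring
  have hz0 : ((y / 2 : ℝ) : ℂ) ≠ 0 := by exact_mod_cast hy2.ne'
  rw [besselJ, besselJ, map_mul, hz, Complex.conj_tsum]
  congr 1
  · rw [Complex.cpow_def_of_ne_zero hz0, Complex.cpow_def_of_ne_zero hz0, ← Complex.exp_conj,
      map_mul, ← Complex.ofReal_log hy2.le, Complex.conj_ofReal]
  · refine tsum_congr fun k => ?_
    simp only [map_mul, map_div₀, map_pow, map_neg, map_one, Complex.conj_ofReal, map_natCast]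
    rw [← Complex.Gamma_conj]
    simp

/-- The imaginary part of `J_{iτ}(y)` as a boundary value of `K_{iτ}`. -/
theorem tendsto_re_besselK {τ : ℝ} (hτ : τ ≠ 0) {y : ℝ} (hy : 0 < y) :
    Filter.Tendsto (fun θ : ℝ => (besselK (Complex.I * τ) (y * Complex.exp (θ * Complex.I))).re)
      (nhdsWithin (Real.pi / 2) (Iio (Real.pi / 2)))
      (nhds (-(Real.pi / 2) * ((besselJ (Complex.I * τ) y).im / Real.sinh (Real.pi * τ / 2)))) := by
  have hμr : (Complex.I * (τ : ℂ)).re = 0 := by simp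
  have hμr' : (-(Complex.I * (τ : ℂ))).re = 0 := by simp
  have hy2 : (0 : ℝ) < y / 2 := by positivity
  -- The series side of the connection formula is continuous in all of `t`. Its value at `Im t =
  -- π/2`, where the integral defining `K_{iτ}` no longer converges absolutely, is therefore the
  -- required limit.
  set S : ℂ → ℂ := fun t => Real.pi / (2 * Complex.I * Real.sinh (Real.pi * τ)) *
        (expSeries (-(Complex.I * τ)) (besselCoeff (-(Complex.I * τ))) t
          - expSeries (Complex.I * τ) (besselCoeff (Complex.I * τ)) t) with hS
  have hSc : Continuous S := continuous_iff_continuousAt.2 fun t =>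
    (((hasDerivAt_expSeries (summable_besselCoeff hμr') _ t).sub
      (hasDerivAt_expSeries (summable_besselCoeff hμr) _ t)).differentiableAt.const_mul
        _).continuousAt
  have hlim : Filter.Tendsto (fun θ : ℝ => (S (Real.log (y / 2) + θ * Complex.I)).re)
      (nhdsWithin (Real.pi / 2) (Iio (Real.pi / 2)))
      (nhds (S (Real.log (y / 2) + (Real.pi / 2 : ℝ) * Complex.I)).re) := by
    refine Filter.Tendsto.mono_left ?_ nhdsWithin_le_nhds
    refine Continuous.tendsto (f := fun θ : ℝ => (S (Real.log (y / 2) + θ * Complex.I)).re) ?_ _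
    fun_prop
  have hval : (S (Real.log (y / 2) + (Real.pi / 2 : ℝ) * Complex.I)).re =
      -(Real.pi / 2) * ((besselJ (Complex.I * τ) y).im / Real.sinh (Real.pi * τ / 2)) := by
    rw [hS]
    simp only [Complex.ofReal_div, Complex.ofReal_ofNat]
    rw [expSeries_besselCoeff_eq_besselJ hy, expSeries_besselCoeff_eq_besselJ hy]
    have ec : -(Complex.I * (τ : ℂ)) = (starRingEnd ℂ) (Complex.I * τ) := by simp
    have e1 : (Real.pi : ℂ) / 2 * Complex.I * -(Complex.I * τ) = ((Real.pi * τ / 2 : ℝ) : ℂ) := by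
      push_cast
      linear_combination (-(Real.pi : ℂ) / 2 * τ) * Complex.I_sq
    have e2 : (Real.pi : ℂ) / 2 * Complex.I * (Complex.I * τ) = ((-(Real.pi * τ / 2) : ℝ) : ℂ) := by
      push_cast
      linear_combination ((Real.pi : ℂ) / 2 * τ) * Complex.I_sq
    have hs : Real.sinh (Real.pi * τ / 2) ≠ 0 :=
      Real.sinh_eq_zero.not.2 (by positivity)
    have hc : Real.cosh (Real.pi * τ / 2) ≠ 0 := (Real.cosh_pos _).ne'
    have e3 : Real.sinh (Real.pi * τ) = 2 * Real.sinh (Real.pi * τ / 2) * Real.cosh (Real.pi * τ / 2) := by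
      rw [← Real.sinh_two_mul]; ring_nf
    have e4 : (Real.pi : ℂ) / (2 * Complex.I * Real.sinh (Real.pi * τ)) =
        ((Real.pi / (2 * Real.sinh (Real.pi * τ)) : ℝ) : ℂ) * -Complex.I := by
      push_cast
      rw [mul_assoc, mul_left_comm, div_mul_eq_div_div, div_mul_eq_mul_div,
        div_eq_mul_inv (Real.pi : ℂ) Complex.I, Complex.inv_I]
    rw [e1, e2, ec, besselJ_conj hy, e4, ← Complex.ofReal_exp, ← Complex.ofReal_exp]
    set J := besselJ (Complex.I * τ) y
    have e5 : Real.exp (Real.pi * τ / 2) + Real.exp (-(Real.pi * τ / 2))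
        = 2 * Real.cosh (Real.pi * τ / 2) := by rw [Real.cosh_eq]; ring
    -- With `J_{-iτ}(y) = conj J_{iτ}(y)` the two exponentials `e^{±πτ/2}` add up to `2 cosh(πτ/2)`
    -- in front of `Im J`; this cancels against `sinh(πτ) = 2 sinh(πτ/2) cosh(πτ/2)`.
    have e6 : ∀ A E₁ E₂ : ℝ, ((A : ℂ) * -Complex.I * ((E₁ : ℂ) * (starRingEnd ℂ) J - (E₂ : ℂ) * J)).re
        = -A * (E₁ + E₂) * J.im := by
      intro A E₁ E₂
      simp
      ring
    rw [e6, e5, e3]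
    field_simp
  rw [hval] at hlim
  refine hlim.congr' ?_
  have hmem : Ioo (-(Real.pi / 2)) (Real.pi / 2) ∈ nhdsWithin (Real.pi / 2) (Iio (Real.pi / 2)) :=
    Ioo_mem_nhdsLT (by linarith [Real.pi_pos])
  filter_upwards [hmem] with θ hθ
  rw [hS]
  simp only
  rw [← besselK_eq_expSeries hτ (by simpa [abs_lt] using hθ), Complex.exp_add, ← Complex.ofReal_exp,
    Real.exp_log hy2]
  congr 2
  push_cast
  ring_nf

/-! ### The product formula for `K_{iτ}(y) K_{iτ}(y e^{iθ})`. -/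

theorem integral_eq_integral_Ioi_add_comp_neg {f : ℝ → ℂ} (hf : Integrable f) :
    ∫ v, f v = ∫ v in Ioi (0 : ℝ), (f v + f (-v)) := by
  rw [integral_add hf.integrableOn hf.comp_neg.integrableOn, integral_comp_neg_Ioi, neg_zero,
    ← integral_add_compl measurableSet_Ioi hf, compl_Ioi]

theorem besselK_eq_integral_univ {ζ : ℂ} (hζ : 0 < ζ.re) (τ : ℝ) :
    besselK (Complex.I * τ) ζ = 1 / 2 *
      ∫ v : ℝ, Complex.exp (-ζ * (Real.cosh v : ℂ)) * Complex.exp (Complex.I * τ * v) := by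
  rw [integral_eq_integral_Ioi_add_comp_neg, besselK_eq_integral_cos, ← integral_const_mul]
  · refine integral_congr_ae (.of_forall fun v => ?_)
    simp only [Real.cosh_neg]
    rw [Complex.ofReal_cos, Complex.cos]
    push_cast
    have e2 : Complex.I * τ * -v = -((τ : ℂ) * v) * Complex.I := by ring
    have e3 : Complex.I * τ * v = ((τ : ℂ) * v) * Complex.I := by ring
    rw [e2, e3]
    ring
  · refine integrable_cexp_neg_mul_cosh_mul (C := 1) hζ 0
      (Continuous.aestronglyMeasurable (by fun_prop)) fun v => ?_
    rw [Complex.norm_exp]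
    simp

theorem besselK_zero_eq (w : ℂ) :
    besselK 0 w = ∫ v in Ioi (0 : ℝ), Complex.exp (-w * (Real.cosh v : ℂ)) := by
  rw [besselK]
  simp

theorem integral_cexp_neg_mul_cosh {w : ℂ} (hw : 0 < w.re) :
    ∫ v : ℝ, Complex.exp (-w * (Real.cosh v : ℂ)) = 2 * besselK 0 w := by
  have := besselK_eq_integral_univ hw 0
  simp only [Complex.ofReal_zero, mul_zero, zero_mul, Complex.exp_zero, mul_one] at this
  rw [this]
  ring

/-- Rotating the contour in the integral of `exp (-w cosh s)`. -/
theorem integral_cexp_neg_mul_cosh_shift {w : ℂ} (hw : |w.im| < w.re) {φ : ℝ}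
    (hφ : φ ∈ Ioo (-(Real.pi / 4)) (Real.pi / 4)) :
    ∫ s : ℝ, Complex.exp (-w * (Real.cosh s * Real.cos φ - Complex.I * (Real.sinh s * Real.sin φ)))
      = 2 * besselK 0 w := by
  have hpi := Real.pi_pos
  -- The exponent is `-w cosh(s - iφ)`. Instead of a contour argument the integral is differentiated
  -- in `φ`: since `∂_φ F = -i ∂_s F`, the derivative integrates to `0`.
  set F : ℝ → ℝ → ℂ := fun φ s =>
    Complex.exp (-w * (Real.cosh s * Real.cos φ - Complex.I * (Real.sinh s * Real.sin φ))) with hF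
  set F' : ℝ → ℝ → ℂ := fun φ s => F φ s * (-w * (Real.cosh s * (-Real.sin φ : ℝ)
    - Complex.I * (Real.sinh s * Real.cos φ))) with hF'
  set D : ℝ → ℝ → ℂ := fun φ s => F φ s * (-w * (Real.sinh s * Real.cos φ
    - Complex.I * (Real.cosh s * Real.sin φ))) with hD
  -- For `|φ| < π/4` one has `cos φ ≥ √2/2` and `|sin φ| ≤ cos φ`, hence `Re (w cosh(s - iφ)) ≥ c
  -- cosh s` uniformly in `φ`.
  set c : ℝ := (w.re - |w.im|) * (√2 / 2) with hc
  have hc0 : 0 < c := by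
    have : 0 < w.re - |w.im| := sub_pos.2 hw
    positivity
  have htrig : ∀ φ ∈ Ioo (-(Real.pi / 4)) (Real.pi / 4),
      √2 / 2 ≤ Real.cos φ ∧ |Real.sin φ| ≤ Real.cos φ := by
    intro φ hφ
    have habs : |φ| ≤ Real.pi / 4 := (abs_lt.2 hφ).le
    have h1 : √2 / 2 ≤ Real.cos φ := by
      rw [← Real.cos_pi_div_four, ← Real.cos_abs φ]
      exact Real.cos_le_cos_of_nonneg_of_le_pi (abs_nonneg _) (by linarith) habs
    refine ⟨h1, ?_⟩
    have h2 : 0 ≤ Real.cos φ := le_trans (by positivity) h1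
    refine abs_le_of_sq_le_sq ?_ h2
    have h3 : (√2 / 2) ^ 2 ≤ Real.cos φ ^ 2 := pow_le_pow_left₀ (by positivity) h1 2
    rw [div_pow, Real.sq_sqrt zero_le_two] at h3
    nlinarith [Real.sin_sq_add_cos_sq φ]
  have hFn : ∀ φ ∈ Ioo (-(Real.pi / 4)) (Real.pi / 4), ∀ s,
      ‖F φ s‖ ≤ Real.exp (-c * Real.cosh s) := by
    intro φ hφ s
    obtain ⟨h1, h2⟩ := htrig φ hφ
    rw [hF, Complex.norm_exp]
    refine Real.exp_le_exp.2 ?_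
    have e : (-w * (Real.cosh s * Real.cos φ - Complex.I * (Real.sinh s * Real.sin φ))).re
        = -(w.re * Real.cos φ * Real.cosh s) - w.im * (Real.sin φ * Real.sinh s) := by
      rw [← Complex.ofReal_mul, ← Complex.ofReal_mul]
      simp only [Complex.mul_re, Complex.neg_re, Complex.sub_re, Complex.ofReal_re, Complex.neg_im,
        Complex.sub_im, Complex.ofReal_im, Complex.mul_im, Complex.I_re, Complex.I_im]
      ring
    rw [e]
    have hcs := Real.cosh_pos s
    have hcp : 0 ≤ Real.cos φ := (abs_nonneg _).trans h2
    have h3 : -(w.im * (Real.sin φ * Real.sinh s)) ≤ |w.im| * (Real.cos φ * Real.cosh s) := by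
      refine (neg_le_abs _).trans ?_
      rw [abs_mul, abs_mul]
      exact mul_le_mul_of_nonneg_left
        (mul_le_mul h2 (abs_sinh_le_cosh s) (abs_nonneg _) hcp) (abs_nonneg _)
    have h4 : c * Real.cosh s ≤ (w.re - |w.im|) * Real.cos φ * Real.cosh s := by
      rw [hc]
      have : 0 < w.re - |w.im| := sub_pos.2 hw
      gcongr
    linarith
  have hFc : ∀ φ, Continuous (F φ) := fun φ => by rw [hF]; fun_prop
  have hlin : ∀ a b s : ℝ, |a| ≤ 1 → |b| ≤ 1 →
      ‖-w * ((Real.cosh s : ℂ) * (a : ℂ) - Complex.I * (Real.sinh s * b))‖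
        ≤ 2 * ‖w‖ * Real.cosh s ∧
      ‖-w * ((Real.sinh s : ℂ) * (a : ℂ) - Complex.I * (Real.cosh s * b))‖
        ≤ 2 * ‖w‖ * Real.cosh s := by
    intro a b s ha hb
    have hcs := Real.cosh_pos s
    have k1 : ‖(Real.cosh s : ℂ) * (a : ℂ)‖ ≤ Real.cosh s := by
      rw [norm_mul, norm_ofReal_cosh, Complex.norm_real]
      exact mul_le_of_le_one_right hcs.le ha
    have k2 : ‖Complex.I * ((Real.sinh s : ℂ) * b)‖ ≤ Real.cosh s := by
      rw [norm_mul, norm_mul, Complex.norm_I, one_mul, Complex.norm_real b]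
      exact (mul_le_of_le_one_right (norm_nonneg _) hb).trans (norm_ofReal_sinh_le s)
    have k3 : ‖(Real.sinh s : ℂ) * (a : ℂ)‖ ≤ Real.cosh s := by
      rw [norm_mul, Complex.norm_real a]
      exact (mul_le_of_le_one_right (norm_nonneg _) ha).trans (norm_ofReal_sinh_le s)
    have k4 : ‖Complex.I * ((Real.cosh s : ℂ) * b)‖ ≤ Real.cosh s := by
      rw [norm_mul, norm_mul, Complex.norm_I, one_mul, norm_ofReal_cosh, Complex.norm_real b]
      exact mul_le_of_le_one_right hcs.le hb
    constructor
    · rw [norm_mul, norm_neg, mul_comm 2, mul_assoc]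
      refine mul_le_mul_of_nonneg_left ((norm_sub_le _ _).trans ?_) (norm_nonneg _)
      linarith
    · rw [norm_mul, norm_neg, mul_comm 2, mul_assoc]
      refine mul_le_mul_of_nonneg_left ((norm_sub_le _ _).trans ?_) (norm_nonneg _)
      linarith
  have hFi : ∀ φ ∈ Ioo (-(Real.pi / 4)) (Real.pi / 4), Integrable (F φ) := by
    intro φ hφ
    have h := integrable_exp_neg_mul_cosh_mul_cosh_pow hc0 0
    simp only [pow_zero, mul_one] at h
    exact h.mono' (hFc φ).aestronglyMeasurable (.of_forall fun s => hFn φ hφ s)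
  have hbd : Integrable fun s : ℝ => 2 * ‖w‖ * (Real.exp (-c * Real.cosh s) * Real.cosh s ^ 1) :=
    (integrable_exp_neg_mul_cosh_mul_cosh_pow hc0 1).const_mul _
  have hF'n : ∀ φ ∈ Ioo (-(Real.pi / 4)) (Real.pi / 4), ∀ s,
      ‖F' φ s‖ ≤ 2 * ‖w‖ * (Real.exp (-c * Real.cosh s) * Real.cosh s ^ 1) := by
    intro φ hφ s
    rw [hF', norm_mul, pow_one]
    refine le_of_le_of_eq (b := Real.exp (-c * Real.cosh s) * (2 * ‖w‖ * Real.cosh s)) ?_ (by ring)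
    exact mul_le_mul (hFn φ hφ s) (hlin _ _ s (by simpa using Real.abs_sin_le_one φ)
      (Real.abs_cos_le_one φ)).1 (norm_nonneg _) (Real.exp_pos _).le
  have hDi : ∀ φ ∈ Ioo (-(Real.pi / 4)) (Real.pi / 4), Integrable (D φ) := by
    intro φ hφ
    refine hbd.mono' (Continuous.aestronglyMeasurable ?_) (.of_forall fun s => ?_)
    · have := hFc φ
      rw [hD]; fun_prop
    · rw [hD, norm_mul, pow_one]
      refine le_of_le_of_eq (b := Real.exp (-c * Real.cosh s) * (2 * ‖w‖ * Real.cosh s)) ?_ (by ring)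
      exact mul_le_mul (hFn φ hφ s) (hlin _ _ s (Real.abs_cos_le_one φ)
        (Real.abs_sin_le_one φ)).2 (norm_nonneg _) (Real.exp_pos _).le
  have hDd : ∀ φ s, HasDerivAt (F φ) (D φ s) s := by
    intro φ s
    have h1 := (Real.hasDerivAt_cosh s).ofReal_comp
    have h2 := (Real.hasDerivAt_sinh s).ofReal_comp
    exact (((h1.mul_const (Real.cos φ : ℂ)).sub
      ((h2.mul_const (Real.sin φ : ℂ)).const_mul Complex.I)).const_mul (-w)).cexp
  have hF'd : ∀ φ s, HasDerivAt (fun φ => F φ s) (F' φ s) φ := by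
    intro φ s
    have h1 := (Real.hasDerivAt_cos φ).ofReal_comp
    have h2 := (Real.hasDerivAt_sin φ).ofReal_comp
    exact (((h1.const_mul (Real.cosh s : ℂ)).sub
      ((h2.const_mul (Real.sinh s : ℂ)).const_mul Complex.I)).const_mul (-w)).cexp
  have hF'D : ∀ φ s, F' φ s = -Complex.I * D φ s := by
    intro φ s
    rw [hF', hD]
    simp only [Complex.ofReal_neg]
    linear_combination (F φ s * w * Real.cosh s * Real.sin φ) * Complex.I_sq
  have hder : ∀ φ ∈ Ioo (-(Real.pi / 4)) (Real.pi / 4),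
      HasDerivAt (fun φ => ∫ s, F φ s) 0 φ := by
    intro φ hφ
    have h := (hasDerivAt_integral_of_dominated_loc_of_deriv_le (F := F) (F' := F')
      (Ioo_mem_nhds hφ.1 hφ.2)
      (.of_forall fun φ => (hFc φ).aestronglyMeasurable) (hFi φ hφ)
      (by
        have : F' φ = fun s => -Complex.I * D φ s := funext (hF'D φ)
        rw [this]
        exact ((hDi φ hφ).const_mul _).1)
      (.of_forall fun s φ hφ => hF'n φ hφ s) hbd
      (.of_forall fun s φ _ => hF'd φ s)).2
    refine h.congr_deriv ?_
    simp only [hF'D]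
    rw [integral_const_mul, integral_eq_zero_of_hasDerivAt_of_integrable (hDd φ) (hDi φ hφ)
      (hFi φ hφ), mul_zero]
  have h0 : (0 : ℝ) ∈ Ioo (-(Real.pi / 4)) (Real.pi / 4) := by
    constructor <;> linarith
  have := isOpen_Ioo.is_const_of_deriv_eq_zero isPreconnected_Ioo
    (fun φ hφ => (hder φ hφ).differentiableAt.differentiableWithinAt)
    (fun φ hφ => (hder φ hφ).deriv) hφ h0
  rw [this, ← integral_cexp_neg_mul_cosh ((abs_nonneg _).trans_lt hw), hF]
  simp

theorem exists_polar_of_abs_lt {A B : ℝ} (h : |B| < A) :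
    ∃ φ ∈ Ioo (-(Real.pi / 4)) (Real.pi / 4),
      √(A ^ 2 + B ^ 2) * Real.cos φ = A ∧ √(A ^ 2 + B ^ 2) * Real.sin φ = B := by
  have hA : 0 < A := (abs_nonneg _).trans_lt h
  rw [abs_lt] at h
  have hs : √(1 + (B / A) ^ 2) = √(A ^ 2 + B ^ 2) / A := by
    rw [show 1 + (B / A) ^ 2 = (A ^ 2 + B ^ 2) / A ^ 2 by field_simp,
      Real.sqrt_div (by positivity), Real.sqrt_sq hA.le]
  have hs0 : √(A ^ 2 + B ^ 2) ≠ 0 := (Real.sqrt_pos.2 (by positivity)).ne'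
  refine ⟨Real.arctan (B / A), ⟨?_, ?_⟩, ?_, ?_⟩
  · rw [← Real.arctan_one, ← Real.arctan_neg]
    refine Real.arctan_strictMono ?_
    rw [lt_div_iff₀ hA]; linarith
  · rw [← Real.arctan_one]
    refine Real.arctan_strictMono ?_
    rw [div_lt_one hA]; exact h.2
  · rw [Real.cos_arctan, hs]; field_simp
  · rw [Real.sin_arctan, hs]; field_simp

/-- The argument of `K₀` in the product formula for `K_{iτ}(y) K_{iτ}(y e^{iθ})`. -/
noncomputable def productArg (y θ u : ℝ) : ℂ :=
  Complex.exp ((θ / 2 : ℝ) * Complex.I) * ((y * √(2 * (Real.cos θ + Real.cosh u)) : ℝ) : ℂ)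

theorem productArg_re (y θ u : ℝ) :
    (productArg y θ u).re = Real.cos (θ / 2) * (y * √(2 * (Real.cos θ + Real.cosh u))) := by
  rw [productArg, Complex.re_mul_ofReal, Complex.exp_ofReal_mul_I_re]

theorem productArg_im (y θ u : ℝ) :
    (productArg y θ u).im = Real.sin (θ / 2) * (y * √(2 * (Real.cos θ + Real.cosh u))) := by
  rw [productArg, Complex.im_mul_ofReal, Complex.exp_ofReal_mul_I_im]

theorem cos_pi_div_four_le {θ : ℝ} (h0 : 0 ≤ θ) (h1 : θ ≤ Real.pi / 2) :
    √2 / 2 ≤ Real.cos (θ / 2) := by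
  rw [← Real.cos_pi_div_four]
  exact Real.cos_le_cos_of_nonneg_of_le_pi (by linarith) (by linarith [Real.pi_pos]) (by linarith)

/-- `cos(θ/2) ≥ √2/2` and `cos θ ≥ 0` on this range. The bound does not depend on `θ` and includes
`θ = π/2`, so it serves both the passage to the limit and the final norm estimate. -/
theorem le_productArg_re {y θ : ℝ} (hy : 0 < y) (h0 : 0 ≤ θ) (h1 : θ ≤ Real.pi / 2) (u : ℝ) :
    y * √(Real.cosh u) ≤ (productArg y θ u).re := by
  rw [productArg_re]
  have hc : 0 ≤ Real.cos θ := Real.cos_nonneg_of_neg_pi_div_two_le_of_le (by linarith [Real.pi_pos]) h1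
  have h2 : √2 * √(Real.cosh u) ≤ √(2 * (Real.cos θ + Real.cosh u)) := by
    rw [← Real.sqrt_mul zero_le_two]
    exact Real.sqrt_le_sqrt (by linarith)
  have h3 := cos_pi_div_four_le h0 h1
  have h4 : 0 ≤ Real.cos (θ / 2) := le_trans (by positivity) h3
  calc y * √(Real.cosh u) = (√2 / 2) * (y * (√2 * √(Real.cosh u))) := by
        have : √2 * √2 = 2 := Real.mul_self_sqrt zero_le_two
        linear_combination (-(y * √(Real.cosh u)) / 2) * this
    _ ≤ _ := by gcongr

/-- After `s ↦ s + u/2`, the sum `cosh s + e^{iθ} cosh(u - s)` becomes `2e^{iθ/2}(A cosh s - iB sinh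
s)` with `A`, `B` as below. Writing `A = ρ cos φ`, `B = ρ sin φ` gives `2ρ e^{iθ/2} cosh(s - iφ)`,
and the contour is shifted back. The condition `θ < π/2` gives `sin(θ/2) < cos(θ/2)`, which the
shift needs. -/
theorem integral_cexp_mul_cexp_sub {y θ : ℝ} (hy : 0 < y) (h0 : 0 ≤ θ) (h1 : θ < Real.pi / 2)
    (u : ℝ) :
    ∫ s : ℝ, Complex.exp (-(y : ℂ) * (Real.cosh s : ℂ)) *
      Complex.exp (-(y * Complex.exp (θ * Complex.I)) * (Real.cosh (u - s) : ℂ)) =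
    2 * besselK 0 (productArg y θ u) := by
  have hpi := Real.pi_pos
  have hcos : √2 / 2 ≤ Real.cos (θ / 2) := cos_pi_div_four_le h0 h1.le
  have hcos0 : 0 < Real.cos (θ / 2) := lt_of_lt_of_le (by positivity) hcos
  have hsin0 : 0 ≤ Real.sin (θ / 2) := Real.sin_nonneg_of_nonneg_of_le_pi (by linarith) (by linarith)
  have hsc : Real.sin (θ / 2) < Real.cos (θ / 2) := by
    have : Real.cos (Real.pi / 2 - θ / 2) < Real.cos (θ / 2) :=
      Real.cos_lt_cos_of_nonneg_of_le_pi (by linarith) (by linarith) (by linarith)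
    rwa [Real.cos_pi_div_two_sub] at this
  have hre : |(productArg y θ u).im| < (productArg y θ u).re := by
    have hc : 0 ≤ Real.cos θ := Real.cos_nonneg_of_neg_pi_div_two_le_of_le (by linarith) h1.le
    have hcu := Real.cosh_pos u
    rw [productArg_im, productArg_re, abs_of_nonneg (by positivity)]
    have : 0 < y * √(2 * (Real.cos θ + Real.cosh u)) := by positivity
    exact mul_lt_mul_of_pos_right hsc this
  set A := Real.cos (θ / 2) * Real.cosh (u / 2) with hA
  set B := Real.sin (θ / 2) * Real.sinh (u / 2) with hB
  have hBA : |B| < A := by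
    rw [hA, hB, abs_mul, abs_of_nonneg hsin0]
    calc _ ≤ Real.sin (θ / 2) * Real.cosh (u / 2) :=
          mul_le_mul_of_nonneg_left (abs_sinh_le_cosh _) hsin0
      _ < _ := mul_lt_mul_of_pos_right hsc (Real.cosh_pos _)
  obtain ⟨φ, hφ, hφA, hφB⟩ := exists_polar_of_abs_lt hBA
  have hρ : √(2 * (Real.cos θ + Real.cosh u)) = 2 * √(A ^ 2 + B ^ 2) := by
    have e1 : Real.cos θ = 2 * Real.cos (θ / 2) ^ 2 - 1 := by
      rw [← Real.cos_two_mul]; ring_nf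
    have e2 : Real.cosh u = 2 * Real.cosh (u / 2) ^ 2 - 1 := by
      have := Real.cosh_two_mul (u / 2)
      rw [Real.sinh_sq] at this
      rw [show u = 2 * (u / 2) by ring, this]
      ring_nf
    have e3 : 2 * (Real.cos θ + Real.cosh u) = 2 ^ 2 * (A ^ 2 + B ^ 2) := by
      rw [hA, hB, mul_pow, mul_pow, Real.sinh_sq, Real.sin_sq, e1, e2]
      ring
    rw [e3, Real.sqrt_mul (by positivity), Real.sqrt_sq zero_le_two]
  rw [← integral_cexp_neg_mul_cosh_shift hre hφ, ← integral_add_right_eq_self _ (u / 2)]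
  refine integral_congr_ae (.of_forall fun s => ?_)
  simp only
  rw [← Complex.exp_add]
  congr 1
  have e4 : u - (s + u / 2) = u / 2 - s := by ring
  rw [e4, productArg, hρ, Real.cosh_add, Real.cosh_sub]
  have e5 : (θ : ℂ) * Complex.I = ((θ / 2 : ℝ) : ℂ) * Complex.I + ((θ / 2 : ℝ) : ℂ) * Complex.I := by
    push_cast; ring
  have e6 : Complex.exp (((θ / 2 : ℝ) : ℂ) * Complex.I) =
      Real.cos (θ / 2) + Real.sin (θ / 2) * Complex.I := by
    rw [Complex.exp_mul_I, ← Complex.ofReal_cos, ← Complex.ofReal_sin]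
  have e7 : (Real.sin (θ / 2) : ℂ) ^ 2 + (Real.cos (θ / 2) : ℂ) ^ 2 = 1 := by
    exact_mod_cast Real.sin_sq_add_cos_sq (θ / 2)
  have hφA' : (√(A ^ 2 + B ^ 2) : ℂ) * Real.cos φ = Real.cos (θ / 2) * Real.cosh (u / 2) := by
    exact_mod_cast hφA
  have hφB' : (√(A ^ 2 + B ^ 2) : ℂ) * Real.sin φ = Real.sin (θ / 2) * Real.sinh (u / 2) := by
    exact_mod_cast hφB
  rw [e5, Complex.exp_add, e6]
  simp only [Complex.ofReal_add, Complex.ofReal_mul, Complex.ofReal_sub, Complex.ofReal_ofNat]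
  set E : ℂ := Real.cos (θ / 2) + Real.sin (θ / 2) * Complex.I with hE
  have hEE : E * (Real.cos (θ / 2) - Real.sin (θ / 2) * Complex.I) = 1 := by
    rw [hE, ← e7]
    linear_combination (-(Real.sin (θ / 2) : ℂ) ^ 2) * Complex.I_sq
  rw [hE] at hEE ⊢
  linear_combination (2 * y * (Real.cos (θ / 2) + Real.sin (θ / 2) * Complex.I) * Real.cosh s) * hφA'
    - (2 * y * (Real.cos (θ / 2) + Real.sin (θ / 2) * Complex.I) * Complex.I * Real.sinh s) * hφB'
    + (y * (Real.cosh s * Real.cosh (u / 2) + Real.sinh s * Real.sinh (u / 2))) * hEE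

/-- The product formula `K_{iτ}(y) K_{iτ}(y e^{iθ}) = ½ ∫ e^{iτu} K₀(w_θ(u)) du`. -/
theorem besselK_mul_besselK {y θ : ℝ} (hy : 0 < y) (h0 : 0 ≤ θ) (h1 : θ < Real.pi / 2) (τ : ℝ) :
    besselK (Complex.I * τ) y * besselK (Complex.I * τ) (y * Complex.exp (θ * Complex.I)) =
      1 / 2 * ∫ u : ℝ, Complex.exp (Complex.I * τ * u) * besselK 0 (productArg y θ u) := by
  have hre1 : 0 < ((y : ℂ)).re := by simpa using hy
  have hre2 : 0 < ((y : ℂ) * Complex.exp (θ * Complex.I)).re := by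
    rw [Complex.re_ofReal_mul, Complex.exp_ofReal_mul_I_re]
    exact mul_pos hy (Real.cos_pos_of_mem_Ioo ⟨by linarith [Real.pi_pos], h1⟩)
  have hint : ∀ {ζ : ℂ}, 0 < ζ.re → Integrable fun v : ℝ =>
      Complex.exp (-ζ * (Real.cosh v : ℂ)) * Complex.exp (Complex.I * τ * v) := by
    intro ζ hζ
    refine integrable_cexp_neg_mul_cosh_mul (C := 1) hζ 0
      (Continuous.aestronglyMeasurable (by fun_prop)) fun v => ?_
    rw [Complex.norm_exp]
    simp
  -- Each `K_{iτ}` is half an integral over the whole line, so the product is a quarter of the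
  -- integral of a convolution, from which the character `e^{iτu}` factors out. The inner integral
  -- supplies a factor `2`.
  have hconv := integral_convolution (𝕜 := ℂ) (μ := (volume : Measure ℝ)) (ν := volume)
    (ContinuousLinearMap.mul ℂ ℂ) (hint hre1) (hint hre2)
  rw [ContinuousLinearMap.mul_apply'] at hconv
  rw [besselK_eq_integral_univ hre1, besselK_eq_integral_univ hre2]
  rw [mul_mul_mul_comm, ← hconv, show (1 / 2 : ℂ) * (1 / 2) = 1 / 2 * (1 / 2) from rfl, mul_assoc,
    ← integral_const_mul (1 / 2 : ℂ)]
  congr 1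
  refine integral_congr_ae (.of_forall fun u => ?_)
  simp only [convolution, ContinuousLinearMap.mul_apply']
  have e1 : ∀ s : ℝ, Complex.exp (-(y : ℂ) * (Real.cosh s : ℂ)) * Complex.exp (Complex.I * τ * s) *
      (Complex.exp (-(y * Complex.exp (θ * Complex.I)) * (Real.cosh (u - s) : ℂ)) *
        Complex.exp (Complex.I * τ * ((u - s : ℝ) : ℂ))) =
      Complex.exp (Complex.I * τ * u) * (Complex.exp (-(y : ℂ) * (Real.cosh s : ℂ)) *
      Complex.exp (-(y * Complex.exp (θ * Complex.I)) * (Real.cosh (u - s) : ℂ))) := by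
    intro s
    have e2 : Complex.exp (Complex.I * τ * u) = Complex.exp (Complex.I * τ * s) *
        Complex.exp (Complex.I * τ * ((u - s : ℝ) : ℂ)) := by
      rw [← Complex.exp_add]
      congr 1
      push_cast; ring
    rw [e2]; ring
  simp only [e1]
  rw [integral_const_mul, integral_cexp_mul_cexp_sub hy h0 h1]
  ring

/-! ### The limit `θ ↑ π/2` and the kernel as a Fourier integral. -/

theorem norm_besselK_zero_le {w : ℂ} {x : ℝ} (hx : 0 < x) (hxw : x ≤ w.re) :
    ‖besselK 0 w‖ ≤ ∫ v in Ioi (0 : ℝ), Real.exp (-x * Real.cosh v) := by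
  rw [besselK_zero_eq]
  have h := integrable_exp_neg_mul_cosh_mul_cosh_pow hx 0
  simp only [pow_zero, mul_one] at h
  refine norm_integral_le_of_norm_le h.integrableOn (.of_forall fun v => ?_)
  rw [norm_cexp_neg_mul_cosh]
  refine Real.exp_le_exp.2 (mul_le_mul_of_nonneg_right (by linarith) (Real.cosh_pos v).le)

/-- From `e^{-X} ≤ 1/X`. This crude bound already gives decay `cosh(u)^{-1/2}` for the integrand of
the product formula, enough for dominated convergence. -/
theorem integral_exp_neg_mul_cosh_le {x : ℝ} (hx : 0 < x) :
    ∫ v in Ioi (0 : ℝ), Real.exp (-x * Real.cosh v) ≤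
      x⁻¹ * ∫ v in Ioi (0 : ℝ), Real.cosh v ^ (-1 : ℝ) := by
  have h := integrable_exp_neg_mul_cosh_mul_cosh_pow hx 0
  simp only [pow_zero, mul_one] at h
  rw [← integral_const_mul]
  refine setIntegral_mono h.integrableOn
    ((integrable_cosh_rpow_neg one_pos).integrableOn.const_mul _) fun v => ?_
  have hc := Real.cosh_pos v
  rw [Real.rpow_neg_one, ← mul_inv, neg_mul, Real.exp_neg]
  refine inv_anti₀ (by positivity) ?_
  linarith [Real.add_one_le_exp (x * Real.cosh v)]

theorem continuousAt_besselK_zero {w : ℂ} (hw : 0 < w.re) : ContinuousAt (besselK 0) w := by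
  have := (hasDerivAt_besselK hw 0).continuousAt
  simpa using this

theorem productArg_re_pos {y θ : ℝ} (hy : 0 < y) (h0 : 0 ≤ θ) (h1 : θ ≤ Real.pi / 2) (u : ℝ) :
    0 < (productArg y θ u).re :=
  lt_of_lt_of_le (mul_pos hy (Real.sqrt_pos.2 (Real.cosh_pos u))) (le_productArg_re hy h0 h1 u)

theorem continuous_besselK_zero_productArg {y θ : ℝ} (hy : 0 < y) (h0 : 0 ≤ θ)
    (h1 : θ ≤ Real.pi / 2) : Continuous fun u => besselK 0 (productArg y θ u) := by
  refine continuous_iff_continuousAt.2 fun u => ?_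
  refine ContinuousAt.comp (g := besselK 0) (continuousAt_besselK_zero (productArg_re_pos hy h0 h1 u)) ?_
  refine Continuous.continuousAt ?_
  unfold productArg
  fun_prop

theorem norm_besselK_zero_productArg_le {y θ : ℝ} (hy : 0 < y) (h0 : 0 ≤ θ)
    (h1 : θ ≤ Real.pi / 2) (u : ℝ) : ‖besselK 0 (productArg y θ u)‖ ≤
      ∫ v in Ioi (0 : ℝ), Real.exp (-(y * √(Real.cosh u)) * Real.cosh v) :=
  norm_besselK_zero_le (mul_pos hy (Real.sqrt_pos.2 (Real.cosh_pos u)))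
    (le_productArg_re hy h0 h1 u)

theorem norm_besselK_zero_productArg_le_cosh {y θ : ℝ} (hy : 0 < y) (h0 : 0 ≤ θ)
    (h1 : θ ≤ Real.pi / 2) (u : ℝ) : ‖besselK 0 (productArg y θ u)‖ ≤
      y⁻¹ * (∫ v in Ioi (0 : ℝ), Real.cosh v ^ (-1 : ℝ)) * Real.cosh u ^ (-(1 / 2) : ℝ) := by
  refine (norm_besselK_zero_productArg_le hy h0 h1 u).trans
    ((integral_exp_neg_mul_cosh_le (mul_pos hy (Real.sqrt_pos.2 (Real.cosh_pos u)))).trans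
      (le_of_eq ?_))
  rw [mul_inv, Real.sqrt_eq_rpow, ← Real.rpow_neg (Real.cosh_pos u).le]
  ring

theorem integrable_besselK_zero_productArg {y θ : ℝ} (hy : 0 < y) (h0 : 0 ≤ θ)
    (h1 : θ ≤ Real.pi / 2) : Integrable fun u => besselK 0 (productArg y θ u) :=
  ((integrable_cosh_rpow_neg (half_pos one_pos)).const_mul _).mono'
    (continuous_besselK_zero_productArg hy h0 h1).aestronglyMeasurable
    (.of_forall fun u => norm_besselK_zero_productArg_le_cosh hy h0 h1 u)

theorem tendsto_integral_besselK_zero {y : ℝ} (hy : 0 < y) (τ : ℝ) :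
    Filter.Tendsto (fun θ => ∫ u : ℝ, Complex.exp (Complex.I * τ * u) * besselK 0 (productArg y θ u))
      (nhdsWithin (Real.pi / 2) (Iio (Real.pi / 2)))
      (nhds (∫ u : ℝ, Complex.exp (Complex.I * τ * u) * besselK 0 (productArg y (Real.pi / 2) u))) := by
  have hmem : Ioo 0 (Real.pi / 2) ∈ nhdsWithin (Real.pi / 2) (Iio (Real.pi / 2)) :=
    Ioo_mem_nhdsLT (by linarith [Real.pi_pos])
  have hpi := Real.pi_pos
  refine tendsto_integral_filter_of_dominated_convergence
    (fun u => y⁻¹ * (∫ v in Ioi (0 : ℝ), Real.cosh v ^ (-1 : ℝ)) * Real.cosh u ^ (-(1 / 2) : ℝ))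
    ?_ ?_ ((integrable_cosh_rpow_neg (half_pos one_pos)).const_mul _) (.of_forall fun u => ?_)
  · filter_upwards [hmem] with θ hθ
    have := continuous_besselK_zero_productArg hy hθ.1.le hθ.2.le
    exact Continuous.aestronglyMeasurable (by fun_prop)
  · filter_upwards [hmem] with θ hθ
    refine .of_forall fun u => ?_
    have : ‖Complex.exp (Complex.I * τ * u)‖ = 1 := by
      rw [Complex.norm_exp]; simp
    rw [norm_mul, this, one_mul]
    exact norm_besselK_zero_productArg_le_cosh hy hθ.1.le hθ.2.le u
  · refine Filter.Tendsto.const_mul _ ?_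
    refine Filter.Tendsto.mono_left ?_ nhdsWithin_le_nhds
    refine ContinuousAt.tendsto (x := Real.pi / 2) (f := fun θ => besselK 0 (productArg y θ u)) ?_
    refine ContinuousAt.comp (g := besselK 0)
      (continuousAt_besselK_zero (productArg_re_pos hy (by linarith) le_rfl u)) ?_
    refine Continuous.continuousAt ?_
    unfold productArg
    fun_prop

theorem besselK_ofReal_im (τ y : ℝ) : (besselK (Complex.I * τ) y).im = 0 := by
  rw [besselK_eq_integral_cos]
  have : ∀ v : ℝ, Complex.exp (-(y : ℂ) * (Real.cosh v : ℂ)) * (Real.cos (τ * v) : ℂ)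
      = ((Real.exp (-y * Real.cosh v) * Real.cos (τ * v) : ℝ) : ℂ) := by
    intro v
    push_cast
    rfl
  simp only [this]
  rw [integral_complex_ofReal, Complex.ofReal_im]

/-- The density `Re K₀(e^{iπ/4} · 4 √(x cosh u))`. -/
noncomputable def kernelDensity (x u : ℝ) : ℝ :=
  (besselK 0 (productArg (2 * √(2 * x)) (Real.pi / 2) u)).re

/-- For even `h`, conjugation followed by `u ↦ -u` preserves the character and replaces `h` by its
conjugate, so the real part passes onto `h`. -/
theorem re_integral_cexp_mul {h : ℝ → ℂ} (hh : Integrable h) (heven : ∀ u, h (-u) = h u) (τ : ℝ) :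
    (((∫ u : ℝ, Complex.exp (Complex.I * τ * u) * h u).re : ℝ) : ℂ) =
      ∫ u : ℝ, Complex.exp (Complex.I * τ * u) * ((h u).re : ℂ) := by
  have hbd : ∀ g : ℝ → ℂ, Integrable g → Integrable fun u : ℝ => Complex.exp (Complex.I * τ * u) * g u := by
    intro g hg
    refine hg.bdd_mul (c := 1) (Continuous.aestronglyMeasurable (by fun_prop)) (.of_forall fun u => ?_)
    rw [Complex.norm_exp]; simp
  have hconj : Integrable fun u => (starRingEnd ℂ) (h u) :=
    (LinearIsometryEquiv.integrable_comp_iff Complex.conjLIE).2 hh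
  have e1 : (starRingEnd ℂ) (∫ u : ℝ, Complex.exp (Complex.I * τ * u) * h u) =
      ∫ u : ℝ, Complex.exp (Complex.I * τ * u) * (starRingEnd ℂ) (h u) := by
    rw [← integral_conj, ← integral_neg_eq_self]
    refine integral_congr_ae (.of_forall fun u => ?_)
    simp only [map_mul, ← Complex.exp_conj, heven]
    simp
  rw [Complex.re_eq_add_conj, e1, ← integral_add (hbd h hh) (hbd _ hconj), ← integral_div]
  refine integral_congr_ae (.of_forall fun u => ?_)
  simp only
  rw [Complex.re_eq_add_conj]
  ring

/-- The kernel as a Fourier integral. -/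
theorem indexKernel_eq_integral {τ x : ℝ} (hτ : τ ≠ 0) (hx : 0 < x) :
    indexKernel τ x = -(1 / Real.pi : ℝ) *
      ∫ u : ℝ, Complex.exp (Complex.I * τ * u) * (kernelDensity x u : ℂ) := by
  have hpi := Real.pi_pos
  set y := 2 * √(2 * x) with hy
  have hy0 : 0 < y := by positivity
  have hpi2 : (0 : ℝ) ≤ Real.pi / 2 := by positivity
  set k := besselK (Complex.I * τ) y with hk
  have hkre : k = (k.re : ℂ) := by
    apply Complex.ext
    · simp
    · rw [hk, besselK_ofReal_im, Complex.ofReal_im]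
  have t1 := (tendsto_re_besselK hτ hy0).const_mul k.re
  have t2 : Filter.Tendsto (fun θ : ℝ =>
      (1 / 2 * ∫ u : ℝ, Complex.exp (Complex.I * τ * u) * besselK 0 (productArg y θ u)).re)
      (nhdsWithin (Real.pi / 2) (Iio (Real.pi / 2))) (nhds (1 / 2 * ∫ u : ℝ,
        Complex.exp (Complex.I * τ * u) * besselK 0 (productArg y (Real.pi / 2) u)).re) :=
    (Complex.continuous_re.tendsto _).comp ((tendsto_integral_besselK_zero hy0 τ).const_mul _)
  have hmem : Ioo 0 (Real.pi / 2) ∈ nhdsWithin (Real.pi / 2) (Iio (Real.pi / 2)) :=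
    Ioo_mem_nhdsLT (by linarith)
  -- As `K_{iτ}(y)` is real, the real part of the product formula is `K_{iτ}(y) Re K_{iτ}(y
  -- e^{iθ})`; its limit is computed once by the boundary value and once under the integral.
  have t3 := tendsto_nhds_unique_of_eventuallyEq t1 t2 (by
    filter_upwards [hmem] with θ hθ
    rw [← besselK_mul_besselK hy0 hθ.1.le hθ.2, ← hk]
    nth_rw 2 [hkre]
    rw [Complex.re_ofReal_mul])
  have e1 : ∀ u, productArg y (Real.pi / 2) (-u) = productArg y (Real.pi / 2) u := fun u => by
    simp [productArg]
  have e2 := re_integral_cexp_mul (integrable_besselK_zero_productArg hy0 hpi2 le_rfl)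
    (fun u => by rw [e1]) τ
  have e3 : ∀ z : ℂ, (1 / 2 * z).re = 1 / 2 * z.re := fun z => by simp
  rw [e3] at t3
  rw [indexKernel, ← hy, ← hk]
  simp only [kernelDensity, ← hy]
  rw [← e2, hkre, ← Complex.ofReal_mul, ← Complex.ofReal_div, ← Complex.ofReal_neg,
    ← Complex.ofReal_mul]
  congr 1
  rw [mul_div_assoc]
  have h4 : ∀ a b c : ℝ, a * (-(Real.pi / 2) * b) = 1 / 2 * c → a * b = -(1 / Real.pi) * c := by
    intro a b c h
    field_simp
    linarith
  exact h4 _ _ _ t3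

/-! ### Estimates for the density: Gamma and beta integrals, scaling, the majorant. -/

theorem abs_kernelDensity_le {x : ℝ} (hx : 0 < x) (u : ℝ) :
    |kernelDensity x u| ≤
      ∫ v in Ioi (0 : ℝ), Real.exp (-(2 * √(2 * x) * √(Real.cosh u)) * Real.cosh v) :=
  (Complex.abs_re_le_norm _).trans (norm_besselK_zero_productArg_le (by positivity)
    (by positivity) le_rfl u)

theorem measurable_kernelDensity : Measurable fun z : ℝ × ℝ => kernelDensity z.1 z.2 := by
  have h1 : StronglyMeasurable fun z : (ℝ × ℝ) × ℝ =>
      Complex.exp (-productArg (2 * √(2 * z.1.1)) (Real.pi / 2) z.1.2 * (Real.cosh z.2 : ℂ)) := by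
    refine Continuous.stronglyMeasurable ?_
    unfold productArg
    fun_prop
  have h2 := (h1.integral_prod_right' (ν := volume.restrict (Ioi (0 : ℝ)))).measurable
  simp only [← besselK_zero_eq] at h2
  exact Complex.measurable_re.comp h2

theorem lintegral_Ioi_eq_lintegral_exp (h : ℝ → ℝ≥0∞) :
    ∫⁻ x in Ioi (0 : ℝ), h x = ∫⁻ t : ℝ, ENNReal.ofReal (Real.exp t) * h (Real.exp t) := by
  have := lintegral_image_eq_lintegral_abs_deriv_mul (s := univ) MeasurableSet.univ
    (fun x _ => (Real.hasDerivAt_exp x).hasDerivWithinAt) Real.exp_injective.injOn h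
  rw [image_univ, Real.range_exp] at this
  simpa [abs_of_pos (Real.exp_pos _)] using this

theorem lintegral_comp_two_mul (h : ℝ → ℝ≥0∞) :
    ∫⁻ t : ℝ, h t = 2 * ∫⁻ t : ℝ, h (2 * t) := by
  have := lintegral_image_eq_lintegral_abs_deriv_mul (s := univ) (f := fun t : ℝ => 2 * t)
    (f' := fun _ => 2) MeasurableSet.univ
    (fun x _ => by simpa using (hasDerivAt_id x).const_mul (2 : ℝ))
    (mul_right_injective₀ two_ne_zero).injOn h
  have hr : (fun t : ℝ => 2 * t) '' univ = univ := by
    rw [image_univ]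
    exact (mul_left_surjective₀ two_ne_zero).range_eq
  rw [hr] at this
  simp only [Measure.restrict_univ] at this
  rw [this, lintegral_const_mul' _ _ (by simp)]
  simp

/-- The change of variables `ξ = √x e^(u/2)`, `η = √x e^(-u/2)`, in logarithmic coordinates. -/
theorem lintegral_lintegral_half_add_half_sub {g : ℝ → ℝ → ℝ≥0∞}
    (hg : Measurable (Function.uncurry g)) :
    ∫⁻ u : ℝ, ∫⁻ t : ℝ, g ((t + u) / 2) ((t - u) / 2) = 2 * ∫⁻ a : ℝ, ∫⁻ b : ℝ, g a b := by
  have h1 : ∀ u : ℝ, ∫⁻ t : ℝ, g ((t + u) / 2) ((t - u) / 2) = 2 * ∫⁻ a : ℝ, g a (a - u) := by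
    intro u
    rw [← lintegral_add_right_eq_self _ (-u), lintegral_comp_two_mul]
    congr 1
    refine lintegral_congr fun a => ?_
    rw [show (2 * a + -u + u) / 2 = a by ring]
    congr 1
    ring
  have hm : Measurable (Function.uncurry fun (u a : ℝ) => g a (a - u)) :=
    hg.comp (by fun_prop : Measurable fun z : ℝ × ℝ => (z.2, z.2 - z.1))
  simp only [h1]
  have hm' : Measurable fun u : ℝ => ∫⁻ a : ℝ, g a (a - u) := hm.lintegral_prod_right'
  rw [lintegral_const_mul _ hm', lintegral_lintegral_swap hm.aemeasurable]
  congr 1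
  refine lintegral_congr fun a => ?_
  exact lintegral_sub_left_eq_self (fun b => g a b) a

theorem lintegral_exp_mul_exp_neg_mul_exp {s c : ℝ} (hs : 0 < s) (hc : 0 < c) :
    ∫⁻ t : ℝ, ENNReal.ofReal (Real.exp (s * t) * Real.exp (-(c * Real.exp t))) =
      ENNReal.ofReal (Real.Gamma s * c ^ (-s)) := by
  have h := Real.integral_rpow_mul_exp_neg_mul_Ioi hs hc
  have hpos : 0 < (1 / c) ^ s * Real.Gamma s :=
    mul_pos (by positivity) (Real.Gamma_pos_of_pos hs)
  -- A non-integrable function has Bochner integral `0`, while the known value is positive; the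
  -- value formula thus forces integrability.
  have hi : Integrable (fun t : ℝ => t ^ (s - 1) * Real.exp (-(c * t)))
      (volume.restrict (Ioi 0)) := by
    by_contra hcon
    rw [integral_undef hcon] at h
    exact hpos.ne h
  rw [one_div, Real.inv_rpow hc.le, ← Real.rpow_neg hc.le, mul_comm _ (Real.Gamma s)] at h
  rw [← h, ofReal_integral_eq_lintegral_ofReal hi, lintegral_Ioi_eq_lintegral_exp]
  · refine lintegral_congr fun t => ?_
    have : Real.exp t * Real.exp t ^ (s - 1) = Real.exp (s * t) := by
      rw [← Real.exp_mul, ← Real.exp_add]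
      ring_nf
    rw [← ENNReal.ofReal_mul (Real.exp_pos _).le, ← mul_assoc, this]
  · filter_upwards [ae_restrict_mem measurableSet_Ioi] with t ht
    have : (0 : ℝ) < t := ht
    positivity

theorem integral_cosh_rpow_neg_eq (a : ℝ) :
    ∫ u : ℝ, Real.cosh u ^ (-a) = 2 * ∫ u in Ioi (0 : ℝ), Real.cosh u ^ (-a) := by
  rw [← integral_comp_abs (f := fun u => Real.cosh u ^ (-a))]
  simp

/-- `B(a, a) = 2^(2-2a) ∫_0^∞ cosh^(-2a)`. -/
theorem integral_cosh_rpow_eq_beta {a : ℝ} (ha : 0 < a) :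
    ∫ u in Ioi (0 : ℝ), Real.cosh u ^ (-(2 * a)) =
      2 ^ (2 * a - 2) * ProbabilityTheory.beta a a := by
  have hG := Real.Gamma_pos_of_pos ha
  have hG2 : 0 < Real.Gamma (2 * a) := Real.Gamma_pos_of_pos (by positivity)
  -- Write `Γ(a)²` as a double integral in logarithmic variables. Since `e^{(t+u)/2} + e^{(t-u)/2} =
  -- 2e^{t/2} cosh(u/2)`, the `t`-integral yields `Γ(2a) (2 cosh(u/2))^{-2a}`.
  have h := lintegral_lintegral_half_add_half_sub (g := fun s t =>
    ENNReal.ofReal (Real.exp (a * s) * Real.exp (-(1 * Real.exp s))) *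
      ENNReal.ofReal (Real.exp (a * t) * Real.exp (-(1 * Real.exp t)))) (by
      unfold Function.uncurry
      fun_prop)
  have hm : Measurable fun t : ℝ => ENNReal.ofReal (Real.exp (a * t) * Real.exp (-(1 * Real.exp t))) := by
    fun_prop
  simp only [lintegral_const_mul _ hm] at h
  rw [lintegral_mul_const _ hm, lintegral_exp_mul_exp_neg_mul_exp ha one_pos, Real.one_rpow,
    mul_one] at h
  have h1 : ∀ u : ℝ, ∫⁻ t : ℝ, ENNReal.ofReal (Real.exp (a * ((t + u) / 2)) *
      Real.exp (-(1 * Real.exp ((t + u) / 2)))) *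
      ENNReal.ofReal (Real.exp (a * ((t - u) / 2)) * Real.exp (-(1 * Real.exp ((t - u) / 2)))) =
      2 * ENNReal.ofReal (Real.Gamma (2 * a) * 2 ^ (-(2 * a)) * Real.cosh (u / 2) ^ (-(2 * a))) := by
    intro u
    have hcu := Real.cosh_pos (u / 2)
    rw [lintegral_comp_two_mul, mul_assoc, ← Real.mul_rpow zero_le_two hcu.le,
      ← lintegral_exp_mul_exp_neg_mul_exp (by positivity : 0 < 2 * a)
        (by positivity : 0 < 2 * Real.cosh (u / 2))]
    congr 1
    refine lintegral_congr fun t => ?_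
    rw [← ENNReal.ofReal_mul (by positivity), ← Real.exp_add, ← Real.exp_add, ← Real.exp_add,
      ← Real.exp_add, Real.cosh_eq]
    congr 2
    rw [show (2 * t + u) / 2 = t + u / 2 by ring, show (2 * t - u) / 2 = t + -(u / 2) by ring,
      Real.exp_add, Real.exp_add]
    ring
  simp only [h1] at h
  rw [lintegral_const_mul' _ _ (by simp)] at h
  have h2 := (ENNReal.mul_right_inj (by simp) (by simp)).1 h
  have hi : Integrable fun u : ℝ => Real.cosh u ^ (-(2 * a)) :=
    integrable_cosh_rpow_neg (by positivity)
  rw [lintegral_comp_two_mul] at h2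
  have h3 : ∀ u : ℝ, Real.cosh (2 * u / 2) = Real.cosh u := fun u => by congr 1; ring
  simp only [h3] at h2
  rw [← ofReal_integral_eq_lintegral_ofReal (hi.const_mul _)
    (.of_forall fun u => mul_nonneg (by positivity) (Real.rpow_nonneg (Real.cosh_pos u).le _)),
    integral_const_mul, ← ENNReal.ofReal_mul hG.le, ← ENNReal.ofReal_ofNat,
    ← ENNReal.ofReal_mul zero_le_two,
    integral_cosh_rpow_neg_eq] at h2
  set I := ∫ u in Ioi (0 : ℝ), Real.cosh u ^ (-(2 * a)) with hI
  have hI0 : 0 ≤ I := integral_nonneg fun u => Real.rpow_nonneg (Real.cosh_pos u).le _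
  have h4 := (ENNReal.ofReal_eq_ofReal_iff (by positivity) (by positivity)).1 h2
  rw [ProbabilityTheory.beta, ← two_mul, ← h4, Real.rpow_sub two_pos, Real.rpow_neg zero_le_two]
  have : (0 : ℝ) < 2 ^ (2 * a) := by positivity
  field_simp
  norm_num

/-- Hölder's inequality with a weight. -/
theorem lintegral_rpow_le_mul_lintegral {X : Type*} [MeasurableSpace X] {m : Measure X} {q : ℝ}
    (hq : 1 ≤ q) {F : X → ℝ≥0∞} {h : X → ℝ} (hF : AEMeasurable F m) (hh : Measurable h)
    (hpos : ∀ x, 0 < h x) :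
    (∫⁻ x, F x ∂m) ^ q ≤
      (∫⁻ x, ENNReal.ofReal (h x) ∂m) ^ (q - 1) * ∫⁻ x, F x ^ q * ENNReal.ofReal (h x ^ (1 - q)) ∂m := by
  rcases hq.eq_or_lt with rfl | hq1
  · simp
  have hc := Real.HolderConjugate.conjExponent hq1
  set r := q.conjExponent with hr
  have hr0 : 0 < r := hc.symm.pos
  have hq0 : 0 < q := by linarith
  have hrq : 1 / r * q = q - 1 := by
    have := hc.inv_add_inv_eq_one
    have h1 : 1 / r = 1 - q⁻¹ := by rw [one_div]; linarith
    rw [h1, sub_mul, inv_mul_cancel₀ hq0.ne', one_mul]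
  have key := ENNReal.lintegral_mul_le_Lp_mul_Lq m hc
    (f := fun x => F x * ENNReal.ofReal (h x ^ (-(1 / r)))) (g := fun x => ENNReal.ofReal (h x ^ (1 / r)))
    (hF.mul (by fun_prop)) (by fun_prop)
  have e1 : ∀ x, F x * ENNReal.ofReal (h x ^ (-(1 / r))) * ENNReal.ofReal (h x ^ (1 / r)) = F x := by
    intro x
    rw [mul_assoc, ← ENNReal.ofReal_mul (Real.rpow_nonneg (hpos x).le _), ← Real.rpow_add (hpos x)]
    simp
  have e2 : ∀ x, (F x * ENNReal.ofReal (h x ^ (-(1 / r)))) ^ q =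
      F x ^ q * ENNReal.ofReal (h x ^ (1 - q)) := by
    intro x
    rw [ENNReal.mul_rpow_of_nonneg _ _ hq0.le, ENNReal.ofReal_rpow_of_pos (Real.rpow_pos_of_pos (hpos x) _),
      ← Real.rpow_mul (hpos x).le, neg_mul, hrq, neg_sub]
  have e3 : ∀ x, ENNReal.ofReal (h x ^ (1 / r)) ^ r = ENNReal.ofReal (h x) := by
    intro x
    rw [ENNReal.ofReal_rpow_of_pos (Real.rpow_pos_of_pos (hpos x) _), ← Real.rpow_mul (hpos x).le,
      one_div_mul_cancel hr0.ne', Real.rpow_one]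
  simp only [Pi.mul_apply, e1, e2, e3] at key
  refine (ENNReal.rpow_le_rpow key hq0.le).trans (le_of_eq ?_)
  rw [ENNReal.mul_rpow_of_nonneg _ _ hq0.le, ← ENNReal.rpow_mul, ← ENNReal.rpow_mul, hrq,
    one_div_mul_cancel hq0.ne', ENNReal.rpow_one, mul_comm]

/-- The function `y ↦ K_0(2√(2y))`, as an integral with values in `[0, ∞]`. -/
noncomputable def lintegralExpCosh (y : ℝ) : ℝ≥0∞ :=
  ∫⁻ v in Ioi (0 : ℝ), ENNReal.ofReal (Real.exp (-(2 * √(2 * y)) * Real.cosh v))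

theorem measurable_lintegralExpCosh : Measurable lintegralExpCosh := by
  refine Measurable.lintegral_prod_right' (f := fun z : ℝ × ℝ =>
    ENNReal.ofReal (Real.exp (-(2 * √(2 * z.1)) * Real.cosh z.2))) ?_
  fun_prop

theorem enorm_kernelDensity_le {x : ℝ} (hx : 0 < x) (u : ℝ) :
    ‖kernelDensity x u‖ₑ ≤ lintegralExpCosh (x * Real.cosh u) := by
  rw [← ofReal_norm, Real.norm_eq_abs]
  refine (ENNReal.ofReal_le_ofReal (abs_kernelDensity_le hx u)).trans ?_
  rw [← Real.norm_of_nonneg (integral_nonneg fun v => (Real.exp_pos _).le), ofReal_norm]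
  refine (enorm_integral_le_lintegral_enorm _).trans (le_of_eq ?_)
  refine lintegral_congr fun v => ?_
  rw [← ofReal_norm, Real.norm_of_nonneg (Real.exp_pos _).le, ← mul_assoc 2 x,
    Real.sqrt_mul (by positivity : 0 ≤ 2 * x), ← mul_assoc 2]

/-- The `q`-th power of the `L_q(dx/x)` norm of `x ↦ x^a K_0(2√(2x cosh u))`. -/
noncomputable def majorantPow (a q u : ℝ) : ℝ≥0∞ :=
  ∫⁻ t : ℝ, (ENNReal.ofReal (Real.exp (a * t)) * lintegralExpCosh (Real.exp t * Real.cosh u)) ^ q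

/-- Translating `t` by `-log cosh u` removes `cosh u` from the argument of `K₀` and releases the
factor `cosh(u)^{-a}`. -/
theorem majorantPow_eq {a q : ℝ} (hq : 0 ≤ q) (u : ℝ) :
    majorantPow a q u = ENNReal.ofReal (Real.cosh u ^ (-a)) ^ q * majorantPow a q 0 := by
  have hc := Real.cosh_pos u
  unfold majorantPow
  rw [← lintegral_const_mul' _ _ (ENNReal.rpow_ne_top_of_nonneg hq ENNReal.ofReal_ne_top),
    ← lintegral_add_right_eq_self _ (-Real.log (Real.cosh u))]
  refine lintegral_congr fun t => ?_
  rw [← ENNReal.mul_rpow_of_nonneg _ _ hq, ← mul_assoc,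
    ← ENNReal.ofReal_mul (Real.rpow_nonneg hc.le _), Real.rpow_def_of_pos hc, ← Real.exp_add,
    Real.exp_add t, Real.exp_neg, Real.exp_log hc, mul_assoc, inv_mul_cancel₀ hc.ne',
    Real.cosh_zero]
  ring_nf

/-- With `2e^t cosh u = ξ² + η²` this is `(ξ+η)² ≤ 2(ξ²+η²)`. It decouples the exponential into a
function of `ξ` times a function of `η`. -/
theorem sqrt_two_mul_exp_mul_cosh_ge (t u : ℝ) :
    √2 * (Real.exp ((t + u) / 2) + Real.exp ((t - u) / 2)) ≤
      2 * √(2 * (Real.exp t * Real.cosh u)) := by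
  set ξ := Real.exp ((t + u) / 2)
  set η := Real.exp ((t - u) / 2)
  have h : 2 * (Real.exp t * Real.cosh u) = ξ ^ 2 + η ^ 2 := by
    rw [Real.cosh_eq, ← Real.exp_nat_mul, ← Real.exp_nat_mul]
    rw [show ((2 : ℕ) : ℝ) * ((t + u) / 2) = t + u by push_cast; ring,
      show ((2 : ℕ) : ℝ) * ((t - u) / 2) = t + -u by push_cast; ring, Real.exp_add, Real.exp_add]
    ring
  rw [h]
  have h2 : (2 : ℝ) = √2 * √2 := (Real.mul_self_sqrt zero_le_two).symm
  nth_rw 2 [h2]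
  rw [mul_assoc, ← Real.sqrt_mul zero_le_two]
  gcongr
  refine Real.le_sqrt_of_sq_le ?_
  nlinarith [sq_nonneg (ξ - η)]

/-- Hölder in `v` moves the power `q` inside the integral defining `K₀`. After the decoupling,
Tonelli leaves for each `v` the square of one Gamma integral; the leading `2` is the Jacobian of the
change of variables. -/
theorem lintegral_majorantPow_le {a q : ℝ} (ha : 0 < a) (hq : 1 ≤ q) :
    ∫⁻ u : ℝ, majorantPow a q u ≤
      2 * ENNReal.ofReal (Real.Gamma (a * q) * (√2 * q) ^ (-(a * q))) ^ 2 *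
        ENNReal.ofReal (∫ v in Ioi (0 : ℝ), Real.cosh v ^ (-(2 * a))) ^ q := by
  have hq0 : 0 < q := by linarith
  have hcp : ∀ v : ℝ, 0 < Real.cosh v := Real.cosh_pos
  have hhpos : ∀ v : ℝ, 0 < Real.cosh v ^ (-(2 * a)) := fun v => Real.rpow_pos_of_pos (hcp v) _
  have hhm : Measurable fun v : ℝ => Real.cosh v ^ (-(2 * a)) := by fun_prop
  have hI : Integrable (fun v : ℝ => Real.cosh v ^ (-(2 * a))) (volume.restrict (Ioi 0)) :=
    (integrable_cosh_rpow_neg (by positivity)).restrict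
  have hIeq : ∫⁻ v in Ioi (0 : ℝ), ENNReal.ofReal (Real.cosh v ^ (-(2 * a))) =
      ENNReal.ofReal (∫ v in Ioi (0 : ℝ), Real.cosh v ^ (-(2 * a))) :=
    (ofReal_integral_eq_lintegral_ofReal hI (.of_forall fun v => (hhpos v).le)).symm
  have hIpos : 0 < ∫ v in Ioi (0 : ℝ), Real.cosh v ^ (-(2 * a)) := by
    rw [integral_cosh_rpow_eq_beta ha]
    have := ProbabilityTheory.beta_pos ha ha
    positivity
  set I := ∫ v in Ioi (0 : ℝ), Real.cosh v ^ (-(2 * a))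
  let e : ℝ → ℝ → ℝ≥0∞ := fun v s =>
    ENNReal.ofReal (Real.exp (a * q * s) * Real.exp (-(√2 * q * Real.cosh v * Real.exp s)))
  -- The Hölder weight `cosh^{-2a}` reproduces itself: the Gamma integrals contribute
  -- `cosh(v)^{-2aq}`, which times `w v` is again `cosh(v)^{-2a}`. The final `v`-integral thus
  -- raises `I^(q-1)` to `I^q`.
  let w : ℝ → ℝ≥0∞ := fun v => ENNReal.ofReal ((Real.cosh v ^ (-(2 * a))) ^ (1 - q))
  have hem : Measurable (Function.uncurry e) := by
    unfold Function.uncurry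
    fun_prop
  have hwm : Measurable w := by fun_prop
  have hpt : ∀ u t v : ℝ, (ENNReal.ofReal (Real.exp (a * t)) *
      ENNReal.ofReal (Real.exp (-(2 * √(2 * (Real.exp t * Real.cosh u))) * Real.cosh v))) ^ q *
        w v ≤ e v ((t + u) / 2) * e v ((t - u) / 2) * w v := by
    intro u t v
    gcongr
    rw [← ENNReal.ofReal_mul (by positivity), ENNReal.ofReal_rpow_of_pos (by positivity),
      ← ENNReal.ofReal_mul (by positivity)]
    refine ENNReal.ofReal_le_ofReal ?_
    rw [← Real.exp_add, ← Real.exp_mul, ← Real.exp_add, ← Real.exp_add, ← Real.exp_add]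
    refine Real.exp_le_exp.2 ?_
    have := mul_le_mul_of_nonneg_left (sqrt_two_mul_exp_mul_cosh_ge t u)
      (mul_nonneg hq0.le (hcp v).le)
    nlinarith
  have hHol : ∀ u t : ℝ, (ENNReal.ofReal (Real.exp (a * t)) *
      lintegralExpCosh (Real.exp t * Real.cosh u)) ^ q ≤ ENNReal.ofReal I ^ (q - 1) *
        ∫⁻ v in Ioi (0 : ℝ), e v ((t + u) / 2) * e v ((t - u) / 2) * w v := by
    intro u t
    rw [lintegralExpCosh, ← lintegral_const_mul' _ _ ENNReal.ofReal_ne_top]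
    refine (lintegral_rpow_le_mul_lintegral hq (by fun_prop) hhm hhpos).trans ?_
    rw [hIeq]
    exact mul_le_mul_right (lintegral_mono fun v => hpt u t v) _
  have hm3 : Measurable fun z : ℝ × ℝ × ℝ =>
      e z.2.2 ((z.2.1 + z.1) / 2) * e z.2.2 ((z.2.1 - z.1) / 2) * w z.2.2 := by
    refine Measurable.mul (Measurable.mul ?_ ?_) (hwm.comp measurable_snd.snd)
    · exact hem.comp (by fun_prop : Measurable fun z : ℝ × ℝ × ℝ => (z.2.2, (z.2.1 + z.1) / 2))
    · exact hem.comp (by fun_prop : Measurable fun z : ℝ × ℝ × ℝ => (z.2.2, (z.2.1 - z.1) / 2))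
  have hIne : ENNReal.ofReal I ^ (q - 1) ≠ ∞ :=
    ENNReal.rpow_ne_top_of_nonneg (by linarith) ENNReal.ofReal_ne_top
  have hin : ∀ v : ℝ, ∫⁻ u : ℝ, ∫⁻ t : ℝ, e v ((t + u) / 2) * e v ((t - u) / 2) * w v =
      2 * ENNReal.ofReal (Real.Gamma (a * q) * (√2 * q) ^ (-(a * q))) ^ 2 *
        ENNReal.ofReal (Real.cosh v ^ (-(2 * a))) := by
    intro v
    have hev : Measurable (e v) := by fun_prop
    have hg : Measurable (Function.uncurry fun s t => e v s * e v t) := by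
      unfold Function.uncurry
      fun_prop
    have hev2 : ∫⁻ s : ℝ, e v s = ENNReal.ofReal
        (Real.Gamma (a * q) * (√2 * q * Real.cosh v) ^ (-(a * q))) :=
      lintegral_exp_mul_exp_neg_mul_exp (by positivity) (by have := hcp v; positivity)
    have hw : w v ≠ ∞ := ENNReal.ofReal_ne_top
    simp only [lintegral_mul_const' _ _ hw]
    rw [lintegral_lintegral_half_add_half_sub hg]
    simp only [lintegral_const_mul _ hev]
    rw [lintegral_mul_const _ hev, hev2, Real.mul_rpow (by positivity) (hcp v).le, ← mul_assoc (Real.Gamma _)]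
    have hG := Real.Gamma_pos_of_pos (mul_pos ha hq0)
    rw [ENNReal.ofReal_mul (by positivity)]
    have : ENNReal.ofReal (Real.cosh v ^ (-(a * q))) * ENNReal.ofReal (Real.cosh v ^ (-(a * q))) *
        w v = ENNReal.ofReal (Real.cosh v ^ (-(2 * a))) := by
      have h0 := Real.rpow_pos_of_pos (hcp v) (-(a * q))
      rw [← ENNReal.ofReal_mul h0.le, ← ENNReal.ofReal_mul (by positivity),
        ← Real.rpow_mul (hcp v).le, ← Real.rpow_add (hcp v), ← Real.rpow_add (hcp v)]
      ring_nf
    rw [← this]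
    ring
  calc ∫⁻ u : ℝ, majorantPow a q u
      ≤ ∫⁻ u : ℝ, ∫⁻ t : ℝ, ENNReal.ofReal I ^ (q - 1) *
          ∫⁻ v in Ioi (0 : ℝ), e v ((t + u) / 2) * e v ((t - u) / 2) * w v :=
        lintegral_mono fun u => lintegral_mono fun t => hHol u t
    _ = ENNReal.ofReal I ^ (q - 1) * ∫⁻ u : ℝ, ∫⁻ t : ℝ, ∫⁻ v in Ioi (0 : ℝ),
          e v ((t + u) / 2) * e v ((t - u) / 2) * w v := by
        simp only [lintegral_const_mul' _ _ hIne]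
    _ = ENNReal.ofReal I ^ (q - 1) * ∫⁻ u : ℝ, ∫⁻ v in Ioi (0 : ℝ), ∫⁻ t : ℝ,
          e v ((t + u) / 2) * e v ((t - u) / 2) * w v := by
        congr 1
        refine lintegral_congr fun u => lintegral_lintegral_swap ?_
        exact (hm3.comp (by fun_prop : Measurable fun z : ℝ × ℝ => (u, z.1, z.2))).aemeasurable
    _ = ENNReal.ofReal I ^ (q - 1) * ∫⁻ v in Ioi (0 : ℝ), ∫⁻ u : ℝ, ∫⁻ t : ℝ,
          e v ((t + u) / 2) * e v ((t - u) / 2) * w v := by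
        congr 1
        refine lintegral_lintegral_swap (Measurable.aemeasurable ?_)
        exact Measurable.lintegral_prod_right' (hm3.comp
          (by fun_prop : Measurable fun z : (ℝ × ℝ) × ℝ => (z.1.1, z.2, z.1.2)))
    _ = 2 * ENNReal.ofReal (Real.Gamma (a * q) * (√2 * q) ^ (-(a * q))) ^ 2 *
          ENNReal.ofReal I ^ q := by
        simp only [hin]
        rw [lintegral_const_mul' _ _ (by finiteness), hIeq, mul_left_comm]
        congr 1
        have h0 : ENNReal.ofReal I ≠ 0 := (ENNReal.ofReal_pos.2 hIpos).ne'
        nth_rw 2 [← ENNReal.rpow_one (ENNReal.ofReal I)]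
        rw [← ENNReal.rpow_add _ _ h0 ENNReal.ofReal_ne_top]
        simp

/-- The integral over `u` is a positive factor times the value at `u = 0`, and it has just been
bounded. So no separate analysis of `K₀` at `0` and `∞` is needed. -/
theorem majorantPow_zero_lt_top {a q : ℝ} (ha : 0 < a) (hq : 1 ≤ q) : majorantPow a q 0 < ∞ := by
  have hq0 : 0 ≤ q := by linarith
  have h := lintegral_majorantPow_le ha hq
  rw [lintegral_congr fun u => majorantPow_eq hq0 u] at h
  have hm : Measurable fun u : ℝ => ENNReal.ofReal (Real.cosh u ^ (-a)) ^ q := by fun_prop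
  rw [lintegral_mul_const _ hm] at h
  have hfin := h.trans_lt (ENNReal.mul_lt_top (by finiteness)
    (ENNReal.rpow_lt_top_of_nonneg hq0 ENNReal.ofReal_ne_top))
  by_contra hcon
  rw [not_lt_top_iff.1 hcon] at hfin
  have hne : ∫⁻ u : ℝ, ENNReal.ofReal (Real.cosh u ^ (-a)) ^ q ≠ 0 := by
    rw [Ne, lintegral_eq_zero_iff hm]
    intro h0
    obtain ⟨u, hu⟩ := h0.exists
    have hpos : 0 < ENNReal.ofReal (Real.cosh u ^ (-a)) :=
      ENNReal.ofReal_pos.2 (Real.rpow_pos_of_pos (Real.cosh_pos u) _)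
    exact (ENNReal.rpow_pos hpos ENNReal.ofReal_ne_top).ne' hu
  rw [ENNReal.mul_top hne] at hfin
  exact lt_irrefl _ hfin

theorem lintegral_rpow_mul_lintegralExpCosh {q : ℝ} (hq : 0 < q) (a u : ℝ) :
    ∫⁻ x in Ioi (0 : ℝ), (ENNReal.ofReal (x ^ (a - 1 / q)) *
      lintegralExpCosh (x * Real.cosh u)) ^ q = majorantPow a q u := by
  rw [lintegral_Ioi_eq_lintegral_exp, majorantPow]
  refine lintegral_congr fun t => ?_
  have : ENNReal.ofReal (Real.exp t) = ENNReal.ofReal (Real.exp (t / q)) ^ q := by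
    rw [ENNReal.ofReal_rpow_of_pos (Real.exp_pos _), ← Real.exp_mul, div_mul_cancel₀ _ hq.ne']
  rw [this, ← ENNReal.mul_rpow_of_nonneg _ _ hq.le, ← mul_assoc,
    ← ENNReal.ofReal_mul (Real.exp_pos _).le, ← Real.exp_mul, ← Real.exp_add]
  ring_nf

/-! ### Hölder in `x`, Fubini, and the bound for the transform. -/

theorem toReal_eq_one_or_holderConjugate {p q : ℝ≥0∞} (hp : 2 ≤ p) (hpq : p⁻¹ + q⁻¹ = 1) :
    (p = ∞ ∧ q = 1) ∨ (p ≠ ∞ ∧ p.toReal.HolderConjugate q.toReal) := by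
  by_cases h : p = ∞
  · subst h
    left
    simpa using hpq
  · right
    refine ⟨h, ?_⟩
    have hp2 : 2 ≤ p.toReal := by simpa using ENNReal.toReal_mono h hp
    have hp0 : p ≠ 0 := (lt_of_lt_of_le (by simp) hp).ne'
    have hq0 : q ≠ 0 := by
      rintro rfl
      simp at hpq
    rw [Real.holderConjugate_iff]
    refine ⟨by linarith, ?_⟩
    rw [← ENNReal.toReal_inv, ← ENNReal.toReal_inv, ← ENNReal.toReal_add (by simpa) (by simpa), hpq]
    rfl

theorem one_le_toReal_of_inv_add_inv_eq_one {p q : ℝ≥0∞} (hp : 2 ≤ p) (hpq : p⁻¹ + q⁻¹ = 1) :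
    1 ≤ q.toReal := by
  rcases toReal_eq_one_or_holderConjugate hp hpq with ⟨-, rfl⟩ | ⟨-, h⟩
  · simp
  · exact h.symm.lt.le

/-- Hölder's inequality in the variable `x`. -/
theorem lintegral_enorm_kernelDensity_mul_le {p q : ℝ≥0∞} (hp : 2 ≤ p) (hpq : p⁻¹ + q⁻¹ = 1)
    {ν : ℝ} {f : ℝ → ℂ} (hf : AEStronglyMeasurable f (volume.restrict (Ioi (0 : ℝ)))) (u : ℝ) :
    ∫⁻ x in Ioi (0 : ℝ), ‖kernelDensity x u‖ₑ * ‖f x‖ₑ ≤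
      weightedNorm ν p f * majorantPow (1 - ν) q.toReal u ^ (1 / q.toReal) := by
  have hM : Measurable fun x : ℝ => lintegralExpCosh (x * Real.cosh u) :=
    measurable_lintegralExpCosh.comp (by fun_prop)
  -- Used with `b = ν` if `p = ∞` and `b = ν - 1/p` otherwise. Then `x^b |f|` carries the weighted
  -- norm, and `-b = (1-ν) - 1/q` is the exponent that turns `dx` into `dx/x` in the majorant.
  have hsplit : ∀ (b : ℝ) {x : ℝ}, 0 < x → ‖kernelDensity x u‖ₑ * ‖f x‖ₑ ≤
      ENNReal.ofReal (x ^ b) * ‖f x‖ₑ *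
        (ENNReal.ofReal (x ^ (-b)) * lintegralExpCosh (x * Real.cosh u)) := by
    intro b x hx
    have h1 : ENNReal.ofReal (x ^ b) * ENNReal.ofReal (x ^ (-b)) = 1 := by
      rw [← ENNReal.ofReal_mul (by positivity), ← Real.rpow_add hx]
      simp
    calc ‖kernelDensity x u‖ₑ * ‖f x‖ₑ
        ≤ lintegralExpCosh (x * Real.cosh u) * ‖f x‖ₑ := by
          gcongr
          exact enorm_kernelDensity_le hx u
      _ = ENNReal.ofReal (x ^ b) * ENNReal.ofReal (x ^ (-b)) *
            (lintegralExpCosh (x * Real.cosh u) * ‖f x‖ₑ) := by rw [h1, one_mul]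
      _ = _ := by ring
  rcases toReal_eq_one_or_holderConjugate hp hpq with ⟨rfl, rfl⟩ | ⟨hpt, hc⟩
  · have hT := lintegral_rpow_mul_lintegralExpCosh one_pos (1 - ν) u
    simp only [ENNReal.rpow_one, div_one, ENNReal.toReal_one] at hT ⊢
    rw [← hT, ← lintegral_const_mul _ (by fun_prop), weightedNorm, if_pos rfl]
    refine lintegral_mono_ae ?_
    filter_upwards [ae_restrict_mem measurableSet_Ioi,
      ae_le_essSup (μ := volume.restrict (Ioi (0 : ℝ)))
        (f := fun x : ℝ => ENNReal.ofReal (x ^ ν) * ‖f x‖ₑ)] with x hx hle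
    refine (hsplit ν hx).trans ?_
    rw [show (1 : ℝ) - ν - 1 = -ν by ring]
    gcongr
  · have hq0 := hc.symm.pos
    have hp0 := hc.pos
    have hadd : 1 / p.toReal + 1 / q.toReal = 1 := by simpa using hc.inv_add_inv_eq_one
    have key := ENNReal.lintegral_mul_le_Lp_mul_Lq (volume.restrict (Ioi (0 : ℝ))) hc
      (f := fun x => ENNReal.ofReal (x ^ (ν - 1 / p.toReal)) * ‖f x‖ₑ)
      (g := fun x => ENNReal.ofReal (x ^ (-(ν - 1 / p.toReal))) *
        lintegralExpCosh (x * Real.cosh u))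
      (AEMeasurable.mul (by fun_prop) hf.enorm) (by fun_prop)
    rw [show -(ν - 1 / p.toReal) = 1 - ν - 1 / q.toReal by linarith,
      lintegral_rpow_mul_lintegralExpCosh hq0] at key
    refine (setLIntegral_mono_ae' measurableSet_Ioi (.of_forall fun x hx =>
      hsplit (ν - 1 / p.toReal) hx)).trans ?_
    rw [show -(ν - 1 / p.toReal) = 1 - ν - 1 / q.toReal by linarith]
    refine key.trans (le_of_eq ?_)
    rw [weightedNorm, if_neg hpt]
    congr 2
    refine setLIntegral_congr_fun measurableSet_Ioi fun x hx => ?_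
    have hx : (0 : ℝ) < x := hx
    rw [ENNReal.mul_rpow_of_nonneg _ _ hp0.le, ENNReal.ofReal_rpow_of_pos (by positivity),
      ← Real.rpow_mul hx.le, sub_mul, one_div_mul_cancel hp0.ne']

/-- The function whose Fourier transform is, up to scaling, the index transform of `f`. -/
noncomputable def kernelIntegral (f : ℝ → ℂ) (u : ℝ) : ℂ :=
  ∫ x in Ioi (0 : ℝ), (kernelDensity x u : ℂ) * f x

section

variable {f : ℝ → ℂ}

theorem majorantPow_rpow_eq {a q : ℝ} (hq : 0 < q) (u : ℝ) :
    majorantPow a q u ^ (1 / q) =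
      ENNReal.ofReal (Real.cosh u ^ (-a)) * majorantPow a q 0 ^ (1 / q) := by
  rw [majorantPow_eq hq.le, ENNReal.mul_rpow_of_nonneg _ _ (by positivity), ← ENNReal.rpow_mul,
    mul_one_div_cancel hq.ne', ENNReal.rpow_one]

theorem aestronglyMeasurable_kernelDensity_mul
    (hf : AEStronglyMeasurable f (volume.restrict (Ioi (0 : ℝ)))) :
    AEStronglyMeasurable (fun z : ℝ × ℝ => (kernelDensity z.1 z.2 : ℂ) * f z.1)
      ((volume.restrict (Ioi (0 : ℝ))).prod volume) :=
  (Complex.measurable_ofReal.comp measurable_kernelDensity).aestronglyMeasurable.mul hf.comp_fst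

theorem aestronglyMeasurable_kernelIntegral
    (hf : AEStronglyMeasurable f (volume.restrict (Ioi (0 : ℝ)))) :
    AEStronglyMeasurable (kernelIntegral f) :=
  (aestronglyMeasurable_kernelDensity_mul hf).prod_swap.integral_prod_right'

theorem enorm_kernelIntegral_le {p q : ℝ≥0∞} (hp : 2 ≤ p) (hpq : p⁻¹ + q⁻¹ = 1) {ν : ℝ}
   
    (hf : AEStronglyMeasurable f (volume.restrict (Ioi (0 : ℝ)))) (u : ℝ) :
    ‖kernelIntegral f u‖ₑ ≤
      weightedNorm ν p f * majorantPow (1 - ν) q.toReal u ^ (1 / q.toReal) := by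
  refine (enorm_integral_le_lintegral_enorm _).trans ?_
  refine le_trans (le_of_eq (lintegral_congr fun x => ?_))
    (lintegral_enorm_kernelDensity_mul_le hp hpq hf u)
  rw [enorm_mul]
  congr 1
  rw [← ofReal_norm, ← ofReal_norm, Complex.norm_real]

/-- The function is bounded by a multiple of `cosh(u)^{-(1-ν)}`, which decays because `ν < 1`. This
supplies the hypothesis of the Hausdorff–Young inequality. -/
theorem integrable_norm_kernelIntegral_rpow {p q : ℝ≥0∞} (hp : 2 ≤ p) (hpq : p⁻¹ + q⁻¹ = 1) {ν : ℝ}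
    (hν : ν < 1) (hf : MemWeightedLp ν p f) {s : ℝ} (hs : 0 < s) :
    Integrable fun u => ‖kernelIntegral f u‖ ^ s := by
  have hq := one_le_toReal_of_inv_add_inv_eq_one hp hpq
  have ha : 0 < 1 - ν := by linarith
  set C := weightedNorm ν p f * majorantPow (1 - ν) q.toReal 0 ^ (1 / q.toReal)
  have hC : C < ∞ := ENNReal.mul_lt_top hf.2
    (ENNReal.rpow_lt_top_of_nonneg (by positivity) (majorantPow_zero_lt_top ha hq).ne)
  refine Integrable.mono' ((integrable_cosh_rpow_neg (a := (1 - ν) * s) (by positivity)).const_mul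
    (C.toReal ^ s)) ?_ (.of_forall fun u => ?_)
  · exact ((aestronglyMeasurable_kernelIntegral hf.1).norm.aemeasurable.pow_const s).aestronglyMeasurable
  · have h := enorm_kernelIntegral_le hp hpq (ν := ν) hf.1 u
    rw [majorantPow_rpow_eq (by linarith), mul_left_comm] at h
    have hc := Real.rpow_pos_of_pos (Real.cosh_pos u) (-(1 - ν))
    have h2 := ENNReal.toReal_mono (ENNReal.mul_ne_top ENNReal.ofReal_ne_top hC.ne) h
    rw [toReal_enorm, ENNReal.toReal_mul, ENNReal.toReal_ofReal hc.le] at h2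
    rw [Real.norm_of_nonneg (Real.rpow_nonneg (norm_nonneg _) _)]
    refine (Real.rpow_le_rpow (norm_nonneg _) h2 hs.le).trans (le_of_eq ?_)
    rw [Real.mul_rpow hc.le ENNReal.toReal_nonneg, ← Real.rpow_mul (Real.cosh_pos u).le, mul_comm]
    ring_nf

theorem integrable_kernelDensity_mul {p q : ℝ≥0∞} (hp : 2 ≤ p) (hpq : p⁻¹ + q⁻¹ = 1) {ν : ℝ}
    (hν : ν < 1) (hf : MemWeightedLp ν p f) :
    Integrable (fun z : ℝ × ℝ => (kernelDensity z.1 z.2 : ℂ) * f z.1)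
      ((volume.restrict (Ioi (0 : ℝ))).prod volume) := by
  have hq := one_le_toReal_of_inv_add_inv_eq_one hp hpq
  have ha : 0 < 1 - ν := by linarith
  have hm := aestronglyMeasurable_kernelDensity_mul hf.1
  refine ⟨hm, ?_⟩
  rw [HasFiniteIntegral, lintegral_prod_symm _ hm.enorm]
  have hT : majorantPow (1 - ν) q.toReal 0 ^ (1 / q.toReal) < ∞ :=
    ENNReal.rpow_lt_top_of_nonneg (by positivity) (majorantPow_zero_lt_top ha hq).ne
  have hle : ∀ u : ℝ, ∫⁻ x in Ioi (0 : ℝ), ‖(kernelDensity x u : ℂ) * f x‖ₑ ≤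
      weightedNorm ν p f * (ENNReal.ofReal (Real.cosh u ^ (-(1 - ν))) *
        majorantPow (1 - ν) q.toReal 0 ^ (1 / q.toReal)) := by
    intro u
    rw [← majorantPow_rpow_eq (by linarith)]
    refine le_trans (le_of_eq (lintegral_congr fun x => ?_))
      (lintegral_enorm_kernelDensity_mul_le hp hpq hf.1 u)
    rw [enorm_mul]
    congr 1
    rw [← ofReal_norm, ← ofReal_norm, Complex.norm_real]
  refine (lintegral_mono hle).trans_lt ?_
  rw [lintegral_const_mul' _ _ hf.2.ne, lintegral_mul_const' _ _ hT.ne]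
  refine ENNReal.mul_lt_top hf.2 (ENNReal.mul_lt_top ?_ hT)
  exact (integrable_cosh_rpow_neg ha).lintegral_lt_top

theorem integrable_exp_mul_kernelDensity_mul {p q : ℝ≥0∞} (hp : 2 ≤ p) (hpq : p⁻¹ + q⁻¹ = 1) {ν : ℝ}
    (hν : ν < 1) (hf : MemWeightedLp ν p f) (τ : ℝ) :
    Integrable (Function.uncurry fun x u : ℝ =>
      Complex.exp (Complex.I * τ * u) * ((kernelDensity x u : ℂ) * f x))
      ((volume.restrict (Ioi (0 : ℝ))).prod volume) := by
  refine (integrable_kernelDensity_mul hp hpq hν hf).bdd_mul (c := 1) ?_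
    (.of_forall fun z => le_of_eq ?_)
  · exact Continuous.aestronglyMeasurable (by fun_prop)
  · rw [mul_assoc, mul_comm, ← Complex.ofReal_mul, Complex.norm_exp_ofReal_mul_I]

theorem indexKernel_mul_eq {τ x : ℝ} (hτ : τ ≠ 0) (hx : 0 < x) (f : ℝ → ℂ) :
    indexKernel τ x * f x = -(1 / Real.pi : ℝ) *
      ∫ u : ℝ, Complex.exp (Complex.I * τ * u) * ((kernelDensity x u : ℂ) * f x) := by
  rw [indexKernel_eq_integral hτ hx, mul_assoc, ← integral_mul_const]
  simp only [mul_assoc]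

/-- The kernel is itself an integral over `u`, so absolute convergence in `x` is a marginal of
integrability on the product; no pointwise bounds on Bessel functions enter. -/
theorem integrableOn_indexKernel_mul {p q : ℝ≥0∞} (hp : 2 ≤ p) (hpq : p⁻¹ + q⁻¹ = 1) {ν : ℝ}
    (hν : ν < 1) (hf : MemWeightedLp ν p f) {τ : ℝ} (hτ : τ ≠ 0) :
    IntegrableOn (fun x => indexKernel τ x * f x) (Ioi 0) volume := by
  refine (integrableOn_congr_fun (fun x hx => indexKernel_mul_eq hτ hx f) measurableSet_Ioi).2 ?_
  exact (integrable_exp_mul_kernelDensity_mul hp hpq hν hf τ).integral_prod_left.const_mul _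

theorem indexTransform_eq_fourier {p q : ℝ≥0∞} (hp : 2 ≤ p) (hpq : p⁻¹ + q⁻¹ = 1) {ν : ℝ}
    (hν : ν < 1) (hf : MemWeightedLp ν p f) {τ : ℝ} (hτ : τ ≠ 0) :
    indexTransform f τ =
      -(1 / Real.pi : ℝ) * 𝓕 (kernelIntegral f) (-(2 * Real.pi)⁻¹ * τ) := by
  rw [indexTransform, setIntegral_congr_fun measurableSet_Ioi
    (fun x hx => indexKernel_mul_eq hτ hx f), integral_const_mul,
    integral_integral_swap (integrable_exp_mul_kernelDensity_mul hp hpq hν hf τ),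
    Real.fourier_real_eq_integral_exp_smul]
  congr 1
  refine integral_congr_ae (.of_forall fun u => ?_)
  simp only [integral_const_mul, smul_eq_mul]
  rw [kernelIntegral]
  congr 2
  push_cast
  field_simp

/-- At `τ = 0` the kernel divides by `sinh 0 = 0`, and such a quotient is `0`. -/
theorem indexTransform_zero (f : ℝ → ℂ) : indexTransform f 0 = 0 := by
  simp [indexTransform, indexKernel]

theorem eLpNorm_comp_mul_left {g : ℝ → ℂ} {c : ℝ} (hc : c ≠ 0) (p : ℝ≥0∞) :
    eLpNorm (fun x => g (c * x)) p volume =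
      ENNReal.ofReal |c⁻¹| ^ p⁻¹.toReal * eLpNorm g p volume := by
  have h := (Homeomorph.mulLeft₀ c hc).measurableEmbedding.eLpNorm_map_measure
    (g := g) (p := p) (μ := volume)
  have hm : Measure.map (Homeomorph.mulLeft₀ c hc) volume = ENNReal.ofReal |c⁻¹| • volume :=
    Real.map_volume_mul_left hc
  rw [hm, eLpNorm_smul_measure_of_ne_zero (by simpa using hc), one_div, smul_eq_mul] at h
  exact h.symm

theorem eLpNorm_kernelIntegral_le {p q : ℝ≥0∞} (hp : 2 ≤ p) (hpq : p⁻¹ + q⁻¹ = 1) {ν : ℝ}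
    (hν : ν < 1) (hf : MemWeightedLp ν p f) :
    eLpNorm (kernelIntegral f) q volume ≤ weightedNorm ν p f *
      (2 * ENNReal.ofReal (Real.Gamma ((1 - ν) * q.toReal) *
        (√2 * q.toReal) ^ (-((1 - ν) * q.toReal))) ^ 2 *
        ENNReal.ofReal (∫ v in Ioi (0 : ℝ), Real.cosh v ^ (-(2 * (1 - ν)))) ^ q.toReal) ^
          (1 / q.toReal) := by
  have hq := one_le_toReal_of_inv_add_inv_eq_one hp hpq
  have hq0 : 0 < q.toReal := by linarith
  obtain ⟨h0, ht⟩ := ENNReal.toReal_pos_iff.1 hq0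
  rw [eLpNorm_eq_lintegral_rpow_enorm_toReal h0.ne' ht.ne]
  calc (∫⁻ u, ‖kernelIntegral f u‖ₑ ^ q.toReal) ^ (1 / q.toReal)
      ≤ (∫⁻ u, weightedNorm ν p f ^ q.toReal * majorantPow (1 - ν) q.toReal u) ^
          (1 / q.toReal) := by
        gcongr with u
        refine (ENNReal.rpow_le_rpow (enorm_kernelIntegral_le hp hpq (ν := ν) hf.1 u) hq0.le).trans
          (le_of_eq ?_)
        rw [ENNReal.mul_rpow_of_nonneg _ _ hq0.le, ← ENNReal.rpow_mul,
          one_div_mul_cancel hq0.ne', ENNReal.rpow_one]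
    _ = weightedNorm ν p f * (∫⁻ u, majorantPow (1 - ν) q.toReal u) ^ (1 / q.toReal) := by
        rw [lintegral_const_mul' _ _ (ENNReal.rpow_ne_top_of_nonneg hq0.le hf.2.ne),
          ENNReal.mul_rpow_of_nonneg _ _ (by positivity), ← ENNReal.rpow_mul,
          mul_one_div_cancel hq0.ne', ENNReal.rpow_one]
    _ ≤ _ := by
        gcongr
        exact lintegral_majorantPow_le (by linarith) hq

/-- The factor `1/π` comes from the kernel formula, `(2π)^{1/p}` from the dilation of the Fourier
variable, and the rest from the `L_q` bound. With `a = 1 - ν` the powers of `2` have total exponent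
`1/p + 1/q - a + (2a - 2) = -ν`. -/
theorem indexBound_eq {p q : ℝ≥0∞} (hp : 2 ≤ p) (hpq : p⁻¹ + q⁻¹ = 1) {ν : ℝ}
    (hν : ν < 1) :
    ENNReal.ofReal (1 / Real.pi) * (ENNReal.ofReal (2 * Real.pi) ^ p⁻¹.toReal *
      (2 * ENNReal.ofReal (Real.Gamma ((1 - ν) * q.toReal) *
        (√2 * q.toReal) ^ (-((1 - ν) * q.toReal))) ^ 2 *
        ENNReal.ofReal (∫ v in Ioi (0 : ℝ), Real.cosh v ^ (-(2 * (1 - ν)))) ^ q.toReal) ^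
          (1 / q.toReal)) = ENNReal.ofReal (indexBound ν p q) := by
  have hq := one_le_toReal_of_inv_add_inv_eq_one hp hpq
  have hq0 : 0 < q.toReal := by linarith
  have ha : 0 < 1 - ν := by linarith
  have hadd : p⁻¹.toReal + 1 / q.toReal = 1 := by
    rw [one_div, ← ENNReal.toReal_inv, ← ENNReal.toReal_add, hpq, ENNReal.toReal_one]
    · intro h
      simp [h] at hpq
    · intro h
      simp [h] at hpq
  have hB := ProbabilityTheory.beta_pos ha ha
  have hG := Real.Gamma_pos_of_pos (mul_pos ha hq0)
  have hpi := Real.pi_pos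
  rw [integral_cosh_rpow_eq_beta ha, ← ENNReal.ofReal_ofNat, ← ENNReal.ofReal_pow (by positivity),
    ENNReal.ofReal_rpow_of_pos (by positivity), ENNReal.ofReal_rpow_of_pos (by positivity),
    ← ENNReal.ofReal_mul (by positivity), ← ENNReal.ofReal_mul (by positivity),
    ENNReal.ofReal_rpow_of_pos (by positivity), ← ENNReal.ofReal_mul (by positivity),
    ← ENNReal.ofReal_mul (by positivity), indexBound]
  congr 1
  set Q := q.toReal
  set d := p⁻¹.toReal
  rw [mul_comm Q (1 - ν)]
  set G := Real.Gamma ((1 - ν) * Q)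
  set B := ProbabilityTheory.beta (1 - ν) (1 - ν)
  have hs : √2 = (2 : ℝ) ^ (1 / 2 : ℝ) := Real.sqrt_eq_rpow 2
  have hdv : 1 / Q = 1 - d := by linarith
  have hQQ : Q * (1 / Q) = 1 := mul_one_div_cancel hq0.ne'
  have e1 : (2 * (G * (√2 * Q) ^ (-((1 - ν) * Q))) ^ 2 * (2 ^ (2 * (1 - ν) - 2) * B) ^ Q) ^ (1 / Q) =
      2 ^ (1 / Q) * (G ^ (2 / Q) * (√2 * Q) ^ (-(2 * (1 - ν)))) * (2 ^ (2 * (1 - ν) - 2) * B) := by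
    rw [Real.mul_rpow (by positivity) (by positivity), Real.mul_rpow (by positivity) (by positivity),
      ← Real.rpow_mul (by positivity), hQQ, Real.rpow_one, ← Real.rpow_natCast,
      ← Real.rpow_mul (by positivity), Real.mul_rpow (by positivity) (by positivity),
      ← Real.rpow_mul (by positivity)]
    congr 4
    · push_cast
      ring
    · push_cast
      linear_combination (-(2 * (1 - ν))) * hQQ
  rw [e1, Real.mul_rpow zero_le_two hpi.le, Real.mul_rpow (by positivity) hq0.le, hs,
    ← Real.rpow_mul zero_le_two, Real.rpow_sub_one hpi.ne', hdv]
  have e2 : (2 : ℝ) ^ (-ν) = 2 ^ d * (2 ^ (1 - d) * (2 ^ (1 / 2 * -(2 * (1 - ν))) *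
      2 ^ (2 * (1 - ν) - 2))) := by
    rw [← Real.rpow_add two_pos, ← Real.rpow_add two_pos, ← Real.rpow_add two_pos]
    ring_nf
  rw [e2, show 2 * (ν - 1) = -(2 * (1 - ν)) by ring]
  field_simp

theorem indexTransform_ae_eq {p q : ℝ≥0∞} (hp : 2 ≤ p) (hpq : p⁻¹ + q⁻¹ = 1) {ν : ℝ}
    (hν : ν < 1) (hf : MemWeightedLp ν p f) :
    indexTransform f =ᵐ[volume]
      (-(1 / Real.pi : ℝ) : ℂ) • fun τ => 𝓕 (kernelIntegral f) (-(2 * Real.pi)⁻¹ * τ) := by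
  filter_upwards [compl_mem_ae_iff.2 (measure_singleton (0 : ℝ))] with τ hτ
  exact indexTransform_eq_fourier hp hpq hν hf hτ

theorem eLpNorm_indexTransform_le {p q : ℝ≥0∞} (hp : 2 ≤ p) (hpq : p⁻¹ + q⁻¹ = 1) {ν : ℝ}
    (hν : ν < 1) (hf : MemWeightedLp ν p f) :
    eLpNorm (indexTransform f) p volume ≤
      ENNReal.ofReal (indexBound ν p q) * weightedNorm ν p f := by
  have hpi := Real.pi_pos
  have hc : -(2 * Real.pi)⁻¹ ≠ 0 := neg_ne_zero.2 (by positivity)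
  rw [eLpNorm_congr_ae (indexTransform_ae_eq hp hpq hν hf)]
  refine (eLpNorm_const_smul_le (f := fun τ : ℝ =>
    𝓕 (kernelIntegral f) (-(2 * Real.pi)⁻¹ * τ))).trans ?_
  rw [eLpNorm_comp_mul_left hc, ← indexBound_eq hp hpq hν]
  have h1 : ‖(-(1 / Real.pi : ℝ) : ℂ)‖ₑ = ENNReal.ofReal (1 / Real.pi) := by
    rw [enorm_neg, ← ofReal_norm, Complex.norm_real, Real.norm_of_nonneg (by positivity)]
  have h2 : |(-(2 * Real.pi)⁻¹)⁻¹| = 2 * Real.pi := by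
    rw [inv_neg, inv_inv, abs_neg, abs_of_pos (by positivity)]
  rw [h1, h2]
  have h3 := (eLpNorm_fourier_le hpq hp (aestronglyMeasurable_kernelIntegral hf.1)
    fun s hs => integrable_norm_kernelIntegral_rpow hp hpq hν hf hs).trans
      (eLpNorm_kernelIntegral_le hp hpq hν hf)
  calc _ ≤ _ := mul_le_mul_right (mul_le_mul_right h3 _) _
    _ = _ := by
      rw [mul_comm (weightedNorm ν p f), ← mul_assoc _ _ (weightedNorm ν p f), ← mul_assoc _ _ (weightedNorm ν p f)]

theorem memLp_indexTransform {p q : ℝ≥0∞} (hp : 2 ≤ p) (hpq : p⁻¹ + q⁻¹ = 1) {ν : ℝ}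
    (hν : ν < 1) (hf : MemWeightedLp ν p f) : MemLp (indexTransform f) p volume := by
  refine ⟨?_, (eLpNorm_indexTransform_le hp hpq hν hf).trans_lt
    (ENNReal.mul_lt_top ENNReal.ofReal_lt_top hf.2)⟩
  have hi : Integrable (kernelIntegral f) := by
    rw [← integrable_norm_iff (aestronglyMeasurable_kernelIntegral hf.1)]
    simpa using integrable_norm_kernelIntegral_rpow hp hpq hν hf one_pos
  have hcont := continuous_fourier_of_integrable hi
  refine AEStronglyMeasurable.congr (AEStronglyMeasurable.const_smul ?_ _)
    (indexTransform_ae_eq hp hpq hν hf).symm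
  exact Continuous.aestronglyMeasurable (by fun_prop)

theorem indexTransform_congr {g : ℝ → ℂ} (h : f =ᵐ[volume.restrict (Ioi (0 : ℝ))] g) :
    indexTransform f = indexTransform g := by
  funext τ
  exact integral_congr_ae (h.mono fun x hx => by simp only [hx])

theorem indexTransform_add {p q : ℝ≥0∞} (hp : 2 ≤ p) (hpq : p⁻¹ + q⁻¹ = 1) {ν : ℝ}
    (hν : ν < 1) {g : ℝ → ℂ} (hf : MemWeightedLp ν p f) (hg : MemWeightedLp ν p g) :
    indexTransform (f + g) = indexTransform f + indexTransform g := by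
  funext τ
  rcases eq_or_ne τ 0 with rfl | hτ
  · simp [indexTransform_zero]
  · rw [Pi.add_apply, indexTransform, indexTransform, indexTransform,
      ← integral_add (integrableOn_indexKernel_mul hp hpq hν hf hτ)
        (integrableOn_indexKernel_mul hp hpq hν hg hτ)]
    simp only [Pi.add_apply, mul_add]

theorem indexTransform_smul (c : ℂ) (f : ℝ → ℂ) :
    indexTransform (c • f) = c • indexTransform f := by
  funext τ
  rw [Pi.smul_apply, indexTransform, indexTransform, smul_eq_mul, ← integral_const_mul]
  simp only [Pi.smul_apply, smul_eq_mul, mul_left_comm]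

end

theorem corollary4 (p q : ℝ≥0∞) (hp : 2 ≤ p) (hpq : p⁻¹ + q⁻¹ = 1) (ν : ℝ) (hν : ν < 1) :
    -- `F` maps `L_{ν,p}(ℝ₊)` into `L_p(ℝ)`, the integral being absolutely convergent, with the bound
    (∀ f : ℝ → ℂ, MemWeightedLp ν p f →
      (∀ τ : ℝ, τ ≠ 0 → IntegrableOn (fun x => indexKernel τ x * f x) (Ioi 0) volume) ∧
      MemLp (indexTransform f) p volume ∧
      eLpNorm (indexTransform f) p volume ≤
        ENNReal.ofReal (indexBound ν p q) * weightedNorm ν p f) ∧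
    -- `F` does not depend on the representative, and it is linear
    (∀ f g : ℝ → ℂ, f =ᵐ[volume.restrict (Ioi (0 : ℝ))] g →
      indexTransform f = indexTransform g) ∧
    (∀ f g : ℝ → ℂ, MemWeightedLp ν p f → MemWeightedLp ν p g →
      indexTransform (f + g) = indexTransform f + indexTransform g) ∧
    (∀ (c : ℂ) (f : ℝ → ℂ), MemWeightedLp ν p f →
      indexTransform (c • f) = c • indexTransform f) := by
  refine ⟨fun f hf => ⟨fun τ hτ => integrableOn_indexKernel_mul hp hpq hν hf hτ,
    memLp_indexTransform hp hpq hν hf, eLpNorm_indexTransform_le hp hpq hν hf⟩,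
    fun f g h => indexTransform_congr h,
    fun f g hf hg => indexTransform_add hp hpq hν hf hg,
    fun c f _ => indexTransform_smul c f⟩
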